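/- \textbf{Conventions.} Let $\Bbbk$ be a field, $\Gamma$ a group, $V$ a finite-dimensional (left) Yetter--Drinfeld module over $\Bbbk\Gamma$, and $\operatorname{supp}(V)\trianglelefteq\Gamma$ the subgroup generated by the degrees of the nonzero homogeneous elements of $V$. Let $\mathcal B$ be a pre-Nichols algebra of $V$, i.e. a graded Hopf algebra in Yetter--Drinfeld modules that is a quotient of the tensor algebra $T(V)$ (with $V$ primitive) by a homogeneous Hopf ideal in degrees $\ge 2$. Let $H=\mathcal B\#\Bbbk\Gamma$ be the bosonization and $G$ a group. For a Hopf algebra $H$, an \emph{associative $G$-zesting datum} consists of a surjective Hopf algebra map $\pi:H\to\Bbbk G$ which is cocentral ($h_{(1)}\otimes\pi(h_{(2)})=h_{(2)}\otimes\pi(h_{(1)})$), a subgroup $\Gamma_0$ of the group of $\pi$-coinvariant group-like elements of $H$, and a triple $(\gamma,\lambda,\omega)$, where \begin{itemize} \item $\gamma:\Gamma_0\to\operatorname{Alg}(H,\Bbbk)$ is a group homomorphism (for the convolution product) with $\langle\gamma(g),h_{(1)}\rangle\,h_{(2)}\,g=g\,h_{(1)}\langle\gamma(g),h_{(2)}\rangle$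 for $g\in\Gamma_0$, $h\in H$; \item $\lambda:G\times G\to\Gamma_0$ is a normalized 2-cocycle; \item $\omega:G^3\to\Bbbk^\times$ is a normalized 3-cochain (equal to $1$ if one of its arguments is $1$) such that for all $g_1,\dots,g_4\in G$ $$\langle\gamma(\lambda(g_1,g_2)),\lambda(g_3,g_4)\rangle=\frac{\omega(g_1,g_2,g_3)\,\omega(g_1,g_2g_3,g_4)\,\omega(g_2,g_3,g_4)}{\omega(g_1g_2,g_3,g_4)\,\omega(g_1,g_2,g_3g_4)}.\qquad(*)$$ \end{itemize} The map $\pi$ defines a grading $H=\bigoplus_{g\in G}H_g$, $H_g=\{h:\pi(h_{(1)})\otimes h_{(2)}=g\otimes h\}$. By a coquasi-Hopf algebra we mean a coquasi-bialgebra with associator $\Omega$, where $(hk)l$ and $h(kl)$ are related by $(h_{(1)}k_{(1)})l_{(1)}\,\Omega(h_{(2)},k_{(2)},l_{(2)})=\Omega(h_{(1)},k_{(1)},l_{(1)})\,h_{(2)}(k_{(2)}l_{(2)})$, together with a linear map $S$ and functionals $\alpha,\beta$ satisfying $S(h_{(1)})\alpha(h_{(2)})h_{(3)}=\alpha(h)1$,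 $h_{(1)}\beta(h_{(2)})S(h_{(3)})=\beta(h)1$ and $$\Omega^{-1}(h_{(1)}\beta(h_{(2)}),S(h_{(3)}),\alpha(h_{(4)})h_{(5)})=\varepsilon(h)=\Omega(S(h_{(1)}),\alpha(h_{(2)})h_{(3)}\beta(h_{(4)}),S(h_{(5)})).$$ A \emph{relative $r$-form} for a Hopf subalgebra $K\subseteq H$ is a bilinear map $r:H\times K\to\Bbbk$ with $r(hh',x)=r(h',x_{(1)})r(h,x_{(2)})$, $r(h,xx')=r(h_{(1)},x)r(h_{(2)},x')$, $r(h,1)=\varepsilon(h)$, $r(1,x)=\varepsilon(x)$ and $r(h_{(1)},x_{(1)})x_{(2)}h_{(2)}=h_{(1)}x_{(1)}r(h_{(2)},x_{(2)})$. \textbf{Theorem.} For $H=\mathcal B\#\Bbbk\Gamma$ as above consider the following choices: \begin{enumerate} \item a surjective group homomorphism $\iota:\Gamma/\operatorname{supp}(V)\to G$ (write also $\iota$ for the composite $\Gamma\to G$); \item a pair $(\Gamma_0,\Phi)$, where $\Gamma_0$ is a central subgroup of $\Gamma$ contained in $\ker(\Gamma\to G)$ and $\Phi:\Gamma_0\to\operatorname{Hom}(\Gamma,\Bbbk^\times)$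 is a group homomorphism with $g\cdot x=\langle h,\Phi(g)\rangle x$ for all $g\in\Gamma_0$ and all $x\in V$ homogeneous of degree $h$; \item a normalized 2-cocycle $\lambda:G\times G\to\Gamma_0$; \item a normalized 3-cochain $\omega:G^3\to\Bbbk^\times$ satisfying $(*)$ with $\langle\gamma(g),h\rangle:=\langle h,\Phi(g)\rangle$ for $g,h\in\Gamma_0$. \end{enumerate} Then: \begin{itemize} \item[(a)] Each such choice determines exactly one associative $G$-zesting datum for $H$ by $\pi(x\#g)=\varepsilon(x)\iota(g)$, $\Gamma_0=1\#\Gamma_0$, $\langle\gamma(g),x\#h\rangle=\varepsilon(x)\langle h,\Phi(g)\rangle$, and the same $\lambda,\omega$. \item[(b)] For every associative $G$-zesting datum for $H$ there is exactly one choice $(\iota,\Gamma_0,\Phi,\lambda,\omega)$ with $\pi(x\#g)=\varepsilon(x)\iota(g)$, the same $\Gamma_0,\lambda,\omega$, and $\langle\gamma(g),1\#h\rangle=\langle h,\Phi(g)\rangle$. The datum is the one determined by this choice as in (a) if and only if all $\gamma(g)$ vanish on the elements of $V$ that are homogeneous of degree $1\in\Gamma$; this always holds if $V$ has no nonzero such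 elements, and also if $\mathcal B$ is finite-dimensional. \item[(c)] For every associative $G$-zesting datum with associated choice as in (b), there is a relative $r$-form $r$ for $\Bbbk\Gamma_0\subseteq H$ with $r(h,g)=\langle\gamma(g^{-1}),h\rangle$ for $g\in\Gamma_0$. Moreover there is a coquasi-Hopf algebra $H^\lambda$ with the same underlying coalgebra and unit as $H$, such that for $h\in H_{g_1}$, $k\in H_{g_2}$, $l\in H_{g_3}$ $$m^\lambda(h\otimes k)=hk\,\lambda(g_1,g_2),\qquad\Omega(h,k,l)=\varepsilon(hk)\,\omega(g_1,g_2,g_3)\,\langle\gamma(\lambda(g_1,g_2)),l\rangle.$$ Explicitly, for $x,y,z\in\mathcal B$ and $g,h,k\in\Gamma$, $$m^\lambda((x\#g)\otimes(y\#h))=x(g\cdot y)\#gh\,\lambda(\iota(g),\iota(h)),$$ and, if the datum is determined by the choice as in (a), $$\Omega(x\#g,y\#h,z\#k)=\varepsilon(x)\varepsilon(y)\varepsilon(z)\,\omega(\iota(g),\iota(h),\iota(k))\,\langle k,\Phi(\lambda(\iota(g),\iota(h)))\rangle.$$ \end{itemize} -/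

import Mathlib

open scoped TensorProduct

set_option linter.unusedSectionVars false

/-- A Yetter--Drinfeld module over the group algebra `k[Γ]`: a `k`-linear `Γ`-action together with
a `k[Γ]`-coaction.  The coaction is recorded by homogeneous components: identifying `k[Γ] ⊗ V` with
`Γ →₀ V`, one has `coact v = ∑ g, g ⊗ v_g`.  The first two axioms are the counit axiom
`v = ∑ g, v_g` and coassociativity `(v_g)_h = δ_{g,h} v_g`, the third is the Yetter--Drinfeld
compatibility `(h • v)_{h g h⁻¹} = h • v_g`. -/
class YetterDrinfeld (k Γ V : Type*) [Field k] [Group Γ] [AddCommGroup V] [Module k V]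
    [DistribMulAction Γ V] [SMulCommClass Γ k V] where
  coact : V →ₗ[k] (Γ →₀ V)
  coact_sum : ∀ v, ((coact v).sum fun _ w => w) = v
  coact_coact : ∀ v g, coact (coact v g) = Finsupp.single g (coact v g)
  coact_smul : ∀ (h g : Γ) v, coact (h • v) (h * g * h⁻¹) = h • coact v g

namespace YetterDrinfeld

section
variable (k Γ : Type*) {V W : Type*} [Field k] [Group Γ]
  [AddCommGroup V] [Module k V] [DistribMulAction Γ V] [SMulCommClass Γ k V]
  [YetterDrinfeld k Γ V]
  [AddCommGroup W] [Module k W] [DistribMulAction Γ W] [SMulCommClass Γ k W]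
  [YetterDrinfeld k Γ W]

/-- `v` is homogeneous of degree `g`, i.e. its coaction is `g ⊗ v`. -/
def IsHomogeneous (k : Type*) {Γ V : Type*} [Field k] [Group Γ] [AddCommGroup V] [Module k V]
    [DistribMulAction Γ V] [SMulCommClass Γ k V] [YetterDrinfeld k Γ V] (g : Γ) (v : V) : Prop :=
  coact (k := k) v = Finsupp.single g v

/-- The Yetter--Drinfeld braiding `c (v ⊗ w) = v_(-1) • w ⊗ v_(0)`. -/
noncomputable def braiding (V W : Type*)
    [AddCommGroup V] [Module k V] [DistribMulAction Γ V] [SMulCommClass Γ k V]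
    [YetterDrinfeld k Γ V]
    [AddCommGroup W] [Module k W] [DistribMulAction Γ W] [SMulCommClass Γ k W] :
    V ⊗[k] W →ₗ[k] W ⊗[k] V :=
  TensorProduct.lift
    ((Finsupp.lsum k fun g : Γ =>
      ((TensorProduct.mk k W V).comp (DistribSMul.toLinearMap k W g)).flip) ∘ₗ
      coact (k := k) (Γ := Γ))

/-- The coaction `v ⊗ w ↦ v_(-1) w_(-1) ⊗ (v_(0) ⊗ w_(0))` on a tensor product. -/
noncomputable def tensorCoact (V W : Type*)
    [AddCommGroup V] [Module k V] [DistribMulAction Γ V] [SMulCommClass Γ k V]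
    [YetterDrinfeld k Γ V]
    [AddCommGroup W] [Module k W] [DistribMulAction Γ W] [SMulCommClass Γ k W]
    [YetterDrinfeld k Γ W] :
    V ⊗[k] W →ₗ[k] (Γ →₀ V ⊗[k] W) :=
  Finsupp.lmapDomain (V ⊗[k] W) k (fun p : Γ × Γ => p.1 * p.2) ∘ₗ
    (finsuppTensorFinsupp k k V W Γ Γ).toLinearMap ∘ₗ
    TensorProduct.map coact coact

/-- The support of `V`: the subgroup of `Γ` generated by the degrees of the nonzero homogeneous
elements of `V`. -/
def supp (V : Type*)
    [AddCommGroup V] [Module k V] [DistribMulAction Γ V] [SMulCommClass Γ k V]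
    [YetterDrinfeld k Γ V] : Subgroup Γ :=
  Subgroup.closure {g : Γ | ∃ v : V, v ≠ 0 ∧ IsHomogeneous k g v}

variable {k Γ}

theorem isHomogeneous_coact (v : V) (g : Γ) : IsHomogeneous k g (coact (k := k) v g) :=
  coact_coact v g

theorem IsHomogeneous.smul {g : Γ} {v : V} (hv : IsHomogeneous k g v) (h : Γ) :
    IsHomogeneous k (h * g * h⁻¹) (h • v) := by
  have key := coact_smul (k := k) h g v
  rw [hv, Finsupp.single_eq_same] at key
  have := isHomogeneous_coact (k := k) (h • v) (h * g * h⁻¹)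
  rwa [key] at this

/-- Additive statements may be checked on homogeneous elements. -/
@[elab_as_elim]
theorem induction_homogeneous {p : V → Prop} (v : V) (zero : p 0)
    (add : ∀ x y, p x → p y → p (x + y))
    (hom : ∀ (g : Γ) (x : V), IsHomogeneous k g x → p x) : p v := by
  rw [← coact_sum (k := k) (Γ := Γ) v, Finsupp.sum]
  exact Finset.sum_induction _ p add zero fun g _ => hom g _ (isHomogeneous_coact v g)

instance supp_normal : (supp k Γ V).Normal := by
  constructor
  intro n hn g
  refine Subgroup.closure_induction (p := fun x _ => g * x * g⁻¹ ∈ supp k Γ V)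
    ?_ ?_ ?_ ?_ hn
  · rintro x ⟨v, hv, hx⟩
    exact Subgroup.subset_closure ⟨g • v, by simpa [smul_eq_zero_iff_eq] using hv, hx.smul g⟩
  · simp
  · intro x y _ _ hx hy
    simpa [mul_assoc] using mul_mem hx hy
  · intro x _ hx
    simpa [mul_assoc] using inv_mem hx

theorem braiding_tmul {g : Γ} {v : V} (hv : IsHomogeneous k g v) (w : W) :
    braiding k Γ V W (v ⊗ₜ w) = (g • w) ⊗ₜ v := by
  simp [braiding, show coact (k := k) v = Finsupp.single g v from hv]

theorem tensorCoact_tmul {g h : Γ} {v : V} {w : W} (hv : IsHomogeneous k g v)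
    (hw : IsHomogeneous k h w) :
    tensorCoact k Γ V W (v ⊗ₜ w) = Finsupp.single (g * h) (v ⊗ₜ w) := by
  simp [tensorCoact, show coact (k := k) v = Finsupp.single g v from hv,
    show coact (k := k) w = Finsupp.single h w from hw, finsuppTensorFinsupp_single]

@[elab_as_elim]
theorem tensor_induction {p : V ⊗[k] W → Prop} (t : V ⊗[k] W) (zero : p 0)
    (add : ∀ x y, p x → p y → p (x + y))
    (tmul : ∀ (g h : Γ) (v : V) (w : W), IsHomogeneous k g v → IsHomogeneous k h w →
      p (v ⊗ₜ w)) : p t := by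
  induction t using TensorProduct.induction_on with
  | zero => exact zero
  | add x y hx hy => exact add x y hx hy
  | tmul v w =>
    refine induction_homogeneous (k := k) (Γ := Γ) (p := fun v => p (v ⊗ₜ w)) v
      (by simpa using zero) (fun x y hx hy => by rw [TensorProduct.add_tmul]; exact add _ _ hx hy)
      fun g v hv => ?_
    exact induction_homogeneous (k := k) (Γ := Γ) (p := fun w => p (v ⊗ₜ w)) w
      (by simpa using zero) (fun x y hx hy => by rw [TensorProduct.tmul_add]; exact add _ _ hx hy)
      fun h w hw => tmul g h v w hv hw

end

end YetterDrinfeld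

/-- Multiplication of the braided tensor product algebra `B ⊗ B`:
`(a ⊗ b) (c ⊗ d) = a (b_(-1) • c) ⊗ b_(0) d`. -/
noncomputable def braidedMul (k Γ B : Type*) [Field k] [Group Γ] [Ring B] [Algebra k B]
    [MulSemiringAction Γ B] [SMulCommClass Γ k B] [YetterDrinfeld k Γ B] :
    (B ⊗[k] B) ⊗[k] (B ⊗[k] B) →ₗ[k] B ⊗[k] B :=
  TensorProduct.map (LinearMap.mul' k B) (LinearMap.mul' k B) ∘ₗ
    (TensorProduct.assoc k B B (B ⊗[k] B)).symm.toLinearMap ∘ₗ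
    LinearMap.lTensor B ((TensorProduct.assoc k B B B).toLinearMap ∘ₗ
      LinearMap.rTensor B (YetterDrinfeld.braiding k Γ B B) ∘ₗ
      (TensorProduct.assoc k B B B).symm.toLinearMap) ∘ₗ
    (TensorProduct.assoc k B B (B ⊗[k] B)).toLinearMap

/-- A Hopf algebra in the braided monoidal category of Yetter--Drinfeld modules over `k[Γ]`: an
algebra and coalgebra `B` which is a Yetter--Drinfeld module, such that all structure maps are
morphisms of Yetter--Drinfeld modules and `Δ : B → B ⊗ B`, `ε : B → k` are algebra maps, where
`B ⊗ B` carries the braided multiplication.  That unit and multiplication are `Γ`-equivariant is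
contained in `MulSemiringAction Γ B`. -/
class BraidedHopfAlgebra (k Γ B : Type*) [Field k] [Group Γ] [Ring B] [Algebra k B]
    [MulSemiringAction Γ B] [SMulCommClass Γ k B] [YetterDrinfeld k Γ B] [Coalgebra k B] where
  coact_one : YetterDrinfeld.IsHomogeneous k (1 : Γ) (1 : B)
  coact_mul : ∀ a b : B, YetterDrinfeld.coact (k := k) (Γ := Γ) (a * b) =
    Finsupp.mapRange.linearMap (LinearMap.mul' k B)
      (YetterDrinfeld.tensorCoact k Γ B B (a ⊗ₜ b))
  counit_smul : ∀ (g : Γ) (a : B), Coalgebra.counit (R := k) (g • a) = Coalgebra.counit (R := k) a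
  counit_coact : ∀ (g : Γ) (a : B), YetterDrinfeld.IsHomogeneous k g a → g ≠ 1 →
    Coalgebra.counit (R := k) a = 0
  comul_smul : ∀ (g : Γ) (a : B), Coalgebra.comul (R := k) (g • a) =
    TensorProduct.map (DistribSMul.toLinearMap k B g) (DistribSMul.toLinearMap k B g)
      (Coalgebra.comul (R := k) a)
  comul_coact : ∀ a : B, YetterDrinfeld.tensorCoact k Γ B B (Coalgebra.comul (R := k) a) =
    Finsupp.mapRange.linearMap (Coalgebra.comul (R := k))
      (YetterDrinfeld.coact (k := k) (Γ := Γ) a)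
  counit_one : Coalgebra.counit (R := k) (1 : B) = 1
  counit_mul : ∀ a b : B, Coalgebra.counit (R := k) (a * b) =
    Coalgebra.counit (R := k) a * Coalgebra.counit (R := k) b
  comul_one : Coalgebra.comul (R := k) (1 : B) = 1 ⊗ₜ 1
  comul_mul : ∀ a b : B, Coalgebra.comul (R := k) (a * b) =
    braidedMul k Γ B (Coalgebra.comul (R := k) a ⊗ₜ Coalgebra.comul (R := k) b)
  antipode : B →ₗ[k] B
  antipode_smul : ∀ (g : Γ) (a : B), antipode (g • a) = g • antipode a
  antipode_coact : ∀ a : B, YetterDrinfeld.coact (k := k) (Γ := Γ) (antipode a) =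
    Finsupp.mapRange.linearMap antipode (YetterDrinfeld.coact (k := k) (Γ := Γ) a)
  antipode_left : LinearMap.mul' k B ∘ₗ antipode.rTensor B ∘ₗ Coalgebra.comul =
    Algebra.linearMap k B ∘ₗ Coalgebra.counit
  antipode_right : LinearMap.mul' k B ∘ₗ antipode.lTensor B ∘ₗ Coalgebra.comul =
    Algebra.linearMap k B ∘ₗ Coalgebra.counit

/-- The bosonization `B # k[Γ]`, with underlying algebra the skew group algebra:
`SkewMonoidAlgebra.single g x` is the element `x # g`, and
`(x # g) (y # h) = x (g • y) # g h`. The remaining structure maps are constructed below. -/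
abbrev Bosonization (B Γ : Type*) [Zero B] := SkewMonoidAlgebra B Γ

namespace Bosonization

open YetterDrinfeld SkewMonoidAlgebra

variable (k Γ B : Type*) [Field k] [Group Γ] [Ring B] [Algebra k B]
    [MulSemiringAction Γ B] [SMulCommClass Γ k B] [YetterDrinfeld k Γ B]

/-- The linear map `a ⊗ b ↦ (a # b_(-1)) ⊗ (b_(0) # 1)`. -/
noncomputable def spread : B ⊗[k] B →ₗ[k] SkewMonoidAlgebra B Γ ⊗[k] SkewMonoidAlgebra B Γ :=
  TensorProduct.lift (((Finsupp.lsum k fun g : Γ =>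
    ((TensorProduct.mk k (SkewMonoidAlgebra B Γ) (SkewMonoidAlgebra B Γ)).compl₁₂
      (lsingle k g) (lsingle k (1 : Γ))).flip) ∘ₗ coact (k := k) (Γ := Γ)).flip)

variable {k Γ B}

theorem spread_tmul {g : Γ} {b : B} (hb : IsHomogeneous k g b) (a : B) :
    spread k Γ B (a ⊗ₜ b) = single g a ⊗ₜ single 1 b := by
  simp [spread, show coact (k := k) b = Finsupp.single g b from hb, lsingle_apply]

theorem braidedMul_tmul {g : Γ} {b : B} (hb : IsHomogeneous k g b) (a c d : B) :
    braidedMul k Γ B ((a ⊗ₜ b) ⊗ₜ (c ⊗ₜ d)) = (a * g • c) ⊗ₜ (b * d) := by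
  simp [braidedMul, braiding_tmul hb]

theorem single_eq (g : Γ) (a : B) :
    (single g a : SkewMonoidAlgebra B Γ) = single 1 a * single g 1 := by
  simp [single_mul_single]

theorem algHom_ext {A : Type*} [Semiring A] [Algebra k A]
    {φ ψ : SkewMonoidAlgebra B Γ →ₐ[k] A} (h₁ : ∀ a, φ (single 1 a) = ψ (single 1 a))
    (h₂ : ∀ g, φ (single g 1) = ψ (single g 1)) : φ = ψ := by
  apply AlgHom.toLinearMap_injective
  ext g a
  simp only [LinearMap.comp_apply, lsingle_apply, AlgHom.toLinearMap_apply]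
  rw [single_eq g a, map_mul, map_mul, h₁, h₂]

theorem liftNCAlgHom_single {A : Type*} [Semiring A] [Algebra k A] (f : B →ₐ[k] A) (F : Γ →* A)
    (hc : ∀ {x y}, (f (y • x)) * F y = (F y) * (f x)) (g : Γ) (a : B) :
    liftNCAlgHom f F hc (single g a) = f a * F g :=
  liftNC_single _ _ _ _

variable [Coalgebra k B] [BraidedHopfAlgebra k Γ B]

theorem mul_homogeneous {g h : Γ} {a b : B} (ha : IsHomogeneous k g a) (hb : IsHomogeneous k h b) :
    IsHomogeneous k (g * h) (a * b) := by
  have := BraidedHopfAlgebra.coact_mul (k := k) (Γ := Γ) a b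
  rw [tensorCoact_tmul ha hb] at this
  simp only [Finsupp.mapRange.linearMap_apply, Finsupp.mapRange_single, LinearMap.mul'_apply] at this
  exact this

theorem spread_mul (s t : B ⊗[k] B) :
    spread k Γ B (braidedMul k Γ B (s ⊗ₜ t)) = spread k Γ B s * spread k Γ B t := by
  refine tensor_induction (k := k) (Γ := Γ) s ?_ ?_ ?_
  · simp
  · intro x y hx hy
    simp only [TensorProduct.add_tmul, map_add, hx, hy, add_mul]
  intro g₁ g₂ a b ha hb
  refine tensor_induction (k := k) (Γ := Γ) t ?_ ?_ ?_
  · simp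
  · intro x y hx hy
    simp only [TensorProduct.tmul_add, map_add, hx, hy, mul_add]
  intro h₁ h₂ c d hc hd
  rw [braidedMul_tmul hb, spread_tmul hb, spread_tmul hd, spread_tmul (mul_homogeneous hb hd)]
  simp [single_mul_single]

variable (k Γ B) in
/-- `b ↦ (b_(1) # (b_(2))_(-1)) ⊗ ((b_(2))_(0) # 1)`. -/
noncomputable def comulBase :
    B →ₐ[k] SkewMonoidAlgebra B Γ ⊗[k] SkewMonoidAlgebra B Γ :=
  AlgHom.ofLinearMap (spread k Γ B ∘ₗ Coalgebra.comul)
    (by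
      simp only [LinearMap.comp_apply, BraidedHopfAlgebra.comul_one (k := k) (Γ := Γ)]
      rw [spread_tmul BraidedHopfAlgebra.coact_one]; rfl)
    (fun a b => by
      simp only [LinearMap.comp_apply, BraidedHopfAlgebra.comul_mul (k := k) (Γ := Γ)]
      exact spread_mul _ _)

variable (k Γ B) in
/-- `g ↦ (1 # g) ⊗ (1 # g)`. -/
noncomputable def comulGroup : Γ →* SkewMonoidAlgebra B Γ ⊗[k] SkewMonoidAlgebra B Γ where
  toFun g := single g 1 ⊗ₜ single g 1
  map_one' := rfl
  map_mul' g h := by simp [single_mul_single]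

theorem spread_smul (g : Γ) (t : B ⊗[k] B) :
    spread k Γ B (TensorProduct.map (DistribSMul.toLinearMap k B g)
      (DistribSMul.toLinearMap k B g) t) * comulGroup k Γ B g =
    comulGroup k Γ B g * spread k Γ B t := by
  refine tensor_induction (k := k) (Γ := Γ) t ?_ ?_ ?_
  · simp
  · intro x y hx hy
    simp only [map_add, hx, hy, mul_add, add_mul]
  intro h₁ h₂ c d hc hd
  simp only [TensorProduct.map_tmul, DistribSMul.toLinearMap_apply]
  rw [spread_tmul hd, spread_tmul (hd.smul g)]
  simp [comulGroup, single_mul_single]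

theorem comulBase_smul {a : B} {g : Γ} :
    comulBase k Γ B (g • a) * comulGroup k Γ B g =
      comulGroup k Γ B g * comulBase k Γ B a := by
  have : comulBase k Γ B (g • a) = spread k Γ B (TensorProduct.map (DistribSMul.toLinearMap k B g)
      (DistribSMul.toLinearMap k B g) (Coalgebra.comul a)) := by
    rw [← BraidedHopfAlgebra.comul_smul]; rfl
  rw [this, spread_smul]; rfl

variable (k Γ B) in
/-- The comultiplication of the bosonization,
`Δ (b # g) = (b_(1) # (b_(2))_(-1) g) ⊗ ((b_(2))_(0) # g)`. -/
noncomputable def comulHom :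
    SkewMonoidAlgebra B Γ →ₐ[k] SkewMonoidAlgebra B Γ ⊗[k] SkewMonoidAlgebra B Γ :=
  liftNCAlgHom (comulBase k Γ B) (comulGroup k Γ B) comulBase_smul

variable (k Γ B) in
/-- The counit of `B`, as an algebra map. -/
noncomputable def counitBase : B →ₐ[k] k :=
  AlgHom.ofLinearMap (Coalgebra.counit (R := k) (A := B))
    (BraidedHopfAlgebra.counit_one (Γ := Γ)) (BraidedHopfAlgebra.counit_mul (Γ := Γ))

theorem counitBase_smul {a : B} {g : Γ} :
    counitBase k Γ B (g • a) * (1 : Γ →* k) g = (1 : Γ →* k) g * counitBase k Γ B a := by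
  simp [counitBase, BraidedHopfAlgebra.counit_smul]

variable (k Γ B) in
/-- The counit of the bosonization, `ε (b # g) = ε b`. -/
noncomputable def counitHom : SkewMonoidAlgebra B Γ →ₐ[k] k :=
  liftNCAlgHom (counitBase k Γ B) 1 counitBase_smul

theorem comulHom_single (g : Γ) (a : B) : comulHom k Γ B (single g a) =
    spread k Γ B (Coalgebra.comul a) * (single g 1 ⊗ₜ single g 1) :=
  liftNCAlgHom_single _ _ comulBase_smul _ _

theorem comulHom_base (a : B) : comulHom k Γ B (single 1 a) =
    spread k Γ B (Coalgebra.comul a) := by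
  rw [comulHom_single]
  exact mul_one _

theorem comulHom_group (g : Γ) : comulHom k Γ B (single g 1) =
    (single g 1 ⊗ₜ single g 1) := by
  rw [comulHom_single, BraidedHopfAlgebra.comul_one (Γ := Γ),
    spread_tmul BraidedHopfAlgebra.coact_one]
  exact one_mul _

theorem counitHom_single (g : Γ) (a : B) : counitHom k Γ B (single g a) =
    Coalgebra.counit (R := k) a :=
  (liftNCAlgHom_single _ _ counitBase_smul _ _).trans (mul_one _)

variable (k Γ B) in
/-- `a ⊗ t ↦ ∑ g, (a # g) ⊗ spread t_g`. -/
noncomputable def spread₃ : B ⊗[k] (B ⊗[k] B) →ₗ[k]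
    SkewMonoidAlgebra B Γ ⊗[k] (SkewMonoidAlgebra B Γ ⊗[k] SkewMonoidAlgebra B Γ) :=
  TensorProduct.lift (((Finsupp.lsum k fun g : Γ =>
    ((TensorProduct.mk k (SkewMonoidAlgebra B Γ)
      (SkewMonoidAlgebra B Γ ⊗[k] SkewMonoidAlgebra B Γ)).compl₁₂
      (lsingle k g) (spread k Γ B)).flip) ∘ₗ tensorCoact k Γ B B).flip)

theorem spread₃_tmul {g : Γ} {t : B ⊗[k] B} (ht : tensorCoact k Γ B B t = Finsupp.single g t)
    (a : B) : spread₃ k Γ B (a ⊗ₜ t) = single g a ⊗ₜ spread k Γ B t := by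
  simp [spread₃, ht, lsingle_apply]

theorem coassoc_right (t : B ⊗[k] B) :
    (comulHom k Γ B).toLinearMap.lTensor _ (spread k Γ B t) =
      spread₃ k Γ B (LinearMap.lTensor B Coalgebra.comul t) := by
  refine tensor_induction (k := k) (Γ := Γ) t ?_ ?_ ?_
  · simp
  · intro x y hx hy
    simp only [map_add, hx, hy]
  intro g h a b ha hb
  rw [spread_tmul hb, LinearMap.lTensor_tmul, LinearMap.lTensor_tmul, spread₃_tmul (g := h)]
  · simp [comulHom_base]
  · rw [BraidedHopfAlgebra.comul_coact,
      show coact (k := k) b = Finsupp.single h b from hb]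
    simp

set_option synthInstance.maxHeartbeats 200000 in
theorem coassoc_left (t : B ⊗[k] B) :
    TensorProduct.assoc k _ _ _ ((comulHom k Γ B).toLinearMap.rTensor _ (spread k Γ B t)) =
      spread₃ k Γ B (TensorProduct.assoc k _ _ _ (LinearMap.rTensor B Coalgebra.comul t)) := by
  refine tensor_induction (k := k) (Γ := Γ) t ?_ ?_ ?_
  · simp
  · intro x y hx hy
    simp only [map_add, hx, hy]
  intro g h a b ha hb
  rw [spread_tmul hb, LinearMap.rTensor_tmul, LinearMap.rTensor_tmul, AlgHom.toLinearMap_apply,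
    comulHom_single]
  refine tensor_induction (k := k) (Γ := Γ) (Coalgebra.comul (R := k) a) ?_ ?_ ?_
  · simp
  · intro x y hx hy
    simp only [map_add, add_mul, TensorProduct.add_tmul, hx, hy]
  intro g₁ g₂ c d hc hd
  rw [spread_tmul hd, TensorProduct.assoc_tmul, spread₃_tmul (tensorCoact_tmul hd hb),
    spread_tmul hb]
  simp [single_mul_single]

theorem counit_right (t : B ⊗[k] B) :
    (counitHom k Γ B).toLinearMap.lTensor _ (spread k Γ B t) =
      (lsingle k (1 : Γ)).rTensor k (LinearMap.lTensor B Coalgebra.counit t) := by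
  refine tensor_induction (k := k) (Γ := Γ) t ?_ ?_ ?_
  · simp
  · intro x y hx hy
    simp only [map_add, hx, hy]
  intro g h a b ha hb
  rw [spread_tmul hb]
  by_cases hh : h = 1
  · subst hh
    simp [counitHom_single, lsingle_apply]
  · simp [counitHom_single, BraidedHopfAlgebra.counit_coact h b hb hh]

theorem counit_left (t : B ⊗[k] B) :
    (counitHom k Γ B).toLinearMap.rTensor _ (spread k Γ B t) =
      (lsingle k (1 : Γ)).lTensor k (LinearMap.rTensor B Coalgebra.counit t) := by
  refine tensor_induction (k := k) (Γ := Γ) t ?_ ?_ ?_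
  · simp
  · intro x y hx hy
    simp only [map_add, hx, hy]
  intro g h a b ha hb
  rw [spread_tmul hb]
  simp [counitHom_single, lsingle_apply]

noncomputable instance instBialgebra : Bialgebra k (SkewMonoidAlgebra B Γ) :=
  Bialgebra.ofAlgHom (comulHom k Γ B) (counitHom k Γ B)
    (algHom_ext
      (fun a => by
        have h₁ := coassoc_left (k := k) (Γ := Γ) (Coalgebra.comul a)
        have h₂ := coassoc_right (k := k) (Γ := Γ) (Coalgebra.comul a)
        rw [Coalgebra.coassoc_apply, ← h₂] at h₁
        simpa [comulHom_base] using! h₁)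
      (fun g => by simp [comulHom_group]))
    (algHom_ext
      (fun a => by
        have h := counit_left (k := k) (Γ := Γ) (Coalgebra.comul a)
        simpa [comulHom_base] using! h)
      (fun g => by simp [comulHom_group, counitHom_single, BraidedHopfAlgebra.counit_one (Γ := Γ)]))
    (algHom_ext
      (fun a => by
        have h := counit_right (k := k) (Γ := Γ) (Coalgebra.comul a)
        simpa [comulHom_base] using! h)
      (fun g => by simp [comulHom_group, counitHom_single, BraidedHopfAlgebra.counit_one (Γ := Γ)]))

theorem comul_single (g : Γ) (a : B) :
    Coalgebra.comul (R := k) (single g a : SkewMonoidAlgebra B Γ) =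
      spread k Γ B (Coalgebra.comul a) * (single g 1 ⊗ₜ single g 1) :=
  comulHom_single g a

theorem counit_single (g : Γ) (a : B) :
    Coalgebra.counit (R := k) (single g a : SkewMonoidAlgebra B Γ) = Coalgebra.counit (R := k) a :=
  counitHom_single g a

variable (k Γ B) in
/-- `b ↦ (1 # b_(-1))⁻¹ (S b_(0) # 1)`. -/
noncomputable def antipodeBase : B →ₗ[k] SkewMonoidAlgebra B Γ :=
  (Finsupp.lsum k fun g : Γ =>
    LinearMap.mulLeft k (single g⁻¹ 1 : SkewMonoidAlgebra B Γ) ∘ₗ lsingle k (1 : Γ) ∘ₗ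
      BraidedHopfAlgebra.antipode Γ) ∘ₗ coact (k := k) (Γ := Γ)

theorem antipodeBase_apply {g : Γ} {b : B} (hb : IsHomogeneous k g b) :
    antipodeBase k Γ B b =
      single g⁻¹ 1 * single 1 (BraidedHopfAlgebra.antipode (k := k) Γ b) := by
  simp [antipodeBase, show coact (k := k) b = Finsupp.single g b from hb, lsingle_apply]

variable (k Γ B) in
/-- The antipode of the bosonization, `S (b # g) = (1 # b_(-1) g)⁻¹ (S b_(0) # 1)`. -/
noncomputable def antipode : SkewMonoidAlgebra B Γ →ₗ[k] SkewMonoidAlgebra B Γ :=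
  (Finsupp.lsum k fun g : Γ =>
    LinearMap.mulLeft k (single g⁻¹ 1 : SkewMonoidAlgebra B Γ) ∘ₗ antipodeBase k Γ B) ∘ₗ
    ({ toFun := SkewMonoidAlgebra.coeff
       map_add' := fun x y => coeff_add x y
       map_smul' := fun c x => coeff_smul c x } : SkewMonoidAlgebra B Γ →ₗ[k] (Γ →₀ B))

theorem antipode_single (g : Γ) (b : B) :
    antipode k Γ B (single g b) = single g⁻¹ 1 * antipodeBase k Γ B b := by
  simp [antipode]

variable (k Γ B) in
/-- `t ↦ ∑ h, (1 # h g)⁻¹ (m (S ⊗ id) t_h # g)`. -/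
noncomputable def antipodeAux (g : Γ) : B ⊗[k] B →ₗ[k] SkewMonoidAlgebra B Γ :=
  (Finsupp.lsum k fun h : Γ =>
    LinearMap.mulLeft k (single (h * g)⁻¹ 1 : SkewMonoidAlgebra B Γ) ∘ₗ lsingle k g ∘ₗ
      LinearMap.mul' k B ∘ₗ (BraidedHopfAlgebra.antipode Γ).rTensor B) ∘ₗ
    tensorCoact k Γ B B

theorem antipode_left_aux (g : Γ) (t : B ⊗[k] B) :
    LinearMap.mul' k _ ((antipode k Γ B).rTensor _
      (spread k Γ B t * (single g 1 ⊗ₜ single g 1))) = antipodeAux k Γ B g t := by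
  refine tensor_induction (k := k) (Γ := Γ) t ?_ ?_ ?_
  · simp
  · intro x y hx hy
    simp only [map_add, add_mul, hx, hy]
  intro h₁ h₂ a b ha hb
  rw [spread_tmul hb]
  simp [antipodeAux, tensorCoact_tmul ha hb, lsingle_apply, single_mul_single, antipode_single,
    antipodeBase_apply ha, mul_assoc, smul_smul]

theorem antipode_right_aux (g : Γ) (t : B ⊗[k] B) :
    LinearMap.mul' k _ ((antipode k Γ B).lTensor _
      (spread k Γ B t * (single g 1 ⊗ₜ single g 1))) =
    single 1 (LinearMap.mul' k B ((BraidedHopfAlgebra.antipode (k := k) Γ).lTensor B t)) := by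
  refine tensor_induction (k := k) (Γ := Γ) t ?_ ?_ ?_
  · simp
  · intro x y hx hy
    simp only [map_add, add_mul, hx, hy, single_add]
  intro h₁ h₂ a b ha hb
  rw [spread_tmul hb]
  simp [single_mul_single, antipode_single, antipodeBase_apply hb, mul_assoc, smul_smul]

noncomputable instance instHopfAlgebra : HopfAlgebra k (SkewMonoidAlgebra B Γ) where
  antipode := antipode k Γ B
  mul_antipode_rTensor_comul := by
    refine lhom_ext fun g a => ?_
    simp only [LinearMap.comp_apply, Algebra.linearMap_apply]
    rw [comul_single, counit_single, antipode_left_aux]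
    refine induction_homogeneous (k := k) (Γ := Γ) a ?_ ?_ ?_
    · simp
    · intro x y hx hy
      simp only [map_add, hx, hy]
    · intro h a ha
      have hS := LinearMap.congr_fun (BraidedHopfAlgebra.antipode_left (k := k) (Γ := Γ) (B := B)) a
      simp only [LinearMap.comp_apply] at hS
      rw [antipodeAux, LinearMap.comp_apply, BraidedHopfAlgebra.comul_coact,
        show coact (k := k) a = Finsupp.single h a from ha]
      by_cases hh : h = 1
      · subst hh
        simp [hS, lsingle_apply, single_mul_single]
      · simp [hS, BraidedHopfAlgebra.counit_coact h a ha hh, lsingle_apply]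
  mul_antipode_lTensor_comul := by
    refine lhom_ext fun g a => ?_
    simp only [LinearMap.comp_apply, Algebra.linearMap_apply]
    rw [comul_single, counit_single, antipode_right_aux]
    have hS := LinearMap.congr_fun (BraidedHopfAlgebra.antipode_right (k := k) (Γ := Γ) (B := B)) a
    simp only [LinearMap.comp_apply] at hS
    rw [hS]
    rfl

variable (k Γ B) in
/-- The group-like elements `1 # g` of the bosonization. -/
noncomputable def toGroupLike : Γ →* GroupLike k (SkewMonoidAlgebra B Γ) where
  toFun g := ⟨single g 1, ⟨by rw [counit_single]; exact BraidedHopfAlgebra.counit_one (Γ := Γ),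
    comulHom_group g⟩⟩
  map_one' := rfl
  map_mul' g h := by
    apply GroupLike.val_injective
    simp [single_mul_single]

end Bosonization

/-- A pre-Nichols algebra of the Yetter--Drinfeld module `V`: a graded Hopf algebra
`B = ⨁ n, grading n` in Yetter--Drinfeld modules which is a quotient of the tensor algebra `T(V)`
(with `V` primitive) by a homogeneous Hopf ideal contained in degrees `≥ 2`.  Thus `B` is
generated by the primitive elements `V`, with `B_0 = k` and `B_1 = V`. -/
structure PreNicholsAlgebra (k Γ V B : Type*) [Field k] [Group Γ]
    [AddCommGroup V] [Module k V] [DistribMulAction Γ V] [SMulCommClass Γ k V]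
    [YetterDrinfeld k Γ V] [Ring B] [Algebra k B] [MulSemiringAction Γ B] [SMulCommClass Γ k B]
    [YetterDrinfeld k Γ B] [Coalgebra k B] [BraidedHopfAlgebra k Γ B] where
  incl : V →ₗ[k] B
  incl_injective : Function.Injective incl
  incl_smul : ∀ (g : Γ) (v : V), incl (g • v) = g • incl v
  incl_coact : ∀ v : V, YetterDrinfeld.coact (k := k) (Γ := Γ) (incl v) =
    Finsupp.mapRange.linearMap incl (YetterDrinfeld.coact (k := k) (Γ := Γ) v)
  comul_incl : ∀ v : V, Coalgebra.comul (R := k) (incl v) = incl v ⊗ₜ 1 + 1 ⊗ₜ incl v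
  generates : Algebra.adjoin k (Set.range incl) = ⊤
  grading : ℕ → Submodule k B
  gradedAlgebra : GradedAlgebra grading
  grading_zero : grading 0 = 1
  grading_one : grading 1 = LinearMap.range incl
  smul_mem : ∀ (n : ℕ) (g : Γ), ∀ b ∈ grading n, g • b ∈ grading n
  coact_mem : ∀ (n : ℕ) (g : Γ), ∀ b ∈ grading n,
    YetterDrinfeld.coact (k := k) b g ∈ grading n
  comul_mem : ∀ n : ℕ, ∀ b ∈ grading n, Coalgebra.comul (R := k) b ∈
    ⨆ (i : ℕ) (j : ℕ) (_ : i + j = n),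
      LinearMap.range (TensorProduct.map (grading i).subtype (grading j).subtype)
  counit_eq_zero : ∀ n : ℕ, n ≠ 0 → ∀ b ∈ grading n, Coalgebra.counit (R := k) b = 0
  antipode_mem : ∀ n : ℕ, ∀ b ∈ grading n,
    BraidedHopfAlgebra.antipode (k := k) Γ b ∈ grading n

section Convolution

variable {k C M : Type*} [Field k] [AddCommMonoid C] [Module k C] [Coalgebra k C]
  [AddCommMonoid M] [Module k M]

/-- `c ↦ f(c_(1)) w(c_(2))` for a linear map `f` and a functional `w` on a coalgebra. -/
noncomputable def convRight (f : C →ₗ[k] M) (w : C →ₗ[k] k) : C →ₗ[k] M :=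
  (TensorProduct.rid k M).toLinearMap ∘ₗ TensorProduct.map f w ∘ₗ Coalgebra.comul

/-- `c ↦ w(c_(1)) f(c_(2))` for a functional `w` and a linear map `f` on a coalgebra. -/
noncomputable def convLeft (w : C →ₗ[k] k) (f : C →ₗ[k] M) : C →ₗ[k] M :=
  (TensorProduct.lid k M).toLinearMap ∘ₗ TensorProduct.map w f ∘ₗ Coalgebra.comul

end Convolution

/-- A coquasi-bialgebra structure on the coalgebra `H`, with multiplication `mul`, unit `unit`,
associator `assoc` and its convolution inverse `assocInv`:
* `(h₁ k₁) l₁ Ω(h₂, k₂, l₂) = Ω(h₁, k₁, l₁) h₂ (k₂ l₂)`,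
* `Ω(h₁ k₁, l₁, t₁) Ω(h₂, k₂, l₂ t₂) = Ω(h₁, k₁, l₁) Ω(h₂, k₂ l₂, t₁) Ω(k₃, l₃, t₂)`,
* `1 h = h = h 1` and `Ω(h, 1, k) = ε(h) ε(k)`. -/
structure CoquasiBialgebra (k H : Type*) [Field k] [AddCommGroup H] [Module k H]
    [Coalgebra k H] where
  mul : H ⊗[k] H →ₗc[k] H
  unit : k →ₗc[k] H
  assoc : (H ⊗[k] H) ⊗[k] H →ₗ[k] k
  assocInv : (H ⊗[k] H) ⊗[k] H →ₗ[k] k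
  assoc_conv_assocInv : convRight assoc assocInv = Coalgebra.counit
  assocInv_conv_assoc : convRight assocInv assoc = Coalgebra.counit
  one_mul : ∀ h : H, mul (unit 1 ⊗ₜ h) = h
  mul_one : ∀ h : H, mul (h ⊗ₜ unit 1) = h
  mul_assoc :
    convRight (mul.toLinearMap ∘ₗ mul.toLinearMap.rTensor H) assoc =
      convLeft assoc (mul.toLinearMap ∘ₗ mul.toLinearMap.lTensor H ∘ₗ
        (TensorProduct.assoc k H H H).toLinearMap)
  pentagon :
    convRight (assoc ∘ₗ (mul.toLinearMap.rTensor H).rTensor H)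
        (assoc ∘ₗ mul.toLinearMap.lTensor (H ⊗[k] H) ∘ₗ
          (TensorProduct.assoc k (H ⊗[k] H) H H).toLinearMap) =
      convRight
        (convRight (LinearMap.mul' k k ∘ₗ TensorProduct.map assoc Coalgebra.counit)
          (assoc ∘ₗ LinearMap.rTensor H
            (mul.toLinearMap.lTensor H ∘ₗ (TensorProduct.assoc k H H H).toLinearMap)))
        (LinearMap.mul' k k ∘ₗ TensorProduct.map Coalgebra.counit assoc ∘ₗ
          (TensorProduct.assoc k H (H ⊗[k] H) H).toLinearMap ∘ₗ
          (TensorProduct.assoc k H H H).toLinearMap.rTensor H)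
  assoc_one : ∀ h l : H, assoc ((h ⊗ₜ unit 1) ⊗ₜ l) =
    Coalgebra.counit (R := k) h * Coalgebra.counit (R := k) l

/-- A coquasi-Hopf algebra structure on the coalgebra `H`: a coquasi-bialgebra with an antipode
`S` and functionals `α`, `β` such that
* `S(h₁) α(h₂) h₃ = α(h) 1` and `h₁ β(h₂) S(h₃) = β(h) 1`,
* `Ω⁻¹(h₁ β(h₂), S(h₃), α(h₄) h₅) = ε(h) = Ω(S(h₁), α(h₂) h₃ β(h₄), S(h₅))`. -/
structure CoquasiHopfAlgebra (k H : Type*) [Field k] [AddCommGroup H] [Module k H]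
    [Coalgebra k H] extends CoquasiBialgebra k H where
  antipode : H →ₗ[k] H
  α : H →ₗ[k] k
  β : H →ₗ[k] k
  antipode_left : ∀ h : H,
    mul (TensorProduct.map antipode (convLeft α LinearMap.id) (Coalgebra.comul h)) =
      α h • unit 1
  antipode_right : ∀ h : H,
    mul (TensorProduct.map (convRight LinearMap.id β) antipode (Coalgebra.comul h)) =
      β h • unit 1
  assocInv_antipode :
    assocInv ∘ₗ TensorProduct.map
        (TensorProduct.map (convRight LinearMap.id β) antipode) (convLeft α LinearMap.id) ∘ₗ
      LinearMap.rTensor H Coalgebra.comul ∘ₗ Coalgebra.comul = Coalgebra.counit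
  assoc_antipode :
    assoc ∘ₗ TensorProduct.map
        (TensorProduct.map antipode (convRight (convLeft α LinearMap.id) β)) antipode ∘ₗ
      LinearMap.rTensor H Coalgebra.comul ∘ₗ Coalgebra.comul = Coalgebra.counit

/-- A relative `r`-form `r : H ⊗ K → k` for an inclusion `j : K → H` of a Hopf subalgebra. -/
structure IsRelativeRForm {k H K : Type*} [Field k] [Ring H] [HopfAlgebra k H]
    [Ring K] [HopfAlgebra k K] (j : K →ₐc[k] H) (r : H →ₗ[k] K →ₗ[k] k) : Prop where
  injective : Function.Injective j
  /-- `r(h h', x) = r(h', x₁) r(h, x₂)` -/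
  mul_left : ∀ (h h' : H), r (h * h') = convRight (r h') (r h)
  /-- `r(h, x x') = r(h₁, x) r(h₂, x')` -/
  mul_right : ∀ (x x' : K), r.flip (x * x') = convRight (r.flip x) (r.flip x')
  one_right : ∀ h : H, r h 1 = Coalgebra.counit (R := k) h
  one_left : ∀ x : K, r 1 x = Coalgebra.counit (R := k) x
  /-- `r(h₁, x₁) x₂ h₂ = h₁ x₁ r(h₂, x₂)` -/
  comm : convLeft (TensorProduct.lift r)
      (LinearMap.mul' k H ∘ₗ (TensorProduct.comm k H H).toLinearMap ∘ₗ
        LinearMap.lTensor H (j : K →ₐ[k] H).toLinearMap) =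
    convRight (LinearMap.mul' k H ∘ₗ LinearMap.lTensor H (j : K →ₐ[k] H).toLinearMap)
      (TensorProduct.lift r)

/-- A normalized 2-cocycle with values in a group `A` (with trivial action). -/
structure IsNormalizedTwoCocycle {G A : Type*} [Group G] [Group A] (c : G → G → A) : Prop where
  one_left : ∀ g, c 1 g = 1
  one_right : ∀ g, c g 1 = 1
  cocycle : ∀ g₁ g₂ g₃, c g₁ g₂ * c (g₁ * g₂) g₃ = c g₂ g₃ * c g₁ (g₂ * g₃)

/-- A normalized 3-cochain with values in a group `A`. -/
structure IsNormalizedThreeCochain {G A : Type*} [Group G] [Group A] (w : G → G → G → A) :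
    Prop where
  one_left : ∀ g h, w 1 g h = 1
  one_middle : ∀ g h, w g 1 h = 1
  one_right : ∀ g h, w g h 1 = 1

/-- The coboundary
`ω(g₁,g₂,g₃) ω(g₁,g₂g₃,g₄) ω(g₂,g₃,g₄) / (ω(g₁g₂,g₃,g₄) ω(g₁,g₂,g₃g₄))`. -/
def coboundary₃ {G A : Type*} [Group G] [CommGroup A] (w : G → G → G → A) (g₁ g₂ g₃ g₄ : G) : A :=
  w g₁ g₂ g₃ * w g₁ (g₂ * g₃) g₄ * w g₂ g₃ g₄ / (w (g₁ * g₂) g₃ g₄ * w g₁ g₂ (g₃ * g₄))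

/-- An associative `G`-zesting datum `(γ, lam, ω)` for the Hopf algebra `H`, relative to a
surjective cocentral Hopf algebra map `π : H → k[G]` and a subgroup `Γ₀` of the group of group-like
elements that are coinvariant under `π`.  The set `Alg(H, k)` carries the convolution product. -/
structure AssocZestingDatum (k H G : Type*) [Field k] [Ring H] [HopfAlgebra k H] [Group G] where
  π : H →ₐc[k] MonoidAlgebra k G
  π_surjective : Function.Surjective π
  π_cocentral : LinearMap.lTensor H (π : H →ₐ[k] MonoidAlgebra k G).toLinearMap ∘ₗ
      Coalgebra.comul =
    LinearMap.lTensor H (π : H →ₐ[k] MonoidAlgebra k G).toLinearMap ∘ₗ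
      (TensorProduct.comm k H H).toLinearMap ∘ₗ Coalgebra.comul
  Γ₀ : Subgroup (GroupLike k H)
  Γ₀_coinvariant : ∀ g ∈ Γ₀, LinearMap.lTensor H (π : H →ₐ[k] MonoidAlgebra k G).toLinearMap
    (Coalgebra.comul (g : H)) = (g : H) ⊗ₜ 1
  γ : Γ₀ →* WithConv (H →ₐ[k] k)
  /-- `⟨γ(g), h₁⟩ h₂ g = g h₁ ⟨γ(g), h₂⟩`, i.e. `g ⊗ x ↦ ⟨γ(g), x_(-1)⟩ x_(0) ⊗ g` is a half-braiding
  on the one-dimensional left comodule spanned by `g`. -/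
  central : ∀ (g : Γ₀) (h : H),
    convLeft (γ g).ofConv.toLinearMap LinearMap.id h * (g : GroupLike k H) =
      (g : GroupLike k H) * convRight LinearMap.id (γ g).ofConv.toLinearMap h
  lam : G → G → Γ₀
  lam_cocycle : IsNormalizedTwoCocycle lam
  ω : G → G → G → kˣ
  ω_normalized : IsNormalizedThreeCochain ω
  compat : ∀ g₁ g₂ g₃ g₄ : G,
    (γ (lam g₁ g₂)).ofConv ((lam g₃ g₄ : GroupLike k H) : H) = (coboundary₃ ω g₁ g₂ g₃ g₄ : kˣ)

namespace AssocZestingDatum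

variable {k H G : Type*} [Field k] [Ring H] [HopfAlgebra k H] [Group G]

/-- The homogeneous component `H_g` of the `G`-grading induced by `π`. -/
def component (D : AssocZestingDatum k H G) (g : G) : Set H :=
  {h | LinearMap.rTensor H (D.π : H →ₐ[k] MonoidAlgebra k G).toLinearMap
    (Coalgebra.comul h) = MonoidAlgebra.single g 1 ⊗ₜ h}

/-- `Q` is the coquasi-bialgebra `H^λ` attached to the zesting datum: on the coalgebra `H`, its
unit is that of `H`, and for `h ∈ H_{g₁}`, `l ∈ H_{g₂}`, `t ∈ H_{g₃}` the product of `h` and `l` is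
`h l λ(g₁, g₂)` and the associator is `ε(h l) ω(g₁, g₂, g₃) ⟨γ(λ(g₁, g₂)), t⟩`. -/
structure IsZested (D : AssocZestingDatum k H G) (Q : CoquasiBialgebra k H) : Prop where
  unit : Q.unit 1 = (1 : H)
  mul : ∀ g₁ g₂ : G, ∀ h ∈ D.component g₁, ∀ l ∈ D.component g₂,
    Q.mul (h ⊗ₜ l) = h * l * ((D.lam g₁ g₂ : GroupLike k H) : H)
  assoc : ∀ g₁ g₂ g₃ : G, ∀ h ∈ D.component g₁, ∀ l ∈ D.component g₂, ∀ t ∈ D.component g₃,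
    Q.assoc ((h ⊗ₜ l) ⊗ₜ t) = Coalgebra.counit (R := k) (h * l) * (D.ω g₁ g₂ g₃ : kˣ) *
      (D.γ (D.lam g₁ g₂)).ofConv t

/-- The inclusion of the Hopf subalgebra `k[Γ₀]` into `H`. -/
noncomputable def inclusion (D : AssocZestingDatum k H G) : MonoidAlgebra k D.Γ₀ →ₐc[k] H :=
  MonoidAlgebra.liftGroupLikeBialgHom.comp (MonoidAlgebra.mapDomainBialgHom k D.Γ₀.subtype)

end AssocZestingDatum

/-- The choices determining an associative `G`-zesting datum for `B # k[Γ]`. -/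
structure PointedZestingChoice (k Γ V G : Type*) [Field k] [Group Γ]
    [AddCommGroup V] [Module k V] [DistribMulAction Γ V] [SMulCommClass Γ k V]
    [YetterDrinfeld k Γ V] [Group G] where
  ι : Γ ⧸ YetterDrinfeld.supp k Γ V →* G
  ι_surjective : Function.Surjective ι
  Γ₀ : Subgroup Γ
  Γ₀_central : Γ₀ ≤ Subgroup.center Γ
  Γ₀_le_ker : ∀ g ∈ Γ₀, ι (g : Γ ⧸ YetterDrinfeld.supp k Γ V) = 1
  Φ : Γ₀ →* (Γ →* kˣ)
  /-- `g • x = ⟨h, Φ(g)⟩ x` for `g ∈ Γ₀` and `x ∈ V` homogeneous of degree `h`. -/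
  Φ_smul : ∀ (g : Γ₀) (h : Γ) (x : V), YetterDrinfeld.IsHomogeneous k h x →
    (g : Γ) • x = (Φ g h : k) • x
  lam : G → G → Γ₀
  lam_cocycle : IsNormalizedTwoCocycle lam
  ω : G → G → G → kˣ
  ω_normalized : IsNormalizedThreeCochain ω
  compat : ∀ g₁ g₂ g₃ g₄ : G, Φ (lam g₁ g₂) (lam g₃ g₄) = coboundary₃ ω g₁ g₂ g₃ g₄

namespace PointedZestingChoice

variable {k Γ V B G : Type*} [Field k] [Group Γ]
  [AddCommGroup V] [Module k V] [DistribMulAction Γ V] [SMulCommClass Γ k V]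
  [YetterDrinfeld k Γ V] [Ring B] [Algebra k B] [MulSemiringAction Γ B] [SMulCommClass Γ k B]
  [YetterDrinfeld k Γ B] [Coalgebra k B] [BraidedHopfAlgebra k Γ B] [Group G]

/-- The datum `D` restricts to the choice `c`: `π(x # g) = ε(x) ι(g)`, the group `D.Γ₀` is
`1 # c.Γ₀`, the cochains `λ`, `ω` agree, and `⟨γ(g), 1 # h⟩ = ⟨h, Φ(g)⟩`. -/
structure IsRestrictionOf (c : PointedZestingChoice k Γ V G)
    (D : AssocZestingDatum k (Bosonization B Γ) G) : Prop where
  π_eq : ∀ (x : B) (g : Γ), D.π (SkewMonoidAlgebra.single g x) =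
    MonoidAlgebra.single (c.ι (g : Γ ⧸ YetterDrinfeld.supp k Γ V)) (Coalgebra.counit (R := k) x)
  Γ₀_eq : D.Γ₀ = c.Γ₀.map (Bosonization.toGroupLike k Γ B)
  γ_eq : ∀ (g : c.Γ₀) (g' : D.Γ₀), (g' : GroupLike k (Bosonization B Γ)) =
      Bosonization.toGroupLike k Γ B g →
    ∀ h : Γ, (D.γ g').ofConv (SkewMonoidAlgebra.single h 1) = (c.Φ g h : kˣ)
  lam_eq : ∀ g₁ g₂ : G, (D.lam g₁ g₂ : GroupLike k (Bosonization B Γ)) =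
    Bosonization.toGroupLike k Γ B (c.lam g₁ g₂)
  ω_eq : D.ω = c.ω

/-- The choice `c` determines the datum `D`: in addition, `⟨γ(g), x # h⟩ = ε(x) ⟨h, Φ(g)⟩`. -/
structure Determines (c : PointedZestingChoice k Γ V G)
    (D : AssocZestingDatum k (Bosonization B Γ) G) : Prop extends IsRestrictionOf c D where
  γ_formula : ∀ (g : c.Γ₀) (g' : D.Γ₀), (g' : GroupLike k (Bosonization B Γ)) =
      Bosonization.toGroupLike k Γ B g →
    ∀ (x : B) (h : Γ), (D.γ g').ofConv (SkewMonoidAlgebra.single h x) =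
      Coalgebra.counit (R := k) x * (c.Φ g h : kˣ)

end PointedZestingChoice

/-! ### Convolution of linear maps with functionals on a coalgebra. -/

section Convolution

variable {k C D M N : Type*} [Field k] [AddCommMonoid C] [Module k C] [Coalgebra k C]
  [AddCommMonoid D] [Module k D] [Coalgebra k D]
  [AddCommMonoid M] [Module k M] [AddCommMonoid N] [Module k N]

/-! The construction of `H^λ` and of the `r`-form works over any Hopf algebra `H`. Cocentrality of
`π` makes every component `H_g` a subcoalgebra (`isSubcoalgebra_homogeneous`), and `H` is their sum.
Hence maps on tensor powers of `H` may be defined block by block on `H_{g₁} ⊗ ⋯ ⊗ H_{gₙ}`, and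
identities between convolutions may be checked there. On a block the twisted product is `h l u` with
one fixed group-like `u`, and the associator is a scalar times `ε ⊗ ε ⊗ γ(u)`.

Quasi-associativity then reduces to the centrality of `γ(u)` and the 2-cocycle identity
(`convRight_mulElt_assocForm`). In the pentagon every factor is a scalar times a product of
characters: the characters match by the cocycle identity and commutativity of `Γ₀` (`mul_comm_Γ₀`),
the scalars by `(*)`. The antipode data are `S^λ(h) = S(h) u⁻¹`, `β = ε` and `α = ω(g, g⁻¹, g) γ(u)`
on `H_g`, with `u = λ(g, g⁻¹)`; beyond cancellation they need `(*)` only at `(g, g⁻¹, g, g⁻¹)`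
(`ω_mul_ω_inv`). The `r`-form is centrality for `g⁻¹`, multiplied by `g` on both sides.

For the bosonization everything is read off on generators: `g ∈ Γ` is group-like, and `v ∈ V` of
degree `h` satisfies `Δ(v) = v ⊗ 1 + h ⊗ v`. A top-degree argument shows that there are no
group-likes besides `Γ` (`toGroupLike_surjective`). For nonzero `v`, cocentrality at `v` gives `π(h)
= 1`; then `π(v)` is primitive in a group algebra, hence zero (`π_eq_one_and_eq_zero`). Centrality
of `γ(u)` at `h` says that `u` commutes with `h`. At `v` it reads `γ(v) u + γ(h) v u = (u·v) u +
γ(v) u h` (`form_gen_mul`): degree one gives the condition on `Φ`, and degree zero gives `γ(v) = 0`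
unless `h = 1`. So a datum restricts to a choice and can differ from the datum of that choice only
by the values of `γ` on vectors of degree `1`. If `B` is finite-dimensional these vectors are
nilpotent in `B`, so characters kill them. Conversely, the formulas attached to a choice are
verified on the same generators. -/

theorem comp_convRight (φ : M →ₗ[k] N) (f : C →ₗ[k] M) (w : C →ₗ[k] k) :
    φ ∘ₗ convRight f w = convRight (φ ∘ₗ f) w := by
  have : φ ∘ₗ (TensorProduct.rid k M).toLinearMap ∘ₗ TensorProduct.map f w =
      (TensorProduct.rid k N).toLinearMap ∘ₗ TensorProduct.map (φ ∘ₗ f) w := by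
    ext a b; simp
  simp only [convRight, ← LinearMap.comp_assoc] at this ⊢
  rw [this]

theorem comp_convLeft (φ : M →ₗ[k] N) (w : C →ₗ[k] k) (f : C →ₗ[k] M) :
    φ ∘ₗ convLeft w f = convLeft w (φ ∘ₗ f) := by
  have : φ ∘ₗ (TensorProduct.lid k M).toLinearMap ∘ₗ TensorProduct.map w f =
      (TensorProduct.lid k N).toLinearMap ∘ₗ TensorProduct.map w (φ ∘ₗ f) := by
    ext a b; simp
  simp only [convLeft, ← LinearMap.comp_assoc] at this ⊢
  rw [this]

/-- Reduces convolution with `w` to one translation operator on the coalgebra, followed by `f`. -/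
theorem convRight_eq_comp (f : C →ₗ[k] M) (w : C →ₗ[k] k) :
    convRight f w = f ∘ₗ convRight LinearMap.id w := by
  rw [comp_convRight, LinearMap.comp_id]

theorem convLeft_eq_comp (w : C →ₗ[k] k) (f : C →ₗ[k] M) :
    convLeft w f = f ∘ₗ convLeft w LinearMap.id := by
  rw [comp_convLeft, LinearMap.comp_id]

theorem convRight_counit (f : C →ₗ[k] M) : convRight f Coalgebra.counit = f := by
  ext c
  have : TensorProduct.map f (Coalgebra.counit (R := k) (A := C)) =
      LinearMap.rTensor k f ∘ₗ LinearMap.lTensor C Coalgebra.counit := by ext; simp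
  simp only [convRight, LinearMap.comp_apply, this, Coalgebra.lTensor_counit_comul,
    LinearEquiv.coe_coe, LinearMap.rTensor_tmul, TensorProduct.rid_tmul, one_smul]

theorem convLeft_counit (f : C →ₗ[k] M) : convLeft Coalgebra.counit f = f := by
  ext c
  have : TensorProduct.map (Coalgebra.counit (R := k) (A := C)) f =
      LinearMap.lTensor k f ∘ₗ LinearMap.rTensor C Coalgebra.counit := by ext; simp
  simp only [convLeft, LinearMap.comp_apply, this, Coalgebra.rTensor_counit_comul,
    LinearEquiv.coe_coe, LinearMap.lTensor_tmul, TensorProduct.lid_tmul, one_smul]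

/-- For two functionals both sides are the product `v(c₁) w(c₂)` of the dual algebra; only the
identification `k ⊗ k ≃ k` differs, so no cocommutativity is involved. -/
theorem convLeft_eq_convRight (v w : C →ₗ[k] k) : convLeft v w = convRight v w := by
  have : (TensorProduct.lid k k).toLinearMap ∘ₗ TensorProduct.map v w =
      (TensorProduct.rid k k).toLinearMap ∘ₗ TensorProduct.map v w := by
    ext a b; simp [mul_comm]
  simp only [convLeft, convRight, ← LinearMap.comp_assoc, this]

/-- This is coassociativity: both sides equal `u(c₁) v(c₂) f(c₃)`. -/
theorem convLeft_convLeft (u v : C →ₗ[k] k) (f : C →ₗ[k] M) :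
    convLeft u (convLeft v f) = convLeft (convRight u v) f := by
  ext c
  have h₁ : (TensorProduct.lid k M).toLinearMap ∘ₗ TensorProduct.map (convRight u v) f =
      (TensorProduct.lid k M).toLinearMap ∘ₗ
        TensorProduct.map u ((TensorProduct.lid k M).toLinearMap ∘ₗ TensorProduct.map v f) ∘ₗ
        (TensorProduct.assoc k C C C).toLinearMap ∘ₗ LinearMap.rTensor C Coalgebra.comul := by
    ext a b
    simp only [convRight, TensorProduct.AlgebraTensorModule.curry_apply,
      LinearMap.restrictScalars_self, TensorProduct.curry_apply, LinearMap.comp_apply,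
      TensorProduct.map_tmul, LinearEquiv.coe_coe, LinearMap.rTensor_tmul]
    generalize (Coalgebra.comul (R := k) a) = t
    induction t with
    | zero => simp
    | add x y hx hy => simp only [map_add, TensorProduct.add_tmul, hx, hy]
    | tmul x y => simp [smul_smul, mul_comm]
  have h₂ : (TensorProduct.lid k M).toLinearMap ∘ₗ TensorProduct.map u (convLeft v f) =
      (TensorProduct.lid k M).toLinearMap ∘ₗ
        TensorProduct.map u ((TensorProduct.lid k M).toLinearMap ∘ₗ TensorProduct.map v f) ∘ₗ
        LinearMap.lTensor C Coalgebra.comul := by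
    ext a b
    simp [convLeft]
  have h₁' := LinearMap.congr_fun h₁ (Coalgebra.comul (R := k) c)
  have h₂' := LinearMap.congr_fun h₂ (Coalgebra.comul (R := k) c)
  simp only [LinearMap.comp_apply, LinearEquiv.coe_coe, Coalgebra.coassoc_apply] at h₁' h₂'
  rw [convLeft, LinearMap.comp_apply, LinearMap.comp_apply, LinearEquiv.coe_coe, h₂', ← h₁']
  rfl

theorem convRight_smul_right (f : C →ₗ[k] M) (a : k) (w : C →ₗ[k] k) :
    convRight f (a • w) = a • convRight f w := by
  simp only [convRight, TensorProduct.map_smul_right, LinearMap.smul_comp, LinearMap.comp_smul]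

theorem convRight_smul_left (a : k) (f : C →ₗ[k] M) (w : C →ₗ[k] k) :
    convRight (a • f) w = a • convRight f w := by
  simp only [convRight, TensorProduct.map_smul_left, LinearMap.smul_comp, LinearMap.comp_smul]

theorem convLeft_smul_left (a : k) (w : C →ₗ[k] k) (f : C →ₗ[k] M) :
    convLeft (a • w) f = a • convLeft w f := by
  simp only [convLeft, TensorProduct.map_smul_left, LinearMap.smul_comp, LinearMap.comp_smul]

/-- The functional `c ⊗ d ↦ v(c) w(d)`. -/
noncomputable def outer (v : C →ₗ[k] k) (w : D →ₗ[k] k) : C ⊗[k] D →ₗ[k] k :=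
  LinearMap.mul' k k ∘ₗ TensorProduct.map v w

@[simp]
theorem outer_tmul (v : C →ₗ[k] k) (w : D →ₗ[k] k) (c : C) (d : D) :
    outer v w (c ⊗ₜ d) = v c * w d := rfl

theorem outer_counit : outer (Coalgebra.counit (R := k) (A := C))
    (Coalgebra.counit (R := k) (A := D)) = Coalgebra.counit := by
  ext a b
  simp [mul_comm]

/-- The comultiplication of `C ⊗ D` is factorwise up to a swap, so convolution with a product
functional acts on each tensor factor separately. Identities on tensor powers thereby become
identities in single factors. -/
theorem convRight_map (f : C →ₗ[k] M) (g : D →ₗ[k] N) (v : C →ₗ[k] k) (w : D →ₗ[k] k) :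
    convRight (TensorProduct.map f g) (outer v w) =
      TensorProduct.map (convRight f v) (convRight g w) := by
  ext c d
  simp only [convRight, TensorProduct.AlgebraTensorModule.curry_apply,
      LinearMap.restrictScalars_self, TensorProduct.curry_apply, LinearMap.comp_apply,
      TensorProduct.map_tmul, LinearEquiv.coe_coe, TensorProduct.comul_tmul]
  generalize (Coalgebra.comul (R := k) c) = s
  generalize (Coalgebra.comul (R := k) d) = t
  induction s with
  | zero => simp
  | add x y hx hy => simp only [map_add, TensorProduct.add_tmul, hx, hy]
  | tmul x y =>
    induction t with
    | zero => simp
    | add x y hx hy => simp only [map_add, TensorProduct.tmul_add, hx, hy]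
    | tmul x y => simp [← TensorProduct.smul_tmul', smul_smul, mul_comm]

theorem convLeft_map (v : C →ₗ[k] k) (w : D →ₗ[k] k) (f : C →ₗ[k] M) (g : D →ₗ[k] N) :
    convLeft (outer v w) (TensorProduct.map f g) =
      TensorProduct.map (convLeft v f) (convLeft w g) := by
  ext c d
  simp only [convLeft, TensorProduct.AlgebraTensorModule.curry_apply,
      LinearMap.restrictScalars_self, TensorProduct.curry_apply, LinearMap.comp_apply,
      TensorProduct.map_tmul, LinearEquiv.coe_coe, TensorProduct.comul_tmul]
  generalize (Coalgebra.comul (R := k) c) = s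
  generalize (Coalgebra.comul (R := k) d) = t
  induction s with
  | zero => simp
  | add x y hx hy => simp only [map_add, TensorProduct.add_tmul, hx, hy]
  | tmul x y =>
    induction t with
    | zero => simp
    | add x y hx hy => simp only [map_add, TensorProduct.tmul_add, hx, hy]
    | tmul x y => simp [← TensorProduct.smul_tmul', smul_smul, mul_comm]

theorem convRight_outer (a v : C →ₗ[k] k) (b w : D →ₗ[k] k) :
    convRight (outer a b) (outer v w) = outer (convRight a v) (convRight b w) := by
  simp only [outer]
  rw [← comp_convRight]
  exact congrArg (LinearMap.mul' k k ∘ₗ ·) (convRight_map a b v w)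

end Convolution

/-! ### Subcoalgebras and localization of convolution identities. -/

section Subcoalgebra

variable {k C D M N : Type*} [Field k] [AddCommMonoid C] [Module k C]
  [AddCommMonoid D] [Module k D]
  [AddCommMonoid M] [Module k M] [AddCommMonoid N] [Module k N]

/-- The image of `S ⊗ T` in `C ⊗ D`. -/
noncomputable def tensorSubmodule (S : Submodule k C) (T : Submodule k D) : Submodule k (C ⊗[k] D) :=
  LinearMap.range (TensorProduct.map S.subtype T.subtype)

theorem tmul_mem_tensorSubmodule {S : Submodule k C} {T : Submodule k D} {c : C} {d : D}
    (hc : c ∈ S) (hd : d ∈ T) : c ⊗ₜ[k] d ∈ tensorSubmodule S T :=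
  ⟨(⟨c, hc⟩ : S) ⊗ₜ (⟨d, hd⟩ : T), rfl⟩

@[elab_as_elim]
theorem tensorSubmodule_induction {S : Submodule k C} {T : Submodule k D}
    {p : C ⊗[k] D → Prop} {t : C ⊗[k] D} (ht : t ∈ tensorSubmodule S T) (zero : p 0)
    (add : ∀ x y, p x → p y → p (x + y)) (tmul : ∀ c ∈ S, ∀ d ∈ T, p (c ⊗ₜ d)) : p t := by
  obtain ⟨s, rfl⟩ := ht
  induction s with
  | zero => simpa using zero
  | add x y hx hy => simpa using add _ _ hx hy
  | tmul x y => exact tmul x x.2 y y.2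

theorem eqOn_tensorSubmodule {S : Submodule k C} {T : Submodule k D} {f g : C ⊗[k] D →ₗ[k] M}
    (h : ∀ c ∈ S, ∀ d ∈ T, f (c ⊗ₜ d) = g (c ⊗ₜ d)) :
    ∀ t ∈ tensorSubmodule S T, f t = g t := fun t ht =>
  tensorSubmodule_induction ht (by simp) (fun x y hx hy => by simp only [map_add, hx, hy]) h

theorem map_eqOn {S : Submodule k C} {T : Submodule k D} {f f' : C →ₗ[k] M} {g g' : D →ₗ[k] N}
    (hf : ∀ c ∈ S, f c = f' c) (hg : ∀ d ∈ T, g d = g' d) :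
    ∀ t ∈ tensorSubmodule S T, TensorProduct.map f g t = TensorProduct.map f' g' t :=
  eqOn_tensorSubmodule fun c hc d hd => by simp [hf c hc, hg d hd]

variable [Coalgebra k C] [Coalgebra k D]

/-- The submodule `S` is a subcoalgebra. -/
def IsSubcoalgebra (S : Submodule k C) : Prop :=
  ∀ c ∈ S, Coalgebra.comul (R := k) c ∈ tensorSubmodule S S

theorem IsSubcoalgebra.tensor {S : Submodule k C} {T : Submodule k D} (hS : IsSubcoalgebra S)
    (hT : IsSubcoalgebra T) : IsSubcoalgebra (tensorSubmodule S T) := by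
  intro t ht
  refine tensorSubmodule_induction ht (by simp)
    (fun x y hx hy => by simpa using add_mem hx hy) fun c hc d hd => ?_
  rw [TensorProduct.comul_tmul]
  refine tensorSubmodule_induction (hS c hc) (by simp)
    (fun x y hx hy => by simpa [TensorProduct.add_tmul] using add_mem hx hy) fun a ha b hb => ?_
  refine tensorSubmodule_induction (hT d hd) (by simp)
    (fun x y hx hy => by simpa [TensorProduct.tmul_add] using add_mem hx hy) fun a' ha' b' hb' => ?_
  exact tmul_mem_tensorSubmodule (tmul_mem_tensorSubmodule ha ha') (tmul_mem_tensorSubmodule hb hb')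

/-- Localization principle: the comultiplication does not leave `S`, so only the restrictions to `S`
enter. This replaces maps defined blockwise by their formula on one block. -/
theorem IsSubcoalgebra.convRight_congr {S : Submodule k C} (hS : IsSubcoalgebra S)
    {f f' : C →ₗ[k] M} {w w' : C →ₗ[k] k} (hf : ∀ c ∈ S, f c = f' c) (hw : ∀ c ∈ S, w c = w' c) :
    ∀ c ∈ S, convRight f w c = convRight f' w' c := fun c hc =>
  congrArg (TensorProduct.rid k M) (map_eqOn hf hw _ (hS c hc))

theorem IsSubcoalgebra.convLeft_congr {S : Submodule k C} (hS : IsSubcoalgebra S)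
    {f f' : C →ₗ[k] M} {w w' : C →ₗ[k] k} (hf : ∀ c ∈ S, f c = f' c) (hw : ∀ c ∈ S, w c = w' c) :
    ∀ c ∈ S, convLeft w f c = convLeft w' f' c := fun c hc =>
  congrArg (TensorProduct.lid k M) (map_eqOn hw hf _ (hS c hc))

theorem IsSubcoalgebra.convLeft_mem {S : Submodule k C} (hS : IsSubcoalgebra S)
    (w : C →ₗ[k] k) : ∀ c ∈ S, convLeft w LinearMap.id c ∈ S := fun c hc => by
  rw [convLeft, LinearMap.comp_apply, LinearMap.comp_apply]
  refine tensorSubmodule_induction (hS c hc) (by simp)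
    (fun x y hx hy => by simpa using add_mem hx hy) fun a ha b hb => ?_
  simpa using S.smul_mem _ hb

end Subcoalgebra

/-! ### Translation operators against the comultiplication. -/

section Convolution

variable {k C : Type*} [Field k] [AddCommMonoid C] [Module k C] [Coalgebra k C]

/-- By coassociativity, pairing with the first leg affects only the left factor of the
comultiplication. -/
theorem comul_comp_convLeft_id (w : C →ₗ[k] k) :
    Coalgebra.comul ∘ₗ convLeft w (LinearMap.id (M := C)) =
      LinearMap.rTensor C (convLeft w LinearMap.id) ∘ₗ Coalgebra.comul (R := k) := by
  ext c
  have h₁ : ∀ t : C ⊗[k] C, LinearMap.rTensor C (convLeft w LinearMap.id) t =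
      TensorProduct.lid k _ (LinearMap.rTensor (C ⊗[k] C) w (TensorProduct.assoc k C C C
        (LinearMap.rTensor C Coalgebra.comul t))) := fun t => by
    induction t with
    | zero => simp
    | add x y hx hy => simp only [map_add, hx, hy]
    | tmul x y =>
      simp only [convLeft, LinearMap.comp_apply, LinearEquiv.coe_coe, LinearMap.rTensor_tmul]
      generalize (Coalgebra.comul (R := k) x) = t
      induction t with
      | zero => simp
      | add x y hx hy => simp only [map_add, TensorProduct.add_tmul, hx, hy]
      | tmul x y => simp [TensorProduct.smul_tmul']
  have h₂ : ∀ t : C ⊗[k] C, TensorProduct.lid k _ (TensorProduct.map w Coalgebra.comul t) =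
      TensorProduct.lid k _ (LinearMap.rTensor (C ⊗[k] C) w
        (LinearMap.lTensor C (Coalgebra.comul (R := k)) t)) := fun t => by
    induction t with
    | zero => simp
    | add x y hx hy => simp only [map_add, hx, hy]
    | tmul x y => simp
  rw [comp_convLeft, LinearMap.comp_id, LinearMap.comp_apply, h₁, Coalgebra.coassoc_apply, ← h₂]
  rfl

theorem comul_comp_convRight_id (w : C →ₗ[k] k) :
    Coalgebra.comul ∘ₗ convRight (LinearMap.id (M := C)) w =
      LinearMap.lTensor C (convRight LinearMap.id w) ∘ₗ Coalgebra.comul (R := k) := by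
  ext c
  have h₁ : ∀ t : C ⊗[k] C, LinearMap.lTensor C (convRight LinearMap.id w) t =
      TensorProduct.rid k _ (LinearMap.lTensor (C ⊗[k] C) w ((TensorProduct.assoc k C C C).symm
        (LinearMap.lTensor C Coalgebra.comul t))) := fun t => by
    induction t with
    | zero => simp
    | add x y hx hy => simp only [map_add, hx, hy]
    | tmul x y =>
      simp only [convRight, LinearMap.comp_apply, LinearEquiv.coe_coe, LinearMap.lTensor_tmul]
      generalize (Coalgebra.comul (R := k) y) = t
      induction t with
      | zero => simp
      | add x y hx hy => simp only [map_add, TensorProduct.tmul_add, hx, hy]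
      | tmul x y => simp
  have h₂ : ∀ t : C ⊗[k] C, TensorProduct.rid k _ (TensorProduct.map Coalgebra.comul w t) =
      TensorProduct.rid k _ (LinearMap.lTensor (C ⊗[k] C) w
        (LinearMap.rTensor C (Coalgebra.comul (R := k)) t)) := fun t => by
    induction t with
    | zero => simp
    | add x y hx hy => simp only [map_add, hx, hy]
    | tmul x y => simp
  rw [comp_convRight, LinearMap.comp_id, LinearMap.comp_apply, h₁, Coalgebra.coassoc_symm_apply,
    ← h₂]
  rfl

end Convolution

/-! ### The `G`-grading of `H` by subcoalgebras. -/

namespace AssocZestingDatum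

variable {k H G : Type*} [Field k] [Ring H] [HopfAlgebra k H] [Group G]
  {M : Type*} [AddCommMonoid M] [Module k M]
  (D : AssocZestingDatum k H G)

/-- The coefficient of `g` on `k[G]`. -/
noncomputable def coeffAt (k : Type*) {G : Type*} [Field k] (g : G) : MonoidAlgebra k G →ₗ[k] k :=
  Finsupp.lapply g ∘ₗ (MonoidAlgebra.coeffLinearEquiv k).toLinearMap

open Classical in
theorem coeffAt_single (g g' : G) (a : k) :
    coeffAt k g (MonoidAlgebra.single g' a) = if g' = g then a else 0 := by
  simp [coeffAt, Finsupp.single_apply]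

open Classical in
/-- The `G`-coaction `h ↦ (g ↦ h_g)` induced by `π`. -/
noncomputable def coaction : H →ₗ[k] (G →₀ H) :=
  (TensorProduct.finsuppScalarLeft k H G).toLinearMap ∘ₗ
    LinearMap.rTensor H ((MonoidAlgebra.coeffLinearEquiv k).toLinearMap ∘ₗ
      (D.π : H →ₐ[k] MonoidAlgebra k G).toLinearMap) ∘ₗ Coalgebra.comul

/-- The functional whose left convolution action is the projection onto `H_g`. -/
noncomputable def idem (g : G) : H →ₗ[k] k :=
  coeffAt k g ∘ₗ (D.π : H →ₐ[k] MonoidAlgebra k G).toLinearMap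

open Classical in
theorem coaction_apply (h : H) (g : G) :
    D.coaction h g = convLeft (D.idem g) LinearMap.id h := by
  simp only [coaction, convLeft, LinearMap.comp_apply, LinearEquiv.coe_coe]
  generalize (Coalgebra.comul (R := k) h) = t
  induction t with
  | zero => simp
  | add x y hx hy => simp only [map_add, Finsupp.add_apply, hx, hy]
  | tmul x y => simp [TensorProduct.finsuppScalarLeft_apply_tmul_apply, idem, coeffAt]

open Classical in
theorem rid_map_coeffAt_comul (g g' : G) (x : MonoidAlgebra k G) :
    TensorProduct.rid k k (TensorProduct.map (coeffAt k g) (coeffAt k g')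
      (Coalgebra.comul (R := k) x)) = if g = g' then coeffAt k g x else 0 := by
  induction x using MonoidAlgebra.induction_linear with
  | zero => simp
  | add x y hx hy => simp only [map_add, hx, hy]; split_ifs <;> simp
  | single x a =>
    simp only [MonoidAlgebra.comul_single, CommSemiring.comul_apply, TensorProduct.map_tmul,
      MonoidAlgebra.lsingle_apply, coeffAt_single, TensorProduct.rid_tmul]
    split_ifs <;> simp_all

-- Coefficient functionals are orthogonal idempotents in the dual algebra of `k[G]`, and
-- precomposition with the coalgebra map `π` preserves convolution.
open Classical in
theorem convRight_idem (g g' : G) :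
    convRight (D.idem g) (D.idem g') = if g = g' then D.idem g else 0 := by
  ext h
  have h₁ := CoalgHomClass.map_comp_comul_apply D.π h
  have h₃ : convRight (D.idem g) (D.idem g') h = TensorProduct.rid k k
      (TensorProduct.map (coeffAt k g) (coeffAt k g')
        (Coalgebra.comul (R := k) (D.π h))) := by
    rw [← h₁]
    simp only [convRight, idem, TensorProduct.map_comp]
    rfl
  rw [h₃, rid_map_coeffAt_comul]
  split_ifs <;> simp [idem]

/-- Cocentrality of `π`, read off at the coefficient of `g`. -/
theorem convRight_id_idem (g : G) :
    convRight LinearMap.id (D.idem g) = convLeft (D.idem g) LinearMap.id := by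
  ext h
  have h₁ := LinearMap.congr_fun D.π_cocentral h
  have h₂ := congrArg (fun t => TensorProduct.rid k H (LinearMap.lTensor H (coeffAt k g) t)) h₁
  simp only [LinearMap.comp_apply, LinearEquiv.coe_coe] at h₂
  have e₁ : ∀ t : H ⊗[k] H, TensorProduct.rid k H (LinearMap.lTensor H (coeffAt k g)
      (LinearMap.lTensor H (D.π : H →ₐ[k] MonoidAlgebra k G).toLinearMap t)) =
      TensorProduct.rid k H (TensorProduct.map LinearMap.id (D.idem g) t) := fun t => by
    induction t with
    | zero => simp
    | add x y hx hy => simp only [map_add, hx, hy]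
    | tmul x y => simp [idem]
  have e₂ : ∀ t : H ⊗[k] H, TensorProduct.rid k H (LinearMap.lTensor H (coeffAt k g)
      (LinearMap.lTensor H (D.π : H →ₐ[k] MonoidAlgebra k G).toLinearMap
        (TensorProduct.comm k H H t))) =
      TensorProduct.lid k H (TensorProduct.map (D.idem g) LinearMap.id t) := fun t => by
    induction t with
    | zero => simp
    | add x y hx hy => simp only [map_add, hx, hy]
    | tmul x y => simp [idem]
  rw [e₁, e₂] at h₂
  exact h₂

/-- The homogeneous component `H_g` as a submodule. -/
def homogeneous (g : G) : Submodule k H where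
  carrier := D.component g
  add_mem' {x y} hx hy := by
    simp only [component, Set.mem_ofPred_eq, map_add, TensorProduct.tmul_add] at *
    rw [hx, hy]
  zero_mem' := by simp [component]
  smul_mem' a x hx := by
    simp only [component, Set.mem_ofPred_eq, map_smul, TensorProduct.tmul_smul] at *
    rw [hx]

-- Transports the defining equation of `H_g` along `k[G] ⊗ H ≃ (G →₀ H)`.
open Classical in
theorem mem_homogeneous_iff_coaction {g : G} {h : H} :
    h ∈ D.homogeneous g ↔ D.coaction h = Finsupp.single g h := by
  let e : MonoidAlgebra k G ⊗[k] H ≃ₗ[k] (G →₀ H) :=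
    (TensorProduct.congr (MonoidAlgebra.coeffLinearEquiv k) (LinearEquiv.refl k H)).trans
      (TensorProduct.finsuppScalarLeft k H G)
  have e₁ : D.coaction h = e (LinearMap.rTensor H
      (D.π : H →ₐ[k] MonoidAlgebra k G).toLinearMap (Coalgebra.comul h)) := by
    simp only [coaction, LinearMap.rTensor_comp, LinearMap.comp_apply]
    rfl
  have e₂ : Finsupp.single g h = e (MonoidAlgebra.single g 1 ⊗ₜ h) := by
    simp [e, TensorProduct.finsuppScalarLeft_apply_tmul]
  rw [e₁, e₂, e.injective.eq_iff]
  rfl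

theorem coaction_of_mem {g : G} {h : H} (hh : h ∈ D.homogeneous g) :
    D.coaction h = Finsupp.single g h :=
  D.mem_homogeneous_iff_coaction.1 hh

/-- Translation by `idem g` is a projection, and orthogonality annihilates the components at all
other group elements. -/
theorem coaction_apply_mem (h : H) (g : G) : D.coaction h g ∈ D.homogeneous g := by
  classical
  rw [mem_homogeneous_iff_coaction]
  ext g'
  rw [coaction_apply, coaction_apply, ← LinearMap.comp_apply, comp_convLeft, LinearMap.comp_id,
    convLeft_convLeft, convRight_idem, Finsupp.single_apply]
  split_ifs <;> simp [convLeft]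

theorem convLeft_idem_of_mem {g : G} {h : H} (hh : h ∈ D.homogeneous g) :
    convLeft (D.idem g) LinearMap.id h = h := by
  rw [← coaction_apply, D.coaction_of_mem hh, Finsupp.single_eq_same]

theorem convLeft_idem_mem (g : G) (h : H) :
    convLeft (D.idem g) LinearMap.id h ∈ D.homogeneous g :=
  D.coaction_apply h g ▸ D.coaction_apply_mem h g

-- The counit of `k[G]` sums coefficients and `π` preserves counits, so this is the counit axiom of
-- `H`.
open Classical in
theorem sum_coaction (h : H) : ((D.coaction h).sum fun _ x => x) = h := by
  have h₁ : ∀ t : H ⊗[k] H, ((TensorProduct.finsuppScalarLeft k H G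
      (LinearMap.rTensor H ((MonoidAlgebra.coeffLinearEquiv k).toLinearMap ∘ₗ
        (D.π : H →ₐ[k] MonoidAlgebra k G).toLinearMap) t)).sum fun _ x => x) =
      TensorProduct.lid k H (LinearMap.rTensor H Coalgebra.counit t) := fun t => by
    induction t with
    | zero => simp
    | add x y hx hy =>
      simp only [map_add]
      rw [Finsupp.sum_add_index' (by simp) (by simp), hx, hy]
    | tmul x y =>
      have h₂ : ∀ z : MonoidAlgebra k G, (z.coeff.sum fun _ a => a) =
          Coalgebra.counit (R := k) z := fun z => by
        induction z using MonoidAlgebra.induction_linear with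
        | zero => simp
        | add x y hx hy =>
          simp only [map_add, ← hx, ← hy, MonoidAlgebra.coeff_add]
          rw [Finsupp.sum_add_index' (by simp) (by simp)]
        | single x a => simp
      have h₃ := h₂ (D.π x)
      rw [CoalgHomClass.counit_comp_apply] at h₃
      simp only [LinearMap.rTensor_tmul, TensorProduct.finsuppScalarLeft_apply_tmul,
        TensorProduct.lid_tmul, ← h₃]
      rw [Finsupp.sum_sum_index (by simp) (by simp)]
      simp only [Finsupp.sum_single_index]
      simp [Finsupp.sum, Finset.sum_smul]
  have := h₁ (Coalgebra.comul h)
  rw [Coalgebra.rTensor_counit_comul] at this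
  rw [TensorProduct.lid_tmul, one_smul] at this
  exact this

@[elab_as_elim]
theorem homogeneous_induction {p : H → Prop} (h : H) (zero : p 0)
    (add : ∀ x y, p x → p y → p (x + y)) (hom : ∀ g, ∀ x ∈ D.homogeneous g, p x) : p h := by
  rw [← D.sum_coaction h, Finsupp.sum]
  exact Finset.sum_induction _ p add zero fun g _ => hom g _ (D.coaction_apply_mem h g)

theorem ext_homogeneous {f f' : H →ₗ[k] M} (hf : ∀ g, ∀ h ∈ D.homogeneous g, f h = f' h) :
    f = f' := by
  ext h
  exact D.homogeneous_induction h (by simp) (fun x y hx hy => by simp only [map_add, hx, hy]) hf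

/-- The projection `E` onto `H_g` is a left translation, which acts on the first leg of `Δ`, and by
cocentrality also a right translation, which acts on the second leg. Hence `Δ h = (E ⊗ E) Δ h` for
`h ∈ H_g`. -/
theorem isSubcoalgebra_homogeneous (g : G) : IsSubcoalgebra (D.homogeneous g) := by
  intro h hh
  set E := convLeft (D.idem g) (LinearMap.id (M := H)) with hE
  have e : E h = h := D.convLeft_idem_of_mem hh
  have e₁ := LinearMap.congr_fun (comul_comp_convLeft_id (D.idem g)) h
  have e₂ := LinearMap.congr_fun (comul_comp_convRight_id (D.idem g)) h
  rw [D.convRight_id_idem, ← hE, LinearMap.comp_apply, e] at e₂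
  rw [← hE, LinearMap.comp_apply, e, LinearMap.comp_apply] at e₁
  rw [e₁, e₂, LinearMap.comp_apply]
  generalize Coalgebra.comul (R := k) h = t
  induction t with
  | zero => simp
  | add x y hx hy => simpa using add_mem hx hy
  | tmul x y =>
    exact tmul_mem_tensorSubmodule (D.convLeft_idem_mem g x) (D.convLeft_idem_mem g y)

theorem one_mem_homogeneous : (1 : H) ∈ D.homogeneous 1 := by
  change LinearMap.rTensor H _ (Coalgebra.comul (1 : H)) = _
  rw [Bialgebra.comul_one, Algebra.TensorProduct.one_def]
  simp [MonoidAlgebra.one_def]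

theorem mul_mem_homogeneous {g g' : G} {h l : H} (hh : h ∈ D.homogeneous g)
    (hl : l ∈ D.homogeneous g') : h * l ∈ D.homogeneous (g * g') := by
  have key : ∀ t : H ⊗[k] H,
      LinearMap.rTensor H (D.π : H →ₐ[k] MonoidAlgebra k G).toLinearMap t =
      Algebra.TensorProduct.map (D.π : H →ₐ[k] MonoidAlgebra k G) (AlgHom.id k H) t :=
    fun t => rfl
  change LinearMap.rTensor H _ (Coalgebra.comul (h * l)) = _
  have hh' : LinearMap.rTensor H _ (Coalgebra.comul h) = _ := hh
  have hl' : LinearMap.rTensor H _ (Coalgebra.comul l) = _ := hl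
  rw [key] at hh' hl'
  rw [Bialgebra.comul_mul, key, map_mul, hh', hl']
  simp

/-- Coinvariance applies `π` to the second leg and the grading to the first; for a group-like
element `Δ` is symmetric, so a flip suffices. -/
theorem coe_mem_homogeneous (u : D.Γ₀) : ((u : GroupLike k H) : H) ∈ D.homogeneous 1 := by
  have h₁ := D.Γ₀_coinvariant u u.2
  have h₂ := congrArg (TensorProduct.comm k _ _) h₁
  change LinearMap.rTensor H _ (Coalgebra.comul _) = _
  rw [(u : GroupLike k H).2.comul_eq_tmul_self] at h₂ ⊢
  simpa [MonoidAlgebra.one_def] using h₂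

end AssocZestingDatum

/-! ### Blockwise maps, the antipode, and calculus with `Γ₀` and its characters. -/

namespace AssocZestingDatum

variable {k H G : Type*} [Field k] [Ring H] [HopfAlgebra k H] [Group G]
  {M : Type*} [AddCommMonoid M] [Module k M]
  (D : AssocZestingDatum k H G)

/-- The linear map which is `F g` on `H_g`. -/
noncomputable def assemble (F : G → H →ₗ[k] M) : H →ₗ[k] M :=
  Finsupp.lsum k F ∘ₗ D.coaction

theorem assemble_of_mem (F : G → H →ₗ[k] M) {g : G} {h : H} (hh : h ∈ D.homogeneous g) :
    D.assemble F h = F g h := by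
  simp [assemble, D.coaction_of_mem hh]

/-- The linear map which is `F g₁ g₂` on `H_{g₁} ⊗ H_{g₂}`. -/
noncomputable def assemble₂ (F : G → G → H ⊗[k] H →ₗ[k] M) : H ⊗[k] H →ₗ[k] M :=
  TensorProduct.lift (D.assemble fun g =>
    (D.assemble fun g' => (TensorProduct.curry (F g g')).flip).flip)

theorem assemble₂_tmul (F : G → G → H ⊗[k] H →ₗ[k] M) {g g' : G} {h l : H}
    (hh : h ∈ D.homogeneous g) (hl : l ∈ D.homogeneous g') :
    D.assemble₂ F (h ⊗ₜ l) = F g g' (h ⊗ₜ l) := by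
  simp [assemble₂, D.assemble_of_mem _ hh, D.assemble_of_mem _ hl]

/-- The linear map which is `F g₁ g₂ g₃` on `(H_{g₁} ⊗ H_{g₂}) ⊗ H_{g₃}`. -/
noncomputable def assemble₃ (F : G → G → G → (H ⊗[k] H) ⊗[k] H →ₗ[k] M) :
    (H ⊗[k] H) ⊗[k] H →ₗ[k] M :=
  TensorProduct.lift (D.assemble fun g₃ =>
    (D.assemble₂ fun g₁ g₂ => TensorProduct.curry (F g₁ g₂ g₃)).flip).flip

theorem assemble₃_tmul (F : G → G → G → (H ⊗[k] H) ⊗[k] H →ₗ[k] M) {g₁ g₂ g₃ : G} {h l t : H}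
    (hh : h ∈ D.homogeneous g₁) (hl : l ∈ D.homogeneous g₂) (ht : t ∈ D.homogeneous g₃) :
    D.assemble₃ F ((h ⊗ₜ l) ⊗ₜ t) = F g₁ g₂ g₃ ((h ⊗ₜ l) ⊗ₜ t) := by
  simp [assemble₃, D.assemble_of_mem _ ht, D.assemble₂_tmul _ hh hl]

/-- The submodule `H_{g₁} ⊗ H_{g₂}`. -/
noncomputable def homogeneous₂ (g₁ g₂ : G) : Submodule k (H ⊗[k] H) :=
  tensorSubmodule (D.homogeneous g₁) (D.homogeneous g₂)

/-- The submodule `(H_{g₁} ⊗ H_{g₂}) ⊗ H_{g₃}`. -/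
noncomputable def homogeneous₃ (g₁ g₂ g₃ : G) : Submodule k ((H ⊗[k] H) ⊗[k] H) :=
  tensorSubmodule (D.homogeneous₂ g₁ g₂) (D.homogeneous g₃)

/-- The submodule `((H_{g₁} ⊗ H_{g₂}) ⊗ H_{g₃}) ⊗ H_{g₄}`. -/
noncomputable def homogeneous₄ (g₁ g₂ g₃ g₄ : G) : Submodule k (((H ⊗[k] H) ⊗[k] H) ⊗[k] H) :=
  tensorSubmodule (D.homogeneous₃ g₁ g₂ g₃) (D.homogeneous g₄)

theorem isSubcoalgebra_homogeneous₂ (g₁ g₂ : G) : IsSubcoalgebra (D.homogeneous₂ g₁ g₂) :=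
  (D.isSubcoalgebra_homogeneous g₁).tensor (D.isSubcoalgebra_homogeneous g₂)

theorem isSubcoalgebra_homogeneous₃ (g₁ g₂ g₃ : G) : IsSubcoalgebra (D.homogeneous₃ g₁ g₂ g₃) :=
  (D.isSubcoalgebra_homogeneous₂ g₁ g₂).tensor (D.isSubcoalgebra_homogeneous g₃)

theorem isSubcoalgebra_homogeneous₄ (g₁ g₂ g₃ g₄ : G) :
    IsSubcoalgebra (D.homogeneous₄ g₁ g₂ g₃ g₄) :=
  (D.isSubcoalgebra_homogeneous₃ g₁ g₂ g₃).tensor (D.isSubcoalgebra_homogeneous g₄)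

theorem ext_homogeneous₂ {f f' : H ⊗[k] H →ₗ[k] M}
    (hf : ∀ g₁ g₂, ∀ t ∈ D.homogeneous₂ g₁ g₂, f t = f' t) : f = f' :=
  TensorProduct.ext (D.ext_homogeneous fun g₁ _ hh => D.ext_homogeneous fun g₂ _ hl =>
    hf g₁ g₂ _ (tmul_mem_tensorSubmodule hh hl))

theorem ext_homogeneous₃ {f f' : (H ⊗[k] H) ⊗[k] H →ₗ[k] M}
    (hf : ∀ g₁ g₂ g₃, ∀ t ∈ D.homogeneous₃ g₁ g₂ g₃, f t = f' t) : f = f' :=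
  TensorProduct.ext (D.ext_homogeneous₂ fun g₁ g₂ _ hh => D.ext_homogeneous fun g₃ _ hl =>
    hf g₁ g₂ g₃ _ (tmul_mem_tensorSubmodule hh hl))

theorem ext_homogeneous₄ {f f' : ((H ⊗[k] H) ⊗[k] H) ⊗[k] H →ₗ[k] M}
    (hf : ∀ g₁ g₂ g₃ g₄, ∀ t ∈ D.homogeneous₄ g₁ g₂ g₃ g₄, f t = f' t) : f = f' :=
  TensorProduct.ext (D.ext_homogeneous₃ fun g₁ g₂ g₃ _ hh => D.ext_homogeneous fun g₄ _ hl =>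
    hf g₁ g₂ g₃ g₄ _ (tmul_mem_tensorSubmodule hh hl))

theorem eqOn_homogeneous₂ {g₁ g₂ : G} {f f' : H ⊗[k] H →ₗ[k] M}
    (hf : ∀ h ∈ D.homogeneous g₁, ∀ l ∈ D.homogeneous g₂, f (h ⊗ₜ l) = f' (h ⊗ₜ l)) :
    ∀ t ∈ D.homogeneous₂ g₁ g₂, f t = f' t :=
  eqOn_tensorSubmodule hf

theorem eqOn_homogeneous₃ {g₁ g₂ g₃ : G} {f f' : (H ⊗[k] H) ⊗[k] H →ₗ[k] M}
    (hf : ∀ h ∈ D.homogeneous g₁, ∀ l ∈ D.homogeneous g₂, ∀ t ∈ D.homogeneous g₃,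
      f ((h ⊗ₜ l) ⊗ₜ t) = f' ((h ⊗ₜ l) ⊗ₜ t)) :
    ∀ t ∈ D.homogeneous₃ g₁ g₂ g₃, f t = f' t :=
  eqOn_tensorSubmodule fun c hc t ht =>
    D.eqOn_homogeneous₂ (f := (TensorProduct.curry f).flip t)
      (f' := (TensorProduct.curry f').flip t) (fun h hh l hl => hf h hh l hl t ht) c hc

theorem eqOn_homogeneous₄ {g₁ g₂ g₃ g₄ : G} {f f' : ((H ⊗[k] H) ⊗[k] H) ⊗[k] H →ₗ[k] M}
    (hf : ∀ h ∈ D.homogeneous g₁, ∀ l ∈ D.homogeneous g₂, ∀ t ∈ D.homogeneous g₃,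
      ∀ s ∈ D.homogeneous g₄, f (((h ⊗ₜ l) ⊗ₜ t) ⊗ₜ s) = f' (((h ⊗ₜ l) ⊗ₜ t) ⊗ₜ s)) :
    ∀ t ∈ D.homogeneous₄ g₁ g₂ g₃ g₄, f t = f' t :=
  eqOn_tensorSubmodule fun c hc s hs =>
    D.eqOn_homogeneous₃ (f := (TensorProduct.curry f).flip s)
      (f' := (TensorProduct.curry f').flip s)
      (fun h hh l hl t ht => hf h hh l hl t ht s hs) c hc

/-- The coaction `h ↦ π(h₁) ⊗ h₂` as an algebra map. -/
noncomputable def coactionHom : H →ₐ[k] MonoidAlgebra k G ⊗[k] H :=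
  (Algebra.TensorProduct.map (D.π : H →ₐ[k] MonoidAlgebra k G) (AlgHom.id k H)).comp
    (Bialgebra.comulAlgHom k H)

theorem mem_homogeneous_iff {g : G} {h : H} :
    h ∈ D.homogeneous g ↔ D.coactionHom h = MonoidAlgebra.single g 1 ⊗ₜ h :=
  Iff.rfl

/-- Let `δ` be the coaction as an algebra map. Then `δ ∘ S` is a left convolution inverse of `δ`,
and the map `T` given by `g⁻¹ ⊗ S(h)` on `H_g` is a right one, so they coincide. -/
theorem antipode_mem_homogeneous {g : G} {h : H} (hh : h ∈ D.homogeneous g) :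
    HopfAlgebra.antipode k h ∈ D.homogeneous g⁻¹ := by
  let T : H →ₗ[k] MonoidAlgebra k G ⊗[k] H := D.assemble fun g =>
    TensorProduct.mk k (MonoidAlgebra k G) H (MonoidAlgebra.single g⁻¹ 1) ∘ₗ
      HopfAlgebra.antipode k
  have h₁ : WithConv.toConv (D.coactionHom.toLinearMap ∘ₗ HopfAlgebra.antipode k) *
      WithConv.toConv D.coactionHom.toLinearMap = 1 := by
    have := LinearMap.algHom_comp_convMul_distrib D.coactionHom
      (WithConv.toConv (HopfAlgebra.antipode k (A := H))) (WithConv.toConv LinearMap.id)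
    rw [LinearMap.antipode_mul_id] at this
    apply WithConv.ofConv_injective
    refine Eq.trans this.symm ?_
    ext x
    simp [LinearMap.convOne_def]
  have h₂ : WithConv.toConv D.coactionHom.toLinearMap * WithConv.toConv T = 1 := by
    apply WithConv.ofConv_injective
    refine D.ext_homogeneous fun g h hh => ?_
    have e₂ : ∀ t ∈ D.homogeneous₂ g g,
        LinearMap.mul' k _ (TensorProduct.map D.coactionHom.toLinearMap T t) =
        TensorProduct.mk k (MonoidAlgebra k G) H 1
          (LinearMap.mul' k H (LinearMap.lTensor H (HopfAlgebra.antipode k) t)) := by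
      refine D.eqOn_homogeneous₂ (f := LinearMap.mul' k _ ∘ₗ
        TensorProduct.map D.coactionHom.toLinearMap T) (f' := TensorProduct.mk k _ _ 1 ∘ₗ
          LinearMap.mul' k H ∘ₗ LinearMap.lTensor H (HopfAlgebra.antipode k)) fun a ha b hb => ?_
      simp [T, D.assemble_of_mem _ hb, D.mem_homogeneous_iff.1 ha, MonoidAlgebra.one_def]
    have e₃ := e₂ _ (D.isSubcoalgebra_homogeneous g h hh)
    rw [HopfAlgebra.mul_antipode_lTensor_comul_apply] at e₃
    refine Eq.trans e₃ ?_
    simp [LinearMap.convOne_def, Algebra.TensorProduct.one_def, Algebra.algebraMap_eq_smul_one]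
  have h₃ := congrArg WithConv.ofConv (left_inv_eq_right_inv h₁ h₂)
  have h₄ := LinearMap.congr_fun h₃ h
  rw [mem_homogeneous_iff]
  refine Eq.trans h₄ ?_
  simp [T, D.assemble_of_mem _ hh]

/-- The element of `H` underlying an element of `Γ₀`. -/
def elt (u : D.Γ₀) : H := (u : GroupLike k H)

/-- The character `⟨γ(u), -⟩` as a functional. -/
noncomputable def form (u : D.Γ₀) : H →ₗ[k] k := (D.γ u).ofConv.toLinearMap

variable {D}

theorem elt_one : D.elt 1 = 1 := rfl

theorem elt_mul (u v : D.Γ₀) : D.elt (u * v) = D.elt u * D.elt v := rfl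

theorem comul_elt (u : D.Γ₀) : Coalgebra.comul (R := k) (D.elt u) = D.elt u ⊗ₜ D.elt u :=
  (u : GroupLike k H).2.comul_eq_tmul_self

@[simp]
theorem counit_elt (u : D.Γ₀) : Coalgebra.counit (R := k) (D.elt u) = 1 :=
  (u : GroupLike k H).2.counit_eq_one

theorem elt_inv_mul (u : D.Γ₀) : D.elt u⁻¹ * D.elt u = 1 := by
  rw [← elt_mul, inv_mul_cancel, elt_one]

theorem elt_mul_inv (u : D.Γ₀) : D.elt u * D.elt u⁻¹ = 1 := by
  rw [← elt_mul, mul_inv_cancel, elt_one]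

theorem elt_mem (u : D.Γ₀) : D.elt u ∈ D.homogeneous 1 := D.coe_mem_homogeneous u

theorem elt_injective : Function.Injective D.elt := fun _ _ h =>
  Subtype.ext (GroupLike.val_injective h)

theorem mul_elt_mem {g : G} {h : H} (hh : h ∈ D.homogeneous g) (u : D.Γ₀) :
    h * D.elt u ∈ D.homogeneous g := by
  simpa using D.mul_mem_homogeneous hh (elt_mem u)

theorem form_mul (u v : D.Γ₀) : D.form (u * v) = convRight (D.form u) (D.form v) := by
  rw [form, map_mul]
  change LinearMap.mul' k k ∘ₗ TensorProduct.map (D.form u) (D.form v) ∘ₗ Coalgebra.comul = _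
  rw [convRight, ← LinearMap.comp_assoc, ← LinearMap.comp_assoc]
  congr 1
  ext a b
  simp [mul_comm]

theorem form_one : D.form 1 = Coalgebra.counit := by
  rw [form, map_one]
  rfl

@[simp]
theorem form_apply_mul (u : D.Γ₀) (h l : H) : D.form u (h * l) = D.form u h * D.form u l :=
  map_mul (D.γ u).ofConv h l

@[simp]
theorem form_apply_one (u : D.Γ₀) : D.form u 1 = 1 :=
  map_one (D.γ u).ofConv

theorem convLeft_form_mul_elt (u : D.Γ₀) (h : H) :
    convLeft (D.form u) LinearMap.id h * D.elt u =
      D.elt u * convRight LinearMap.id (D.form u) h :=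
  D.central u h

theorem form_elt_ne_zero (u v : D.Γ₀) : D.form u (D.elt v) ≠ 0 := by
  intro h
  have := form_apply_mul u (D.elt v) (D.elt v⁻¹)
  rw [h, zero_mul, elt_mul_inv, form_apply_one] at this
  exact one_ne_zero this

/-- Centrality of `γ(u)` tested on the group-like `v`: both convolutions scale `v` by the same
nonzero number, which cancels. Commutativity of `Γ₀` is thus a consequence of the axioms. -/
theorem mul_comm_Γ₀ (u v : D.Γ₀) : u * v = v * u := by
  have h := convLeft_form_mul_elt u (D.elt v)
  simp only [convLeft, convRight, LinearMap.comp_apply, comul_elt, TensorProduct.map_tmul,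
    LinearEquiv.coe_coe, TensorProduct.lid_tmul, TensorProduct.rid_tmul, LinearMap.id_apply,
    smul_mul_assoc, mul_smul_comm] at h
  exact elt_injective (smul_right_injective H (form_elt_ne_zero u v) h).symm

theorem form_apply_inv (u v : D.Γ₀) : D.form u (D.elt v⁻¹) = (D.form u (D.elt v))⁻¹ := by
  refine eq_inv_of_mul_eq_one_left ?_
  rw [← form_apply_mul, elt_inv_mul, form_apply_one]

theorem form_lam_apply_lam (g₁ g₂ g₃ g₄ : G) :
    D.form (D.lam g₁ g₂) (D.elt (D.lam g₃ g₄)) = (coboundary₃ D.ω g₁ g₂ g₃ g₄ : kˣ) :=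
  D.compat g₁ g₂ g₃ g₄

/-- The cocycle identity at `(g, g⁻¹, g)`, where normalization removes the other two values. -/
theorem lam_inv_comm (g : G) : D.lam g⁻¹ g = D.lam g g⁻¹ := by
  have := D.lam_cocycle.cocycle g g⁻¹ g
  simpa [D.lam_cocycle.one_left, D.lam_cocycle.one_right] using this.symm

end AssocZestingDatum

/-! ### Multiplication and associator of `H^λ`. -/

namespace AssocZestingDatum

variable {k H G : Type*} [Field k] [Ring H] [HopfAlgebra k H] [Group G]
  {D : AssocZestingDatum k H G}

/-- The map `h ⊗ l ↦ h l u`. -/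
noncomputable def mulElt (u : D.Γ₀) : H ⊗[k] H →ₗ[k] H :=
  LinearMap.mulRight k (D.elt u) ∘ₗ LinearMap.mul' k H

@[simp]
theorem mulElt_tmul (u : D.Γ₀) (h l : H) : mulElt u (h ⊗ₜ l) = h * l * D.elt u := rfl

/-- The functional `h ⊗ l ⊗ t ↦ w ε(h) ε(l) ⟨γ(u), t⟩`. -/
noncomputable def assocForm (w : k) (u : D.Γ₀) : (H ⊗[k] H) ⊗[k] H →ₗ[k] k :=
  w • outer (outer Coalgebra.counit Coalgebra.counit) (D.form u)

@[simp]
theorem assocForm_tmul (w : k) (u : D.Γ₀) (h l t : H) : assocForm w u ((h ⊗ₜ l) ⊗ₜ t) =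
    w * (Coalgebra.counit (R := k) h * Coalgebra.counit (R := k) l * D.form u t) := rfl

theorem counit_mulElt (u : D.Γ₀) : Coalgebra.counit (R := k) ∘ₗ mulElt u = Coalgebra.counit := by
  ext h l
  simp [mul_comm]

/-- Multiplication of a bialgebra is a coalgebra map, and so is right multiplication by a group-like
element. -/
theorem map_mulElt_comul (u : D.Γ₀) : TensorProduct.map (mulElt u) (mulElt u) ∘ₗ Coalgebra.comul =
    Coalgebra.comul (R := k) ∘ₗ mulElt u := by
  have h₁ := CoalgHomClass.map_comp_comul (Bialgebra.mulCoalgHom k H)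
  have h₂ : TensorProduct.map (LinearMap.mulRight k (D.elt u)) (LinearMap.mulRight k (D.elt u)) ∘ₗ
      Coalgebra.comul = Coalgebra.comul (R := k) ∘ₗ LinearMap.mulRight k (D.elt u) := by
    ext x
    simp only [LinearMap.comp_apply, LinearMap.mulRight_apply, Bialgebra.comul_mul, comul_elt]
    generalize (Coalgebra.comul (R := k) x) = t
    induction t with
    | zero => simp
    | add x y hx hy => simp only [map_add, add_mul, hx, hy]
    | tmul x y => simp
  have h₃ : (Bialgebra.mulCoalgHom k H : H ⊗[k] H →ₗ[k] H) = LinearMap.mul' k H := rfl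
  rw [h₃] at h₁
  rw [mulElt, TensorProduct.map_comp, LinearMap.comp_assoc, h₁, ← LinearMap.comp_assoc, h₂,
    LinearMap.comp_assoc]

theorem convRight_counit_left (w : H →ₗ[k] k) : convRight Coalgebra.counit w = w := by
  rw [← convLeft_eq_convRight, convLeft_counit]

theorem convRight_assocForm (w w' : k) (u u' : D.Γ₀) :
    convRight (assocForm w u) (assocForm w' u') = assocForm (w * w') (u * u') := by
  rw [assocForm, assocForm, convRight_smul_left, convRight_smul_right, smul_smul, convRight_outer,
    convRight_outer, convRight_counit, ← form_mul, assocForm]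

theorem assocForm_one : assocForm 1 (1 : D.Γ₀) = Coalgebra.counit := by
  rw [assocForm, one_smul, form_one, outer_counit, outer_counit]

/-- Quasi-associativity on one block. The counits in the first two slots disappear, leaving the
centrality of `γ(u)` in the third slot; `huv` will be the 2-cocycle identity. -/
theorem convRight_mulElt_assocForm (w : k) {u u' v v' : D.Γ₀} (huv : u * u' = v * v') :
    convRight (mulElt u' ∘ₗ (mulElt u).rTensor H) (assocForm w u) =
      convLeft (assocForm w u) (mulElt v' ∘ₗ (mulElt v).lTensor H ∘ₗ
        (TensorProduct.assoc k H H H).toLinearMap) := by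
  rw [convRight_eq_comp, convLeft_eq_comp, assocForm, convRight_smul_right, convLeft_smul_left,
    ← TensorProduct.map_id, convRight_map, convLeft_map, ← TensorProduct.map_id, convRight_map,
    convLeft_map]
  simp only [convRight_counit, convLeft_counit]
  ext h l t
  -- Moving `u` to the right past `t` exchanges right for left convolution with `γ(u)`; afterwards
  -- `u u'` may be replaced by `v v'`.
  have key : D.elt u * convRight LinearMap.id (D.form u) t * D.elt u' =
      convLeft (D.form u) LinearMap.id t * (D.elt v * D.elt v') := by
    rw [← convLeft_form_mul_elt, mul_assoc, ← elt_mul, huv, elt_mul]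
  simp only [mul_assoc] at key
  simp [mul_assoc, key]

variable (D) in
/-- The multiplication of `H^λ`. -/
noncomputable def zestedMul : H ⊗[k] H →ₗ[k] H := D.assemble₂ fun g₁ g₂ => mulElt (D.lam g₁ g₂)

variable (D) in
/-- The associator of `H^λ`. -/
noncomputable def zestedAssoc : (H ⊗[k] H) ⊗[k] H →ₗ[k] k :=
  D.assemble₃ fun g₁ g₂ g₃ => assocForm (D.ω g₁ g₂ g₃ : kˣ) (D.lam g₁ g₂)

variable (D) in
/-- The convolution inverse of the associator of `H^λ`. -/
noncomputable def zestedAssocInv : (H ⊗[k] H) ⊗[k] H →ₗ[k] k :=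
  D.assemble₃ fun g₁ g₂ g₃ => assocForm ((D.ω g₁ g₂ g₃)⁻¹ : kˣ) (D.lam g₁ g₂)⁻¹

theorem zestedMul_tmul {g₁ g₂ : G} {h l : H} (hh : h ∈ D.homogeneous g₁)
    (hl : l ∈ D.homogeneous g₂) : D.zestedMul (h ⊗ₜ l) = h * l * D.elt (D.lam g₁ g₂) := by
  rw [zestedMul, D.assemble₂_tmul _ hh hl, mulElt_tmul]

theorem zestedMul_mem {g₁ g₂ : G} {h l : H} (hh : h ∈ D.homogeneous g₁)
    (hl : l ∈ D.homogeneous g₂) : D.zestedMul (h ⊗ₜ l) ∈ D.homogeneous (g₁ * g₂) := by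
  rw [zestedMul_tmul hh hl]
  exact mul_elt_mem (D.mul_mem_homogeneous hh hl) _

theorem zestedMul_eqOn (g₁ g₂ : G) : ∀ t ∈ D.homogeneous₂ g₁ g₂,
    D.zestedMul t = mulElt (D.lam g₁ g₂) t :=
  D.eqOn_homogeneous₂ fun _ hh _ hl => zestedMul_tmul hh hl

theorem zestedAssoc_tmul {g₁ g₂ g₃ : G} {h l t : H} (hh : h ∈ D.homogeneous g₁)
    (hl : l ∈ D.homogeneous g₂) (ht : t ∈ D.homogeneous g₃) :
    D.zestedAssoc ((h ⊗ₜ l) ⊗ₜ t) = (D.ω g₁ g₂ g₃ : kˣ) * (Coalgebra.counit (R := k) h *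
      Coalgebra.counit (R := k) l * D.form (D.lam g₁ g₂) t) := by
  rw [zestedAssoc, D.assemble₃_tmul _ hh hl ht, assocForm_tmul]

theorem zestedAssocInv_tmul {g₁ g₂ g₃ : G} {h l t : H} (hh : h ∈ D.homogeneous g₁)
    (hl : l ∈ D.homogeneous g₂) (ht : t ∈ D.homogeneous g₃) :
    D.zestedAssocInv ((h ⊗ₜ l) ⊗ₜ t) = ((D.ω g₁ g₂ g₃)⁻¹ : kˣ) * (Coalgebra.counit (R := k) h *
      Coalgebra.counit (R := k) l * D.form (D.lam g₁ g₂)⁻¹ t) := by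
  rw [zestedAssocInv, D.assemble₃_tmul _ hh hl ht, assocForm_tmul]

theorem zestedAssoc_eqOn (g₁ g₂ g₃ : G) : ∀ t ∈ D.homogeneous₃ g₁ g₂ g₃,
    D.zestedAssoc t = assocForm ((D.ω g₁ g₂ g₃ : kˣ) : k) (D.lam g₁ g₂) t :=
  D.eqOn_homogeneous₃ fun _ hh _ hl _ ht => zestedAssoc_tmul hh hl ht

theorem zestedAssocInv_eqOn (g₁ g₂ g₃ : G) : ∀ t ∈ D.homogeneous₃ g₁ g₂ g₃,
    D.zestedAssocInv t = assocForm (((D.ω g₁ g₂ g₃)⁻¹ : kˣ) : k) (D.lam g₁ g₂)⁻¹ t :=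
  D.eqOn_homogeneous₃ fun _ hh _ hl _ ht => zestedAssocInv_tmul hh hl ht

theorem zestedAssoc_conv_zestedAssocInv :
    convRight D.zestedAssoc D.zestedAssocInv = Coalgebra.counit := by
  refine D.ext_homogeneous₃ fun g₁ g₂ g₃ t ht => ?_
  rw [(D.isSubcoalgebra_homogeneous₃ g₁ g₂ g₃).convRight_congr (zestedAssoc_eqOn g₁ g₂ g₃)
    (zestedAssocInv_eqOn g₁ g₂ g₃) t ht, convRight_assocForm, mul_inv_cancel, Units.mul_inv,
    assocForm_one]

theorem zestedAssocInv_conv_zestedAssoc :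
    convRight D.zestedAssocInv D.zestedAssoc = Coalgebra.counit := by
  refine D.ext_homogeneous₃ fun g₁ g₂ g₃ t ht => ?_
  rw [(D.isSubcoalgebra_homogeneous₃ g₁ g₂ g₃).convRight_congr (zestedAssocInv_eqOn g₁ g₂ g₃)
    (zestedAssoc_eqOn g₁ g₂ g₃) t ht, convRight_assocForm, inv_mul_cancel, Units.inv_mul,
    assocForm_one]

theorem counit_comp_zestedMul :
    Coalgebra.counit (R := k) ∘ₗ D.zestedMul = Coalgebra.counit := by
  refine D.ext_homogeneous₂ fun g₁ g₂ t ht => ?_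
  rw [LinearMap.comp_apply, zestedMul_eqOn g₁ g₂ t ht, ← LinearMap.comp_apply, counit_mulElt]

theorem map_zestedMul_comul : TensorProduct.map D.zestedMul D.zestedMul ∘ₗ Coalgebra.comul =
    Coalgebra.comul (R := k) ∘ₗ D.zestedMul := by
  refine D.ext_homogeneous₂ fun g₁ g₂ t ht => ?_
  rw [LinearMap.comp_apply, map_eqOn (zestedMul_eqOn g₁ g₂) (zestedMul_eqOn g₁ g₂) _
    (D.isSubcoalgebra_homogeneous₂ g₁ g₂ t ht), ← LinearMap.comp_apply, map_mulElt_comul,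
    LinearMap.comp_apply, LinearMap.comp_apply, zestedMul_eqOn g₁ g₂ t ht]

theorem zestedMul_assoc :
    convRight (D.zestedMul ∘ₗ D.zestedMul.rTensor H) D.zestedAssoc =
      convLeft D.zestedAssoc (D.zestedMul ∘ₗ D.zestedMul.lTensor H ∘ₗ
        (TensorProduct.assoc k H H H).toLinearMap) := by
  refine D.ext_homogeneous₃ fun g₁ g₂ g₃ t ht => ?_
  have hs := D.isSubcoalgebra_homogeneous₃ g₁ g₂ g₃
  rw [hs.convRight_congr (f' := mulElt (D.lam (g₁ * g₂) g₃) ∘ₗ (mulElt (D.lam g₁ g₂)).rTensor H)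
    (D.eqOn_homogeneous₃ fun h hh l hl t ht => ?_) (zestedAssoc_eqOn g₁ g₂ g₃) t ht,
    hs.convLeft_congr (f' := mulElt (D.lam g₁ (g₂ * g₃)) ∘ₗ (mulElt (D.lam g₂ g₃)).lTensor H ∘ₗ
        (TensorProduct.assoc k H H H).toLinearMap)
      (D.eqOn_homogeneous₃ fun h hh l hl t ht => ?_) (zestedAssoc_eqOn g₁ g₂ g₃) t ht,
    convRight_mulElt_assocForm]
  · rw [D.lam_cocycle.cocycle]
  · simp only [LinearMap.comp_apply, LinearMap.lTensor_tmul, LinearEquiv.coe_coe,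
      TensorProduct.assoc_tmul]
    rw [zestedMul_tmul hh (zestedMul_mem hl ht), zestedMul_tmul hl ht]
    rfl
  · simp only [LinearMap.comp_apply, LinearMap.rTensor_tmul]
    rw [zestedMul_tmul (zestedMul_mem hh hl) ht, zestedMul_tmul hh hl]
    rfl

/-- On a block each of the five factors is a scalar times a product of characters, so both sides can
be compared slot by slot. An extra scalar `⟨γ(λ(g₁,g₂)), λ(g₃,g₄)⟩` arises because `Ω` is evaluated
on a twisted product in its last argument; it is the left side of `(*)`. -/
theorem zested_pentagon :
    convRight (D.zestedAssoc ∘ₗ (D.zestedMul.rTensor H).rTensor H)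
        (D.zestedAssoc ∘ₗ D.zestedMul.lTensor (H ⊗[k] H) ∘ₗ
          (TensorProduct.assoc k (H ⊗[k] H) H H).toLinearMap) =
      convRight
        (convRight (LinearMap.mul' k k ∘ₗ TensorProduct.map D.zestedAssoc Coalgebra.counit)
          (D.zestedAssoc ∘ₗ LinearMap.rTensor H
            (D.zestedMul.lTensor H ∘ₗ (TensorProduct.assoc k H H H).toLinearMap)))
        (LinearMap.mul' k k ∘ₗ TensorProduct.map Coalgebra.counit D.zestedAssoc ∘ₗ
          (TensorProduct.assoc k H (H ⊗[k] H) H).toLinearMap ∘ₗ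
          (TensorProduct.assoc k H H H).toLinearMap.rTensor H) := by
  refine D.ext_homogeneous₄ fun g₁ g₂ g₃ g₄ t ht => ?_
  have hs := D.isSubcoalgebra_homogeneous₄ g₁ g₂ g₃ g₄
  -- A copy of the counit linked to it only by `hε`; `hl` and `hr` cancel it in convolutions.
  obtain ⟨ε, hε⟩ : ∃ ε : H →ₗ[k] k, ε = Coalgebra.counit := ⟨_, rfl⟩
  have hr : ∀ w : H →ₗ[k] k, convRight w ε = w := fun w => by rw [hε, convRight_counit]
  have hl : ∀ w : H →ₗ[k] k, convRight ε w = w := fun w => by rw [hε, convRight_counit_left]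
  have h₁ : ∀ x ∈ D.homogeneous₄ g₁ g₂ g₃ g₄,
      (D.zestedAssoc ∘ₗ (D.zestedMul.rTensor H).rTensor H) x =
        (((D.ω (g₁ * g₂) g₃ g₄ : kˣ) : k) •
          outer (outer (outer ε ε) ε) (D.form (D.lam (g₁ * g₂) g₃))) x :=
    D.eqOn_homogeneous₄ fun h hh l hl t ht s hs => by
      simp only [LinearMap.comp_apply, LinearMap.rTensor_tmul]
      rw [zestedAssoc_tmul (zestedMul_mem hh hl) ht hs, zestedMul_tmul hh hl]
      simp [hε]
  have h₂ : ∀ x ∈ D.homogeneous₄ g₁ g₂ g₃ g₄,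
      (D.zestedAssoc ∘ₗ D.zestedMul.lTensor (H ⊗[k] H) ∘ₗ
          (TensorProduct.assoc k (H ⊗[k] H) H H).toLinearMap) x =
        (((D.ω g₁ g₂ (g₃ * g₄) : kˣ) * D.form (D.lam g₁ g₂) (D.elt (D.lam g₃ g₄)) : k) •
          outer (outer (outer ε ε) (D.form (D.lam g₁ g₂))) (D.form (D.lam g₁ g₂))) x :=
    D.eqOn_homogeneous₄ fun h hh l hl t ht s hs => by
      simp only [LinearMap.comp_apply, LinearMap.lTensor_tmul, LinearEquiv.coe_coe,
        TensorProduct.assoc_tmul]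
      rw [zestedAssoc_tmul hh hl (zestedMul_mem ht hs), zestedMul_tmul ht hs]
      simp [hε]
      ring
  have h₃ : ∀ x ∈ D.homogeneous₄ g₁ g₂ g₃ g₄,
      (LinearMap.mul' k k ∘ₗ TensorProduct.map D.zestedAssoc Coalgebra.counit) x =
        (((D.ω g₁ g₂ g₃ : kˣ) : k) • outer (outer (outer ε ε) (D.form (D.lam g₁ g₂))) ε) x :=
    D.eqOn_homogeneous₄ fun h hh l hl t ht s hs => by
      simp only [LinearMap.comp_apply, TensorProduct.map_tmul]
      rw [zestedAssoc_tmul hh hl ht]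
      simp [hε]
      ring
  have h₄ : ∀ x ∈ D.homogeneous₄ g₁ g₂ g₃ g₄,
      (D.zestedAssoc ∘ₗ LinearMap.rTensor H
            (D.zestedMul.lTensor H ∘ₗ (TensorProduct.assoc k H H H).toLinearMap)) x =
        (((D.ω g₁ (g₂ * g₃) g₄ : kˣ) : k) •
          outer (outer (outer ε ε) ε) (D.form (D.lam g₁ (g₂ * g₃)))) x :=
    D.eqOn_homogeneous₄ fun h hh l hl t ht s hs => by
      simp only [LinearMap.comp_apply, LinearMap.rTensor_tmul, LinearMap.lTensor_tmul,
        LinearEquiv.coe_coe, TensorProduct.assoc_tmul]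
      rw [zestedAssoc_tmul hh (zestedMul_mem hl ht) hs, zestedMul_tmul hl ht]
      simp [hε, mul_assoc]
  have h₅ : ∀ x ∈ D.homogeneous₄ g₁ g₂ g₃ g₄,
      (LinearMap.mul' k k ∘ₗ TensorProduct.map Coalgebra.counit D.zestedAssoc ∘ₗ
          (TensorProduct.assoc k H (H ⊗[k] H) H).toLinearMap ∘ₗ
          (TensorProduct.assoc k H H H).toLinearMap.rTensor H) x =
        (((D.ω g₂ g₃ g₄ : kˣ) : k) • outer (outer (outer ε ε) ε) (D.form (D.lam g₂ g₃))) x :=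
    D.eqOn_homogeneous₄ fun h hh l hl t ht s hs => by
      simp only [LinearMap.comp_apply, LinearMap.rTensor_tmul, LinearEquiv.coe_coe,
        TensorProduct.assoc_tmul, TensorProduct.map_tmul, LinearMap.mul'_apply]
      rw [zestedAssoc_tmul hl ht hs]
      simp [hε]
      ring
  rw [hs.convRight_congr h₁ h₂ t ht, hs.convRight_congr (hs.convRight_congr h₃ h₄) h₅ t ht]
  simp only [convRight_smul_left, convRight_smul_right, convRight_outer, hl, hr, ← form_mul,
    smul_smul]
  -- The products of characters in the fourth slot; their order requires commutativity of `Γ₀`.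
  have hlam : D.lam (g₁ * g₂) g₃ * D.lam g₁ g₂ = D.lam g₁ (g₂ * g₃) * D.lam g₂ g₃ := by
    rw [mul_comm_Γ₀, D.lam_cocycle.cocycle, mul_comm_Γ₀]
  rw [hlam]
  congr 2
  -- Only the scalars remain: this is `(*)` with denominators cleared.
  rw [form_lam_apply_lam, ← Units.val_mul, ← Units.val_mul, ← Units.val_mul, ← Units.val_mul]
  congr 1
  rw [coboundary₃, mul_right_comm, mul_comm (D.ω g₁ g₂ (g₃ * g₄)), mul_div_cancel]
  simp only [mul_comm]

/-! ### The antipode of `H^λ`. -/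

/-- Pulling a product of functionals back along the iterated comultiplication is convolution, so
antipode axioms that factor on a block become identities in the dual algebra. -/
theorem outer_outer_comp_comul (v w x : H →ₗ[k] k) :
    outer (outer v w) x ∘ₗ LinearMap.rTensor H Coalgebra.comul ∘ₗ Coalgebra.comul =
      convRight (convRight v w) x := by
  have h₁ : ∀ t : H ⊗[k] H, outer v w t = TensorProduct.rid k k (TensorProduct.map v w t) :=
    fun t => by
      induction t with
      | zero => simp
      | add x y hx hy => simp only [map_add, hx, hy]
      | tmul x y => simp [mul_comm]
  have h₂ : ∀ t : H ⊗[k] H, outer (outer v w) x (LinearMap.rTensor H Coalgebra.comul t) =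
      TensorProduct.rid k k (TensorProduct.map (convRight v w) x t) := fun t => by
    induction t with
    | zero => simp
    | add x y hx hy => simp only [map_add, hx, hy]
    | tmul y z =>
      simp only [LinearMap.rTensor_tmul, outer_tmul, TensorProduct.map_tmul,
        TensorProduct.rid_tmul, smul_eq_mul, h₁, mul_comm (x z)]
      rfl
  ext h
  exact h₂ _

variable (D) in
/-- The antipode of `H^λ`. -/
noncomputable def zestedAntipode : H →ₗ[k] H :=
  D.assemble fun g => LinearMap.mulRight k (D.elt (D.lam g g⁻¹)⁻¹) ∘ₗ HopfAlgebra.antipode k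

variable (D) in
/-- The functional `α` of `H^λ`. -/
noncomputable def zestedAlpha : H →ₗ[k] k :=
  D.assemble fun g => ((D.ω g g⁻¹ g : kˣ) : k) • D.form (D.lam g g⁻¹)

/-- The factor `λ(g, g⁻¹)⁻¹` cancels the group-like that the twisted product inserts between degrees
`g` and `g⁻¹`. -/
theorem zestedAntipode_of_mem {g : G} {h : H} (hh : h ∈ D.homogeneous g) :
    D.zestedAntipode h = HopfAlgebra.antipode k h * D.elt (D.lam g g⁻¹)⁻¹ := by
  rw [zestedAntipode, D.assemble_of_mem _ hh]
  rfl

theorem zestedAntipode_mem {g : G} {h : H} (hh : h ∈ D.homogeneous g) :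
    D.zestedAntipode h ∈ D.homogeneous g⁻¹ := by
  rw [zestedAntipode_of_mem hh]
  exact mul_elt_mem (D.antipode_mem_homogeneous hh) _

theorem zestedAlpha_of_mem {g : G} {h : H} (hh : h ∈ D.homogeneous g) :
    D.zestedAlpha h = (((D.ω g g⁻¹ g : kˣ) : k) • D.form (D.lam g g⁻¹)) h := by
  rw [zestedAlpha, D.assemble_of_mem _ hh]

theorem convLeft_zestedAlpha_of_mem {g : G} {h : H} (hh : h ∈ D.homogeneous g) :
    convLeft D.zestedAlpha LinearMap.id h =
      ((D.ω g g⁻¹ g : kˣ) : k) • convLeft (D.form (D.lam g g⁻¹)) LinearMap.id h := by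
  rw [(D.isSubcoalgebra_homogeneous g).convLeft_congr (fun _ _ => rfl)
    (fun c hc => zestedAlpha_of_mem hc) h hh, convLeft_smul_left, LinearMap.smul_apply]

theorem convLeft_zestedAlpha_mem {g : G} {h : H} (hh : h ∈ D.homogeneous g) :
    convLeft D.zestedAlpha LinearMap.id h ∈ D.homogeneous g :=
  (D.isSubcoalgebra_homogeneous g).convLeft_mem _ h hh

theorem counit_convLeft_id (w : H →ₗ[k] k) (h : H) :
    Coalgebra.counit (R := k) (convLeft w LinearMap.id h) = w h := by
  rw [← LinearMap.comp_apply, comp_convLeft, LinearMap.comp_id, convLeft_eq_convRight,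
    convRight_counit]

theorem elt_inv_mul_convLeft_mul (u : D.Γ₀) (h : H) :
    D.elt u⁻¹ * convLeft (D.form u) LinearMap.id h * D.elt u =
      convRight LinearMap.id (D.form u) h := by
  rw [mul_assoc, convLeft_form_mul_elt, ← mul_assoc, elt_inv_mul, one_mul]

/-- With `u = λ(g, g⁻¹)`, the inserted elements conjugate the second factor by `u`, and centrality
turns the left convolution with `γ(u)` inside `α` into a right one. The scalar `ω(g, g⁻¹, g)` plays
no role here; it is forced by the normalization involving `Ω⁻¹`. -/
theorem zestedAntipode_left (h : H) :
    D.zestedMul (TensorProduct.map D.zestedAntipode (convLeft D.zestedAlpha LinearMap.id)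
      (Coalgebra.comul h)) = D.zestedAlpha h • (1 : H) := by
  refine D.homogeneous_induction h (by simp) (fun x y hx hy => by simp [hx, hy, add_smul])
    fun g h hh => ?_
  let u := D.lam g g⁻¹
  let c : k := (D.ω g g⁻¹ g : kˣ)
  have h₁ := D.eqOn_homogeneous₂ (g₁ := g) (g₂ := g)
    (f := D.zestedMul ∘ₗ TensorProduct.map D.zestedAntipode (convLeft D.zestedAlpha LinearMap.id))
    (f' := c • LinearMap.mul' k H ∘ₗ LinearMap.rTensor H (HopfAlgebra.antipode k) ∘ₗ
      LinearMap.lTensor H (convRight LinearMap.id (D.form u)))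
    (fun a ha b hb => by
      simp only [LinearMap.comp_apply, TensorProduct.map_tmul, LinearMap.smul_apply,
        LinearMap.lTensor_tmul, LinearMap.rTensor_tmul, LinearMap.mul'_apply]
      rw [zestedMul_tmul (zestedAntipode_mem ha) (convLeft_zestedAlpha_mem hb), lam_inv_comm,
        zestedAntipode_of_mem ha, convLeft_zestedAlpha_of_mem hb, mul_smul_comm, smul_mul_assoc,
        ← elt_inv_mul_convLeft_mul u b]
      simp only [mul_assoc, u, c])
    _ (D.isSubcoalgebra_homogeneous g h hh)
  -- Right translation by `γ(u)` acts on the last leg only, so the ordinary antipode axiom applies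
  -- to the translated element.
  have h₂ := LinearMap.congr_fun (comul_comp_convRight_id (D.form u)) h
  simp only [LinearMap.comp_apply, LinearMap.smul_apply] at h₁ h₂
  rw [← h₂, HopfAlgebra.mul_antipode_rTensor_comul_apply] at h₁
  rw [h₁, zestedAlpha_of_mem hh, ← LinearMap.comp_apply (f := Coalgebra.counit), comp_convRight,
    LinearMap.comp_id, convRight_counit_left, Algebra.algebraMap_eq_smul_one, smul_smul]
  rfl

theorem zestedAntipode_right (h : H) :
    D.zestedMul (TensorProduct.map (convRight LinearMap.id Coalgebra.counit) D.zestedAntipode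
      (Coalgebra.comul h)) = Coalgebra.counit (R := k) h • (1 : H) := by
  refine D.homogeneous_induction h (by simp) (fun x y hx hy => by simp [hx, hy, add_smul])
    fun g h hh => ?_
  have h₁ := D.eqOn_homogeneous₂ (g₁ := g) (g₂ := g)
    (f := D.zestedMul ∘ₗ TensorProduct.map (convRight LinearMap.id Coalgebra.counit)
      D.zestedAntipode)
    (f' := LinearMap.mul' k H ∘ₗ LinearMap.lTensor H (HopfAlgebra.antipode k))
    (fun a ha b hb => by
      simp only [LinearMap.comp_apply, TensorProduct.map_tmul, convRight_counit,
        LinearMap.lTensor_tmul, LinearMap.mul'_apply, LinearMap.id_apply]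
      rw [zestedMul_tmul ha (zestedAntipode_mem hb), zestedAntipode_of_mem hb]
      simp only [mul_assoc, elt_inv_mul, mul_one])
    _ (D.isSubcoalgebra_homogeneous g h hh)
  simp only [LinearMap.comp_apply] at h₁
  rw [h₁, HopfAlgebra.mul_antipode_lTensor_comul_apply, Algebra.algebraMap_eq_smul_one]

theorem rTensor_comul_comul_mem {g : G} {h : H} (hh : h ∈ D.homogeneous g) :
    LinearMap.rTensor H Coalgebra.comul (Coalgebra.comul (R := k) h) ∈
      D.homogeneous₃ g g g := by
  refine tensorSubmodule_induction (D.isSubcoalgebra_homogeneous g h hh) (by simp)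
    (fun x y hx hy => by simpa using add_mem hx hy) fun a ha b hb => ?_
  exact tmul_mem_tensorSubmodule (D.isSubcoalgebra_homogeneous g a ha) hb

/-- The scalar in `α` cancels `ω(g, g⁻¹, g)⁻¹`, and in the third slot `γ(u)⁻¹` convolved with `γ(u)`
is the counit. -/
theorem zestedAssocInv_antipode :
    D.zestedAssocInv ∘ₗ TensorProduct.map
        (TensorProduct.map (convRight LinearMap.id Coalgebra.counit) D.zestedAntipode)
        (convLeft D.zestedAlpha LinearMap.id) ∘ₗ
      LinearMap.rTensor H Coalgebra.comul ∘ₗ Coalgebra.comul = Coalgebra.counit := by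
  refine D.ext_homogeneous fun g h hh => ?_
  have h₁ := D.eqOn_homogeneous₃ (g₁ := g) (g₂ := g) (g₃ := g)
    (f := D.zestedAssocInv ∘ₗ TensorProduct.map
        (TensorProduct.map (convRight LinearMap.id Coalgebra.counit) D.zestedAntipode)
        (convLeft D.zestedAlpha LinearMap.id))
    (f' := outer (outer Coalgebra.counit Coalgebra.counit) Coalgebra.counit)
    (fun a ha b hb c hc => by
      simp only [LinearMap.comp_apply, TensorProduct.map_tmul, convRight_counit, outer_tmul,
        LinearMap.id_apply]
      rw [zestedAssocInv_tmul ha (zestedAntipode_mem hb) (convLeft_zestedAlpha_mem hc),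
        zestedAntipode_of_mem hb, convLeft_zestedAlpha_of_mem hc, map_smul,
        ← LinearMap.comp_apply (f := D.form _), comp_convLeft, LinearMap.comp_id,
        convLeft_eq_convRight, ← form_mul, mul_inv_cancel, form_one]
      simp [mul_left_comm])
    _ (rTensor_comul_comul_mem hh)
  refine Eq.trans h₁ ?_
  have h₂ := LinearMap.congr_fun (outer_outer_comp_comul Coalgebra.counit Coalgebra.counit
    (Coalgebra.counit (R := k) (A := H))) h
  rw [convRight_counit, convRight_counit] at h₂
  exact h₂

/-- Characters are inverted under convolution by composing with the antipode. -/
theorem convRight_form_comp_antipode (u : D.Γ₀) :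
    convRight (D.form u) (D.form u ∘ₗ HopfAlgebra.antipode k) = Coalgebra.counit := by
  ext h
  have h₁ : ∀ t : H ⊗[k] H, TensorProduct.rid k k (TensorProduct.map (D.form u)
      (D.form u ∘ₗ HopfAlgebra.antipode k) t) =
      D.form u (LinearMap.mul' k H (LinearMap.lTensor H (HopfAlgebra.antipode k) t)) := fun t => by
    induction t with
    | zero => simp
    | add x y hx hy => simp only [map_add, hx, hy]
    | tmul x y => simp [mul_comm]
  refine Eq.trans (h₁ _) ?_
  rw [HopfAlgebra.mul_antipode_lTensor_comul_apply, Algebra.algebraMap_eq_smul_one, map_smul,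
    form_apply_one, smul_eq_mul, mul_one]

/-- This is `(*)` at `(g, g⁻¹, g, g⁻¹)`: three of the five values of `ω` have an argument equal to
`1`. The value of `γ(u)` at `u⁻¹` inverts the left side. -/
theorem ω_mul_ω_inv (g : G) : ((D.ω g⁻¹ g g⁻¹ : kˣ) : k) * (D.ω g g⁻¹ g : kˣ) *
    D.form (D.lam g g⁻¹) (D.elt (D.lam g g⁻¹)⁻¹) = 1 := by
  have h := form_lam_apply_lam (D := D) g g⁻¹ g g⁻¹
  simp only [coboundary₃, mul_inv_cancel, inv_mul_cancel, D.ω_normalized.one_left,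
    D.ω_normalized.one_middle, D.ω_normalized.one_right, mul_one, div_one] at h
  rw [form_apply_inv, h, ← Units.val_mul, mul_comm (D.ω g⁻¹ g g⁻¹), ← Units.val_inv_eq_inv_val,
    Units.mul_inv]

/-- The last argument `S(c) u⁻¹` contributes `γ(u)(u⁻¹)`, which `ω_mul_ω_inv` absorbs together with
both values of `ω`. What remains is `γ(u)` convolved with `γ(u) ∘ S`. -/
theorem zestedAssoc_antipode :
    D.zestedAssoc ∘ₗ TensorProduct.map
        (TensorProduct.map D.zestedAntipode
          (convRight (convLeft D.zestedAlpha LinearMap.id) Coalgebra.counit)) D.zestedAntipode ∘ₗ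
      LinearMap.rTensor H Coalgebra.comul ∘ₗ Coalgebra.comul = Coalgebra.counit := by
  refine D.ext_homogeneous fun g h hh => ?_
  let u := D.lam g g⁻¹
  have h₁ := D.eqOn_homogeneous₃ (g₁ := g) (g₂ := g) (g₃ := g)
    (f := D.zestedAssoc ∘ₗ TensorProduct.map (TensorProduct.map D.zestedAntipode
          (convRight (convLeft D.zestedAlpha LinearMap.id) Coalgebra.counit)) D.zestedAntipode)
    (f' := outer (outer Coalgebra.counit (D.form u)) (D.form u ∘ₗ HopfAlgebra.antipode k))
    (fun a ha b hb c hc => by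
      simp only [LinearMap.comp_apply, TensorProduct.map_tmul, convRight_counit, outer_tmul]
      rw [zestedAssoc_tmul (zestedAntipode_mem ha) (convLeft_zestedAlpha_mem hb)
        (zestedAntipode_mem hc), zestedAntipode_of_mem ha, zestedAntipode_of_mem hc,
        counit_convLeft_id, zestedAlpha_of_mem hb, lam_inv_comm, form_apply_mul,
        Bialgebra.counit_mul, counit_elt, HopfAlgebra.counit_antipode, LinearMap.smul_apply,
        smul_eq_mul, mul_one]
      linear_combination (Coalgebra.counit (R := k) a * D.form u b *
        D.form u (HopfAlgebra.antipode k c)) * ω_mul_ω_inv (D := D) g)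
    _ (rTensor_comul_comul_mem hh)
  refine Eq.trans h₁ ?_
  have h₂ := LinearMap.congr_fun (outer_outer_comp_comul Coalgebra.counit (D.form u)
    (D.form u ∘ₗ HopfAlgebra.antipode k)) h
  rw [convRight_counit_left, convRight_form_comp_antipode] at h₂
  exact h₂

variable (D) in
/-- The coquasi-Hopf algebra `H^λ`. -/
noncomputable def zested : CoquasiHopfAlgebra k H where
  mul := ⟨D.zestedMul, counit_comp_zestedMul, map_zestedMul_comul⟩
  unit := ⟨Algebra.linearMap k H, by ext; simp, by ext; simp [Algebra.TensorProduct.one_def]⟩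
  assoc := D.zestedAssoc
  assocInv := D.zestedAssocInv
  assoc_conv_assocInv := zestedAssoc_conv_zestedAssocInv
  assocInv_conv_assoc := zestedAssocInv_conv_zestedAssoc
  one_mul h := by
    refine D.homogeneous_induction h (by simp) (fun x y hx hy => by
      rw [TensorProduct.tmul_add, map_add, hx, hy]) fun g h hh => ?_
    have := zestedMul_tmul D.one_mem_homogeneous hh
    rw [D.lam_cocycle.one_left, elt_one, one_mul, mul_one] at this
    simpa using! this
  mul_one h := by
    refine D.homogeneous_induction h (by simp) (fun x y hx hy => by
      rw [TensorProduct.add_tmul, map_add, hx, hy]) fun g h hh => ?_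
    have := zestedMul_tmul hh D.one_mem_homogeneous
    rw [D.lam_cocycle.one_right, elt_one, mul_one, mul_one] at this
    simpa using! this
  mul_assoc := zestedMul_assoc
  pentagon := zested_pentagon
  assoc_one h l := by
    refine D.homogeneous_induction h (by simp) (fun x y hx hy => by
      rw [TensorProduct.add_tmul, TensorProduct.add_tmul, map_add, hx, hy, map_add, add_mul])
      fun g h hh => ?_
    refine D.homogeneous_induction l (by simp) (fun x y hx hy => by
      rw [TensorProduct.tmul_add, map_add, hx, hy, map_add, mul_add]) fun g' l hl => ?_
    have := zestedAssoc_tmul hh D.one_mem_homogeneous hl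
    rw [D.lam_cocycle.one_right, form_one, D.ω_normalized.one_middle] at this
    simpa using! this
  antipode := D.zestedAntipode
  α := D.zestedAlpha
  β := Coalgebra.counit
  antipode_left h := by simpa using! zestedAntipode_left h
  antipode_right h := by simpa using! zestedAntipode_right h
  assocInv_antipode := zestedAssocInv_antipode
  assoc_antipode := zestedAssoc_antipode

theorem isZested_zested : D.IsZested D.zested.toCoquasiBialgebra where
  unit := map_one (algebraMap k H)
  mul _ _ _ hh _ hl := zestedMul_tmul hh hl
  assoc g₁ g₂ g₃ h hh l hl t ht := by
    refine (zestedAssoc_tmul hh hl ht).trans ?_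
    rw [Bialgebra.counit_mul, ← mul_assoc, mul_comm ((D.ω g₁ g₂ g₃ : kˣ) : k)]
    rfl

end AssocZestingDatum

/-! ### The relative `r`-form. -/

namespace AssocZestingDatum

variable {k H G : Type*} [Field k] [Ring H] [HopfAlgebra k H] [Group G]
  (D : AssocZestingDatum k H G)

/-- The bilinear map `r(h, g) = ⟨γ(g⁻¹), h⟩`. -/
noncomputable def rForm : H →ₗ[k] MonoidAlgebra k D.Γ₀ →ₗ[k] k :=
  (Finsupp.lsum k (fun g : D.Γ₀ => LinearMap.toSpanSingleton k (H →ₗ[k] k) (D.form g⁻¹)) ∘ₗ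
    (MonoidAlgebra.coeffLinearEquiv k).toLinearMap).flip

variable {D}

@[simp]
theorem rForm_single (h : H) (g : D.Γ₀) (a : k) :
    D.rForm h (MonoidAlgebra.single g a) = a * D.form g⁻¹ h := by
  simp [rForm]

theorem rForm_flip_single (g : D.Γ₀) :
    D.rForm.flip (MonoidAlgebra.single g 1) = D.form g⁻¹ := by
  ext h
  simp

theorem inclusion_single (g : D.Γ₀) (a : k) :
    D.inclusion (MonoidAlgebra.single g a) = a • D.elt g := by
  simp [inclusion, elt, Algebra.smul_def]

/-- Distinct group-like elements are linearly independent. -/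
theorem inclusion_injective : Function.Injective D.inclusion := by
  have h₁ : LinearIndependent k D.elt :=
    (linearIndep_groupLikeVal (R := k) (A := H)).comp _ Subtype.val_injective
  have h₂ : ∀ x, D.inclusion x = Finsupp.linearCombination k D.elt x.coeff := fun x => by
    induction x using MonoidAlgebra.induction_linear with
    | zero => simp
    | add x y hx hy => simp only [map_add, hx, hy, MonoidAlgebra.coeff_add]
    | single g a => simp [inclusion_single]
  intro x y hxy
  rw [h₂, h₂] at hxy
  exact MonoidAlgebra.coeff_injective (h₁ hxy)

/-- Since `k[Γ₀]` is spanned by group-likes, each axiom is tested on some `g ∈ Γ₀`. The inverse in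
`γ(g⁻¹)` is needed because the commutation rule has the opposite handedness to centrality; the order
reversal of `(g g')⁻¹` is harmless as `Γ₀` is abelian. -/
theorem isRelativeRForm_rForm : IsRelativeRForm D.inclusion D.rForm where
  injective := inclusion_injective
  mul_left h h' := by
    refine MonoidAlgebra.lhom_ext' fun g => LinearMap.ext_ring ?_
    simp [convRight]
  mul_right x x' := by
    induction x using MonoidAlgebra.induction_linear with
    | zero => simp [convRight]
    | add x y hx hy =>
      rw [add_mul, map_add, hx, hy, map_add]
      simp only [convRight, TensorProduct.map_add_left, LinearMap.add_comp, LinearMap.comp_add]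
    | single g a =>
      induction x' using MonoidAlgebra.induction_linear with
      | zero => simp [convRight]
      | add x y hx hy =>
        rw [mul_add, map_add, hx, hy, map_add]
        simp only [convRight, TensorProduct.map_add_right, LinearMap.add_comp, LinearMap.comp_add]
      | single g' a' =>
        have e : ∀ (g : D.Γ₀) (a : k), (MonoidAlgebra.single g a : MonoidAlgebra k D.Γ₀) =
            a • MonoidAlgebra.single g 1 := fun g a => by simp
        rw [e g a, e g' a', smul_mul_smul_comm, map_smul, map_smul, map_smul,
          MonoidAlgebra.single_mul_single, mul_one, rForm_flip_single, rForm_flip_single,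
          rForm_flip_single, convRight_smul_left, convRight_smul_right, mul_inv_rev, mul_comm_Γ₀,
          form_mul, smul_smul]
  one_right h := by
    rw [MonoidAlgebra.one_def, rForm_single, inv_one, form_one, one_mul]
  one_left x := by
    induction x using MonoidAlgebra.induction_linear with
    | zero => simp
    | add x y hx hy => simp only [map_add, hx, hy]
    | single g a => simp
  comm := by
    refine TensorProduct.ext (LinearMap.ext fun h => MonoidAlgebra.lhom_ext' fun g =>
      LinearMap.ext_ring ?_)
    -- Centrality for `g⁻¹`, multiplied by `g` on both sides.
    have h₁ : D.elt g * convLeft (D.form g⁻¹) LinearMap.id h =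
        convRight LinearMap.id (D.form g⁻¹) h * D.elt g := by
      have := congrArg (fun x => D.elt g * x * D.elt g) (convLeft_form_mul_elt g⁻¹ h)
      simp only [mul_assoc, elt_inv_mul, mul_one] at this
      simpa only [← mul_assoc, elt_mul_inv, one_mul] using this
    have h₂ : ∀ t : H ⊗[k] H, TensorProduct.lid k H (TensorProduct.map (TensorProduct.lift D.rForm)
        (LinearMap.mul' k H ∘ₗ (TensorProduct.comm k H H).toLinearMap ∘ₗ
          LinearMap.lTensor H (D.inclusion : MonoidAlgebra k D.Γ₀ →ₐ[k] H).toLinearMap)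
        (TensorProduct.AlgebraTensorModule.tensorTensorTensorComm k k k k H H
          (MonoidAlgebra k D.Γ₀) (MonoidAlgebra k D.Γ₀)
          (t ⊗ₜ (MonoidAlgebra.single g 1 ⊗ₜ MonoidAlgebra.single g 1)))) =
        D.elt g * TensorProduct.lid k H (TensorProduct.map (D.form g⁻¹) LinearMap.id t) :=
      fun t => by
        induction t with
        | zero => simp
        | add x y hx hy => simp only [map_add, TensorProduct.add_tmul, mul_add, hx, hy]
        | tmul x y => simp [inclusion_single]
    have h₃ : ∀ t : H ⊗[k] H, TensorProduct.rid k H (TensorProduct.map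
        (LinearMap.mul' k H ∘ₗ
          LinearMap.lTensor H (D.inclusion : MonoidAlgebra k D.Γ₀ →ₐ[k] H).toLinearMap)
        (TensorProduct.lift D.rForm)
        (TensorProduct.AlgebraTensorModule.tensorTensorTensorComm k k k k H H
          (MonoidAlgebra k D.Γ₀) (MonoidAlgebra k D.Γ₀)
          (t ⊗ₜ (MonoidAlgebra.single g 1 ⊗ₜ MonoidAlgebra.single g 1)))) =
        TensorProduct.rid k H (TensorProduct.map LinearMap.id (D.form g⁻¹) t) * D.elt g :=
      fun t => by
        induction t with
        | zero => simp
        | add x y hx hy => simp only [map_add, TensorProduct.add_tmul, add_mul, hx, hy]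
        | tmul x y => simp [inclusion_single]
    have h₄ : Coalgebra.comul (R := k) (MonoidAlgebra.single g (1 : k)) =
        MonoidAlgebra.single g 1 ⊗ₜ MonoidAlgebra.single g 1 := by simp
    have h₅ := h₂ (Coalgebra.comul h)
    have h₆ := h₃ (Coalgebra.comul h)
    rw [← h₄, ← TensorProduct.comul_tmul] at h₅ h₆
    exact h₅.trans (h₁.trans h₆.symm)

end AssocZestingDatum

/-! ### Generators of the bosonization. -/

namespace PreNicholsAlgebra

open YetterDrinfeld SkewMonoidAlgebra Bosonization

attribute [local instance] PreNicholsAlgebra.gradedAlgebra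

variable {k Γ V B : Type*} [Field k] [Group Γ]
  [AddCommGroup V] [Module k V] [DistribMulAction Γ V] [SMulCommClass Γ k V]
  [YetterDrinfeld k Γ V] [Ring B] [Algebra k B] [MulSemiringAction Γ B] [SMulCommClass Γ k B]
  [YetterDrinfeld k Γ B] [Coalgebra k B] [BraidedHopfAlgebra k Γ B]

section Generators

variable (P : PreNicholsAlgebra k Γ V B)

theorem isHomogeneous_incl {g : Γ} {v : V} (hv : IsHomogeneous k g v) :
    IsHomogeneous k g (P.incl v) := by
  rw [IsHomogeneous, P.incl_coact, hv]
  simp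

theorem incl_mem_grading (v : V) : P.incl v ∈ P.grading 1 :=
  P.grading_one ▸ LinearMap.mem_range_self _ v

theorem counit_incl (v : V) : Coalgebra.counit (R := k) (P.incl v) = 0 :=
  P.counit_eq_zero 1 one_ne_zero _ (P.incl_mem_grading v)

/-- The element `v # 1` of the bosonization. -/
noncomputable def gen (v : V) : SkewMonoidAlgebra B Γ := single 1 (P.incl v)

theorem gen_zero : P.gen 0 = 0 := by
  simp [gen]

/-- A braided primitive becomes skew-primitive, because the coaction puts `h` into the left leg. All
later computations with `V` rest on this formula. -/
theorem comul_gen {g : Γ} {v : V} (hv : IsHomogeneous k g v) :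
    Coalgebra.comul (R := k) (P.gen v) = P.gen v ⊗ₜ 1 + single g 1 ⊗ₜ P.gen v := by
  refine (comulHom_base (P.incl v)).trans ?_
  rw [P.comul_incl, map_add, spread_tmul BraidedHopfAlgebra.coact_one,
    spread_tmul (P.isHomogeneous_incl hv)]
  rfl

@[simp]
theorem counit_gen (v : V) : Coalgebra.counit (R := k) (P.gen v) = 0 :=
  (counit_single _ _).trans (P.counit_incl v)

theorem single_mul_gen (g : Γ) (v : V) :
    (single g 1 : SkewMonoidAlgebra B Γ) * P.gen v = P.gen (g • v) * single g 1 := by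
  simp [gen, single_mul_single, P.incl_smul]

variable (k Γ B) in
/-- The inclusion of `B` into the bosonization. -/
noncomputable def baseHom : B →ₐ[k] SkewMonoidAlgebra B Γ :=
  AlgHom.ofLinearMap (lsingle k 1) rfl fun a b => by simp [lsingle_apply, single_mul_single]

theorem base_algHom_ext (P : PreNicholsAlgebra k Γ V B) {A : Type*}
    [Semiring A] [Algebra k A] {φ ψ : B →ₐ[k] A}
    (h : ∀ (g : Γ) (v : V), IsHomogeneous k g v → φ (P.incl v) = ψ (P.incl v)) : φ = ψ := by
  refine AlgHom.ext_of_adjoin_eq_top P.generates ?_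
  rintro _ ⟨v, rfl⟩
  exact induction_homogeneous (k := k) (Γ := Γ) v (by simp)
    (fun x y hx hy => by simp only [map_add, hx, hy]) h

theorem algHom_ext {A : Type*} [Semiring A] [Algebra k A]
    {φ ψ : SkewMonoidAlgebra B Γ →ₐ[k] A}
    (h₁ : ∀ (g : Γ) (v : V), IsHomogeneous k g v → φ (P.gen v) = ψ (P.gen v))
    (h₂ : ∀ g, φ (single g 1) = ψ (single g 1)) : φ = ψ :=
  Bosonization.algHom_ext (fun a => AlgHom.congr_fun
    (P.base_algHom_ext (φ := φ.comp (baseHom k Γ B)) (ψ := ψ.comp (baseHom k Γ B)) h₁) a) h₂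

/-- A subalgebra containing the generators is everything. -/
theorem mem_of_generators (S : Subalgebra k (SkewMonoidAlgebra B Γ))
    (h₁ : ∀ (g : Γ) (v : V), IsHomogeneous k g v → P.gen v ∈ S)
    (h₂ : ∀ g, single g 1 ∈ S) (x : SkewMonoidAlgebra B Γ) : x ∈ S := by
  have hB : ∀ b : B, single 1 b ∈ S := by
    have : Algebra.adjoin k (Set.range P.incl) ≤ S.comap (baseHom k Γ B) := by
      refine Algebra.adjoin_le ?_
      rintro _ ⟨v, rfl⟩
      refine induction_homogeneous (k := k) (Γ := Γ) v (by simp)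
        (fun x y hx hy => by simpa using add_mem hx hy) h₁
    rw [P.generates] at this
    exact fun b => this Algebra.mem_top
  induction x using SkewMonoidAlgebra.induction_on with
  | zero => exact S.zero_mem
  | single g b =>
    rw [Bosonization.single_eq]
    exact S.mul_mem (hB b) (h₂ g)
  | add x y hx hy => exact S.add_mem hx hy

end Generators

/-! ### Group-like elements of the bosonization. -/

section GroupLike

variable (P : PreNicholsAlgebra k Γ V B)

variable (k Γ B) in
/-- The coefficients of an element of the bosonization, as a linear map. -/
noncomputable def coeffLinear : SkewMonoidAlgebra B Γ →ₗ[k] (Γ →₀ B) where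
  toFun := SkewMonoidAlgebra.coeff
  map_add' := coeff_add
  map_smul' := coeff_smul

/-- The projection onto the component of degree `n` of the bosonization. -/
noncomputable def proj (n : ℕ) : SkewMonoidAlgebra B Γ →ₗ[k] SkewMonoidAlgebra B Γ :=
  (Finsupp.lsum k fun g => lsingle k g ∘ₗ GradedAlgebra.proj P.grading n) ∘ₗ coeffLinear k Γ B

theorem proj_single (n : ℕ) (g : Γ) (b : B) :
    P.proj n (single g b) = single g (GradedAlgebra.proj P.grading n b) := by
  simp [proj, coeffLinear, lsingle_apply]

theorem proj_single_of_mem {m n : ℕ} (g : Γ) {b : B} (hb : b ∈ P.grading m) :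
    P.proj n (single g b) = if m = n then single g b else 0 := by
  rw [proj_single, GradedAlgebra.proj_apply]
  split_ifs with h
  · subst h
    rw [DirectSum.decompose_of_mem_same _ hb]
  · rw [DirectSum.decompose_of_mem_ne _ hb h, single_zero]

theorem proj_gen_one (v : V) : P.proj 1 (P.gen v) = P.gen v :=
  (P.proj_single_of_mem 1 (P.incl_mem_grading v)).trans (if_pos rfl)

theorem one_mem_grading : (1 : B) ∈ P.grading 0 := by
  rw [P.grading_zero]
  exact Submodule.one_le.1 le_rfl

theorem proj_one_single (g : Γ) : P.proj 1 (single g 1) = 0 :=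
  (P.proj_single_of_mem g P.one_mem_grading).trans (if_neg zero_ne_one)

/-- Bosonizing alters only the `Γ`-labels of the legs, so the comultiplication remains graded for
the degree coming from `B`. -/
theorem map_proj_comul_of_mem {n i j : ℕ} (hn : i + j ≠ n) (g : Γ) {b : B}
    (hb : b ∈ P.grading n) :
    TensorProduct.map (P.proj i) (P.proj j) (Coalgebra.comul (R := k) (single g b)) = 0 := by
  have key : ∀ t ∈ ⨆ (i : ℕ) (j : ℕ) (_ : i + j = n),
      LinearMap.range (TensorProduct.map (P.grading i).subtype (P.grading j).subtype),
      TensorProduct.map (P.proj i) (P.proj j)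
        (spread k Γ B t * (single g 1 ⊗ₜ single g 1)) = 0 := by
    let F : B ⊗[k] B →ₗ[k] SkewMonoidAlgebra B Γ ⊗[k] SkewMonoidAlgebra B Γ :=
      TensorProduct.map (P.proj i) (P.proj j) ∘ₗ
        LinearMap.mulRight k (single g 1 ⊗ₜ single g 1) ∘ₗ spread k Γ B
    suffices (⨆ (i : ℕ) (j : ℕ) (_ : i + j = n),
        LinearMap.range (TensorProduct.map (P.grading i).subtype (P.grading j).subtype)) ≤
        LinearMap.ker F from fun t ht => this ht
    refine iSup_le fun i' => iSup_le fun j' => iSup_le fun hij => ?_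
    intro t ht
    refine tensorSubmodule_induction ht (zero_mem _) (fun x y hx hy => add_mem hx hy)
      fun a ha b hb => ?_
    -- `spread` is explicit only for a `Γ`-homogeneous second leg; by `coact_mem` the `Γ`-components
    -- of `b` keep its degree.
    rw [← coact_sum (k := k) (Γ := Γ) b, Finsupp.sum, TensorProduct.tmul_sum]
    refine sum_mem fun h _ => ?_
    have e₁ : F (a ⊗ₜ coact (k := k) b h) =
        P.proj i (single (h * g) a) ⊗ₜ P.proj j (single g (coact (k := k) b h)) := by
      simp [F, spread_tmul (isHomogeneous_coact b h), single_mul_single]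
    rw [LinearMap.mem_ker, e₁, P.proj_single_of_mem _ ha,
      P.proj_single_of_mem _ (P.coact_mem _ _ _ hb)]
    split_ifs with h₁ h₂
    · omega
    · simp
    · simp
    · simp
  rw [comul_single]
  exact key _ (P.comul_mem n b hb)

theorem map_proj_comul (n : ℕ) (x : SkewMonoidAlgebra B Γ) :
    TensorProduct.map (P.proj n) (P.proj n) (Coalgebra.comul (R := k) x) =
      TensorProduct.map (P.proj n) (P.proj n) (Coalgebra.comul (R := k) (P.proj (n + n) x)) := by
  induction x using SkewMonoidAlgebra.induction_on with
  | zero => simp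
  | add x y hx hy => simp only [map_add, hx, hy]
  | single g b =>
    induction b using DirectSum.Decomposition.inductionOn P.grading with
    | zero => simp
    | add x y hx hy => simp only [single_add, map_add, hx, hy]
    | @homogeneous m b =>
      rw [P.proj_single_of_mem g b.2]
      split_ifs with h
      · rfl
      · rw [P.map_proj_comul_of_mem (Ne.symm h) g b.2]
        simp

theorem exists_proj_eq_zero (x : SkewMonoidAlgebra B Γ) : ∃ N, ∀ n > N, P.proj n x = 0 := by
  induction x using SkewMonoidAlgebra.induction_on with
  | zero => exact ⟨0, by simp⟩
  | add x y hx hy =>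
    obtain ⟨N, hN⟩ := hx
    obtain ⟨M, hM⟩ := hy
    exact ⟨max N M, fun n hn => by rw [map_add, hN n (by omega), hM n (by omega), add_zero]⟩
  | single g b =>
    induction b using DirectSum.Decomposition.inductionOn P.grading with
    | zero => exact ⟨0, by simp⟩
    | add x y hx hy =>
      obtain ⟨N, hN⟩ := hx
      obtain ⟨M, hM⟩ := hy
      exact ⟨max N M, fun n hn => by
        rw [single_add, map_add, hN n (by omega), hM n (by omega), add_zero]⟩
    | @homogeneous m b =>
      exact ⟨m, fun n hn => (P.proj_single_of_mem g b.2).trans (if_neg (by omega))⟩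

theorem proj_zero_mem_span (x : SkewMonoidAlgebra B Γ) :
    P.proj 0 x ∈ Submodule.span k (Set.range fun g : Γ => (single g 1 : SkewMonoidAlgebra B Γ)) := by
  induction x using SkewMonoidAlgebra.induction_on with
  | zero => simp
  | add x y hx hy => simpa using add_mem hx hy
  | single g b =>
    have h : GradedAlgebra.proj P.grading 0 b ∈ P.grading 0 := by
      rw [GradedAlgebra.proj_apply]
      exact SetLike.coe_mem _
    rw [P.grading_zero, Submodule.mem_one] at h
    obtain ⟨c, hc⟩ := h
    rw [proj_single, ← hc, Algebra.algebraMap_eq_smul_one, ← smul_single]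
    exact Submodule.smul_mem _ _ (Submodule.subset_span ⟨g, rfl⟩)

theorem eq_proj_zero {x : SkewMonoidAlgebra B Γ} (hx : ∀ n > 0, P.proj n x = 0) :
    P.proj 0 x = x := by
  classical
  have h : ∀ n g, (P.proj n x).coeff g = GradedAlgebra.proj P.grading n (x.coeff g) := by
    intro n g
    clear hx
    induction x using SkewMonoidAlgebra.induction_on with
    | zero => simp
    | add x y hx hy => simp only [map_add, coeff_add, Finsupp.add_apply, hx, hy]
    | single g' b =>
      rw [proj_single, coeff_single_apply, coeff_single_apply]
      split_ifs <;> simp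
  ext g
  rw [h]
  have h₂ : ∀ n, n ≠ 0 → GradedAlgebra.proj P.grading n (x.coeff g) = 0 := fun n hn => by
    rw [← h, hx n (by omega)]
    simp
  simp only [GradedAlgebra.proj_apply] at h₂ ⊢
  have h₃ := DirectSum.sum_support_decompose P.grading (x.coeff g)
  conv_rhs => rw [← h₃]
  by_cases hs : 0 ∈ (DirectSum.decompose P.grading (x.coeff g)).support
  · rw [Finset.sum_eq_single_of_mem 0 hs fun n _ hn => h₂ n hn]
  · rw [Finset.sum_eq_zero fun n hn => h₂ n fun h0 => hs (h0 ▸ hn)]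
    simpa using hs

/-- Every functional `f` satisfies `f(x)² = 0`, and functionals separate points. -/
theorem eq_zero_of_tmul_self_eq_zero {M : Type*} [AddCommGroup M] [Module k M] {x : M}
    (h : x ⊗ₜ[k] x = 0) : x = 0 := by
  refine (Module.forall_dual_apply_eq_zero_iff k x).1 fun f => ?_
  have := congrArg (TensorProduct.lid k k ∘ TensorProduct.map f f) h
  simpa using this

/-- If a group-like `x` had top degree `n > 0`, then `xₙ ⊗ xₙ`, the `(n, n)` part of `Δ x`, would
come from the component of degree `2n`, which vanishes. So `x` has degree `0` and lies in the span
of `Γ`; independence of group-likes puts it in `Γ`. -/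
theorem toGroupLike_surjective (P : PreNicholsAlgebra k Γ V B) :
    Function.Surjective (toGroupLike k Γ B) := by
  intro x
  obtain ⟨N, hN⟩ := P.exists_proj_eq_zero (x : SkewMonoidAlgebra B Γ)
  -- Descent on the bound `N`, removing degree `N + 1` at each step.
  have hpos : ∀ N, (∀ n > N, P.proj n (x : SkewMonoidAlgebra B Γ) = 0) →
      ∀ n > 0, P.proj n (x : SkewMonoidAlgebra B Γ) = 0 := by
    intro N
    induction N with
    | zero => exact fun h => h
    | succ N ih =>
      intro h
      refine ih fun n hn => ?_
      by_cases hn' : n = N + 1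
      · subst hn'
        have := P.map_proj_comul (N + 1) x
        rw [h (N + 1 + (N + 1)) (by omega), x.2.comul_eq_tmul_self] at this
        exact eq_zero_of_tmul_self_eq_zero (k := k) (by simpa using this)
      · exact h n (by omega)
  have hx : (x : SkewMonoidAlgebra B Γ) ∈
      Submodule.span k (GroupLike.val '' Set.range (toGroupLike k Γ B)) := by
    rw [← P.eq_proj_zero (hpos N hN), ← Set.range_comp]
    exact P.proj_zero_mem_span _
  by_contra h
  exact (linearIndep_groupLikeVal (R := k) (A := SkewMonoidAlgebra B Γ)).notMem_span_image h hx

end GroupLike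

end PreNicholsAlgebra

/-- Compare coefficients at `g ⊗ g`: for `g ≠ 1` one side is `0`, and for `g = 1` the coefficient
equals its double. This works in every characteristic. -/
theorem MonoidAlgebra.eq_zero_of_comul_eq {k G : Type*} [Field k] [Group G]
    {z : MonoidAlgebra k G} (hz : Coalgebra.comul (R := k) z = z ⊗ₜ 1 + 1 ⊗ₜ z) : z = 0 := by
  ext g
  have h := AssocZestingDatum.rid_map_coeffAt_comul g g z
  rw [hz, if_pos rfl] at h
  change AssocZestingDatum.coeffAt k g z = 0
  by_cases hg : 1 = g
  · simpa [MonoidAlgebra.one_def, AssocZestingDatum.coeffAt_single, hg] using h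
  · simpa [MonoidAlgebra.one_def, AssocZestingDatum.coeffAt_single, hg] using h.symm

namespace Bosonization

open SkewMonoidAlgebra

theorem nontrivial (k Γ B : Type*) [Field k] [Group Γ] [Ring B] [Algebra k B]
    [MulSemiringAction Γ B] [SMulCommClass Γ k B] [YetterDrinfeld k Γ B] [Coalgebra k B]
    [BraidedHopfAlgebra k Γ B] : Nontrivial B := by
  refine ⟨0, 1, fun h => ?_⟩
  have := BraidedHopfAlgebra.counit_one (k := k) (Γ := Γ) (B := B)
  rw [← h, map_zero] at this
  exact zero_ne_one this

theorem toGroupLike_injective (k Γ B : Type*) [Field k] [Group Γ] [Ring B] [Algebra k B]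
    [MulSemiringAction Γ B] [SMulCommClass Γ k B] [YetterDrinfeld k Γ B] [Coalgebra k B]
    [BraidedHopfAlgebra k Γ B] :
    Function.Injective (toGroupLike k Γ B) := by
  have := nontrivial k Γ B
  intro g h hgh
  exact (single_left_inj (one_ne_zero (α := B))).1 (congrArg GroupLike.val hgh)

end Bosonization

/-! ### From a datum to a choice. -/

namespace AssocZestingDatum

open YetterDrinfeld SkewMonoidAlgebra Bosonization PreNicholsAlgebra

variable {k Γ V B G : Type*} [Field k] [Group Γ]
  [AddCommGroup V] [Module k V] [DistribMulAction Γ V] [SMulCommClass Γ k V]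
  [YetterDrinfeld k Γ V] [Ring B] [Algebra k B] [MulSemiringAction Γ B] [SMulCommClass Γ k B]
  [YetterDrinfeld k Γ B] [Coalgebra k B] [BraidedHopfAlgebra k Γ B] [Group G]
  (P : PreNicholsAlgebra k Γ V B) (D : AssocZestingDatum k (Bosonization B Γ) G)

/-- The homomorphism `Γ → G` induced by `π` on group-like elements. -/
noncomputable def degHom : Γ →* G :=
  MonoidAlgebra.mapDomainOfBialgHom (R := k) (D.π.comp
    (MonoidAlgebra.liftGroupLikeBialgHom.comp
      (MonoidAlgebra.mapDomainBialgHom k (toGroupLike k Γ B))))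

theorem π_group (g : Γ) : D.π (single g 1) = MonoidAlgebra.single (D.degHom g) 1 := by
  rw [degHom, MonoidAlgebra.single_mapDomainOfBialgHom]
  simp [toGroupLike]

-- Cocentrality at `v` reads `v ⊗ 1 + h ⊗ π(v) = 1 ⊗ π(v) + v ⊗ π(h)`. The part of degree one in the
-- first factor gives `π(h) = 1`; then `π(v)` is primitive in `k[G]`.
include P in
theorem π_eq_one_and_eq_zero {h : Γ} {v : V} (hv : IsHomogeneous k h v) (hv₀ : v ≠ 0) :
    D.degHom h = 1 ∧ D.π (P.gen v) = 0 := by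
  have hgen : P.gen v ≠ 0 := by
    rw [gen, Ne, single_eq_zero]
    exact fun h => hv₀ (P.incl_injective (h.trans (map_zero _).symm))
  have h₁ := LinearMap.congr_fun D.π_cocentral (P.gen v)
  simp only [LinearMap.comp_apply] at h₁
  rw [P.comul_gen hv] at h₁
  -- Keeping degree one in the first factor removes the two terms containing `π(v)`.
  have h₂ := congrArg (LinearMap.rTensor (MonoidAlgebra k G) (P.proj 1)) h₁
  have e₁ : P.proj 1 1 = 0 := P.proj_one_single 1
  simp [P.proj_gen_one, P.proj_one_single, e₁, D.π_group] at h₂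
  -- A functional that does not vanish at `v` cancels the first tensor factor.
  obtain ⟨f, hf⟩ : ∃ f : Module.Dual k (Bosonization B Γ), f (P.gen v) ≠ 0 := by
    by_contra! hf
    exact hgen ((Module.forall_dual_apply_eq_zero_iff k _).1 hf)
  have h₃ := congrArg (TensorProduct.lid k _ ∘ LinearMap.rTensor (MonoidAlgebra k G) f) h₂
  simp only [Function.comp_apply, LinearMap.rTensor_tmul, TensorProduct.lid_tmul] at h₃
  have h₄ : (1 : MonoidAlgebra k G) = MonoidAlgebra.single (D.degHom h) 1 :=
    smul_right_injective _ hf h₃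
  have h₅ : D.degHom h = 1 := by
    rw [MonoidAlgebra.one_def] at h₄
    exact (MonoidAlgebra.single_left_injective (R := k) one_ne_zero h₄).symm
  refine ⟨h₅, MonoidAlgebra.eq_zero_of_comul_eq ?_⟩
  rw [← CoalgHomClass.map_comp_comul_apply, P.comul_gen hv]
  simp [D.π_group, h₅, MonoidAlgebra.one_def]

theorem π_gen {h : Γ} {v : V} (hv : IsHomogeneous k h v) : D.π (P.gen v) = 0 := by
  by_cases hv₀ : v = 0
  · rw [hv₀, P.gen_zero, map_zero]
  · exact (D.π_eq_one_and_eq_zero P hv hv₀).2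

include P in
theorem supp_le_ker : supp k Γ V ≤ D.degHom.ker :=
  (Subgroup.closure_le _).2 fun _ ⟨_, hv₀, hv⟩ => (D.π_eq_one_and_eq_zero P hv hv₀).1

include P in
theorem π_single (g : Γ) (x : B) :
    D.π (single g x) = MonoidAlgebra.single (D.degHom g) (Coalgebra.counit (R := k) x) := by
  have h₁ : (D.π : Bosonization B Γ →ₐ[k] MonoidAlgebra k G).comp (baseHom k Γ B) =
      (Algebra.ofId k (MonoidAlgebra k G)).comp (counitBase k Γ B) :=
    P.base_algHom_ext fun h v hv => by
      have : counitBase k Γ B (P.incl v) = 0 := P.counit_incl v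
      rw [AlgHom.comp_apply, AlgHom.comp_apply, this, map_zero]
      exact D.π_gen P hv
  have h₂ : D.π (single 1 x) = algebraMap k _ (Coalgebra.counit (R := k) x) :=
    AlgHom.congr_fun h₁ x
  rw [Bosonization.single_eq, map_mul, h₂, π_group, Algebra.algebraMap_eq_smul_one, smul_mul_assoc,
    one_mul, MonoidAlgebra.smul_single, smul_eq_mul, mul_one]

/-- The homomorphism `Γ / supp V → G` induced by `π`. -/
noncomputable def quotientHom : Γ ⧸ supp k Γ V →* G :=
  QuotientGroup.lift _ D.degHom (D.supp_le_ker P)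

/-- If `g` were not attained, the coefficient at `g` would vanish on the whole image of `π`. -/
theorem quotientHom_surjective : Function.Surjective (D.quotientHom P) := by
  intro g
  obtain ⟨x, hx⟩ := D.π_surjective (MonoidAlgebra.single g 1)
  by_contra! hg
  have h : coeffAt k g ∘ₗ (D.π : Bosonization B Γ →ₐ[k] MonoidAlgebra k G).toLinearMap = 0 := by
    refine SkewMonoidAlgebra.lhom_ext fun h b => ?_
    have := D.π_single P h b
    simp only [LinearMap.comp_apply, LinearMap.zero_apply]
    refine (congrArg _ this).trans ?_
    exact (coeffAt_single _ _ _).trans (if_neg (hg h))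
  have := LinearMap.congr_fun h x
  simp only [LinearMap.comp_apply] at this
  rw [show (D.π : Bosonization B Γ →ₐ[k] MonoidAlgebra k G).toLinearMap x =
    MonoidAlgebra.single g 1 from hx, coeffAt_single, if_pos rfl] at this
  exact one_ne_zero this

/-- The elements of `Γ` whose associated group-like element lies in `Γ₀`. -/
noncomputable def groupPart : Subgroup Γ := D.Γ₀.comap (toGroupLike k Γ B)

/-- The identification of `groupPart` with `Γ₀`. -/
noncomputable def groupPartEquiv : D.groupPart ≃* D.Γ₀ :=
  MulEquiv.ofBijective ((toGroupLike k Γ B).subgroupComap D.Γ₀)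
    ⟨fun _ _ h => Subtype.ext (Bosonization.toGroupLike_injective k Γ B (congrArg Subtype.val h)),
      MonoidHom.subgroupComap_surjective_of_surjective _ _ P.toGroupLike_surjective⟩

theorem coe_groupPartEquiv (u : D.groupPart) :
    (D.groupPartEquiv P u : GroupLike k (Bosonization B Γ)) = toGroupLike k Γ B u := rfl

theorem toGroupLike_groupPartEquiv_symm (u : D.Γ₀) :
    toGroupLike k Γ B ((D.groupPartEquiv P).symm u) = (u : GroupLike k (Bosonization B Γ)) := by
  rw [← D.coe_groupPartEquiv P, MulEquiv.apply_symm_apply]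

theorem elt_groupPartEquiv (u : D.groupPart) : D.elt (D.groupPartEquiv P u) = single (u : Γ) 1 :=
  rfl

theorem convLeft_form_single (u : D.Γ₀) (h : Γ) :
    convLeft (D.form u) LinearMap.id (single h 1 : Bosonization B Γ) =
      D.form u (single h 1) • single h 1 := by
  have := comulHom_group (k := k) (B := B) h
  rw [convLeft, LinearMap.comp_apply, LinearMap.comp_apply]
  rw [show Coalgebra.comul (R := k) (single h 1 : Bosonization B Γ) = _ from this]
  simp

theorem convRight_form_single (u : D.Γ₀) (h : Γ) :
    convRight LinearMap.id (D.form u) (single h 1 : Bosonization B Γ) =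
      D.form u (single h 1) • single h 1 := by
  have := comulHom_group (k := k) (B := B) h
  rw [convRight, LinearMap.comp_apply, LinearMap.comp_apply]
  rw [show Coalgebra.comul (R := k) (single h 1 : Bosonization B Γ) = _ from this]
  simp

/-- The character of `Γ` given by `γ(u)`. -/
noncomputable def character (u : D.Γ₀) : Γ →* kˣ :=
  MonoidHom.toHomUnits
    (((D.γ u).ofConv : Bosonization B Γ →* k).comp
      ((GroupLike.valMonoidHom k (SkewMonoidAlgebra B Γ)).comp (toGroupLike k Γ B)))

theorem coe_character (u : D.Γ₀) (h : Γ) :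
    ((D.character u h : kˣ) : k) = D.form u (single h 1) := rfl

theorem character_mul (u v : D.Γ₀) : D.character (u * v) = D.character u * D.character v := by
  ext h
  rw [coe_character, form_mul, MonoidHom.mul_apply, Units.val_mul, coe_character, coe_character,
    convRight_eq_comp, LinearMap.comp_apply, convRight_form_single, map_smul, smul_eq_mul, mul_comm]

-- Centrality of `γ(u)` at a group-like `h` carries the same nonzero scalar on both sides, leaving
-- `h u = u h`.
include P in
theorem groupPart_le_center : D.groupPart ≤ Subgroup.center Γ := by
  intro u hu
  rw [Subgroup.mem_center_iff]
  intro h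
  have := convLeft_form_mul_elt (D.groupPartEquiv P ⟨u, hu⟩) (single h 1)
  rw [convLeft_form_single, convRight_form_single, elt_groupPartEquiv, smul_mul_assoc,
    mul_smul_comm] at this
  have h₂ := smul_right_injective _
    (r := D.form (D.groupPartEquiv P ⟨u, hu⟩) (single h 1))
    (D.character (D.groupPartEquiv P ⟨u, hu⟩) h).ne_zero this
  rw [single_mul_single, single_mul_single] at h₂
  have := Bosonization.nontrivial k Γ B
  simpa using (single_left_inj (by simp)).1 (h₂.trans (by simp))

/-- The coaction of `u` is known twice, from coinvariance and from `π(u)`; the counit on the second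
leg compares the two degrees. -/
theorem degHom_of_mem_groupPart {u : Γ} (hu : u ∈ D.groupPart) : D.degHom u = 1 := by
  have h := D.mem_homogeneous_iff.1 (D.coe_mem_homogeneous ⟨toGroupLike k Γ B u, hu⟩)
  have h₁ : D.coactionHom (single u 1) =
      MonoidAlgebra.single (D.degHom u) 1 ⊗ₜ (single u 1 : Bosonization B Γ) := by
    rw [← π_group]
    have := comulHom_group (k := k) (B := B) u
    refine (congrArg (Algebra.TensorProduct.map (D.π : Bosonization B Γ →ₐ[k] MonoidAlgebra k G)
      (AlgHom.id k (Bosonization B Γ))) this).trans ?_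
    simp
  have h₂ := congrArg (TensorProduct.rid k _ ∘
    LinearMap.lTensor (MonoidAlgebra k G) (Coalgebra.counit (R := k))) (h₁.symm.trans h)
  have h₃ : Coalgebra.counit (R := k) (single u 1 : Bosonization B Γ) = 1 :=
    (toGroupLike k Γ B u).2.counit_eq_one
  have h₄ : Coalgebra.counit (R := k)
      ((toGroupLike k Γ B u : GroupLike k (Bosonization B Γ)) : Bosonization B Γ) = 1 := h₃
  simp only [Function.comp_apply, LinearMap.lTensor_tmul, TensorProduct.rid_tmul, h₃, h₄,
    one_smul] at h₂
  exact MonoidAlgebra.single_left_injective (R := k) one_ne_zero h₂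

theorem convLeft_form_gen (u : D.Γ₀) {h : Γ} {v : V} (hv : IsHomogeneous k h v) :
    convLeft (D.form u) LinearMap.id (P.gen v) =
      D.form u (P.gen v) • 1 + D.form u (single h 1) • P.gen v := by
  rw [convLeft, LinearMap.comp_apply, LinearMap.comp_apply, P.comul_gen hv]
  simp

theorem convRight_form_gen (u : D.Γ₀) {h : Γ} {v : V} (hv : IsHomogeneous k h v) :
    convRight LinearMap.id (D.form u) (P.gen v) =
      P.gen v + D.form u (P.gen v) • single h 1 := by
  rw [convRight, LinearMap.comp_apply, LinearMap.comp_apply, P.comul_gen hv]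
  simp

/-- Centrality written out at a generator. It mixes degrees zero and one of the bosonization, and
the next two lemmas separate them. -/
theorem form_gen_mul (u : D.groupPart) {h : Γ} {v : V} (hv : IsHomogeneous k h v) :
    D.form (D.groupPartEquiv P u) (P.gen v) • (single (u : Γ) 1 : Bosonization B Γ) +
      D.form (D.groupPartEquiv P u) (single h 1) • single (u : Γ) (P.incl v) =
      single (u : Γ) (P.incl ((u : Γ) • v)) +
        D.form (D.groupPartEquiv P u) (P.gen v) • single ((u : Γ) * h) 1 := by
  have := convLeft_form_mul_elt (D.groupPartEquiv P u) (P.gen v)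
  rw [D.convLeft_form_gen P _ hv, D.convRight_form_gen P _ hv, elt_groupPartEquiv, add_mul,
    mul_add, P.single_mul_gen, smul_mul_assoc, smul_mul_assoc, one_mul, mul_smul_comm] at this
  simpa only [gen, single_mul_single, one_mul, smul_one, mul_one] using this

/-- The degree-one part of `form_gen_mul`. -/
theorem smul_eq_form_smul (u : D.groupPart) {h : Γ} {v : V} (hv : IsHomogeneous k h v) :
    (u : Γ) • v = D.form (D.groupPartEquiv P u) (single h 1) • v := by
  have h₁ := congrArg (P.proj 1) (D.form_gen_mul P u hv)
  simp only [map_add, map_smul, P.proj_one_single, smul_zero, zero_add, add_zero] at h₁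
  rw [P.proj_single_of_mem _ (P.incl_mem_grading _), P.proj_single_of_mem _ (P.incl_mem_grading _),
    if_pos rfl, if_pos rfl, smul_single] at h₁
  have h₂ := single_injective _ h₁
  rw [← map_smul] at h₂
  exact (P.incl_injective h₂).symm

/-- The degree-zero part of `form_gen_mul` equates the multiples of `u` and `u h` by `γ(v)`, and
these group elements differ when `h ≠ 1`. -/
theorem form_gen_eq_zero (u : D.groupPart) {h : Γ} {v : V} (hv : IsHomogeneous k h v)
    (hh : h ≠ 1) : D.form (D.groupPartEquiv P u) (P.gen v) = 0 := by
  have h₁ := congrArg (P.proj 0) (D.form_gen_mul P u hv)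
  have e : ∀ g : Γ, P.proj 0 (single g 1) = single g 1 := fun g =>
    (P.proj_single_of_mem g P.one_mem_grading).trans (if_pos rfl)
  simp only [map_add, map_smul, e] at h₁
  rw [P.proj_single_of_mem _ (P.incl_mem_grading _), P.proj_single_of_mem _ (P.incl_mem_grading _),
    if_neg one_ne_zero, if_neg one_ne_zero, smul_zero, add_zero, zero_add] at h₁
  have := Bosonization.nontrivial k Γ B
  by_contra hf
  have h₂ := (single_left_inj (one_ne_zero (α := B))).1 (smul_right_injective _ hf h₁)
  exact hh (by simpa using h₂)

/-- The choice to which the datum `D` restricts. -/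
noncomputable def choice : PointedZestingChoice k Γ V G where
  ι := D.quotientHom P
  ι_surjective := D.quotientHom_surjective P
  Γ₀ := D.groupPart
  Γ₀_central := D.groupPart_le_center P
  Γ₀_le_ker _ hg := D.degHom_of_mem_groupPart hg
  Φ :=
    { toFun u := D.character (D.groupPartEquiv P u)
      map_one' := by
        ext h
        rw [map_one, coe_character, form_one]
        exact (toGroupLike k Γ B h).2.counit_eq_one
      map_mul' u v := by rw [map_mul, character_mul] }
  Φ_smul u _ _ hv := D.smul_eq_form_smul P u hv
  lam g₁ g₂ := (D.groupPartEquiv P).symm (D.lam g₁ g₂)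
  lam_cocycle :=
    { one_left g := by rw [D.lam_cocycle.one_left, map_one]
      one_right g := by rw [D.lam_cocycle.one_right, map_one]
      cocycle g₁ g₂ g₃ := by rw [← map_mul, D.lam_cocycle.cocycle, map_mul] }
  ω := D.ω
  ω_normalized := D.ω_normalized
  compat g₁ g₂ g₃ g₄ := by
    ext
    rw [← form_lam_apply_lam]
    refine (coe_character _ _ _).trans ?_
    rw [MulEquiv.apply_symm_apply, ← D.elt_groupPartEquiv P, MulEquiv.apply_symm_apply]

theorem isRestrictionOf_choice : (D.choice P).IsRestrictionOf D where
  π_eq x g := D.π_single P g x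
  Γ₀_eq := (Subgroup.map_comap_eq_self_of_surjective P.toGroupLike_surjective _).symm
  γ_eq g g' hg h := by
    have : g' = D.groupPartEquiv P g := Subtype.ext hg
    subst this
    rfl
  lam_eq g₁ g₂ := (D.toGroupLike_groupPartEquiv_symm P _).symm
  ω_eq := rfl

end AssocZestingDatum

/-! ### Extensionality of data and of choices. -/

/-- The types of `γ` and `lam` depend on `Γ₀`, so they are compared on underlying elements. -/
theorem AssocZestingDatum.ext_of_eq {k H G : Type*} [Field k] [Ring H] [HopfAlgebra k H] [Group G]
    {D D' : AssocZestingDatum k H G} (hπ : D.π = D'.π) (hΓ₀ : D.Γ₀ = D'.Γ₀)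
    (hγ : ∀ (u : GroupLike k H) (hu : u ∈ D.Γ₀) (hu' : u ∈ D'.Γ₀), D.γ ⟨u, hu⟩ = D'.γ ⟨u, hu'⟩)
    (hlam : ∀ g₁ g₂, (D.lam g₁ g₂ : GroupLike k H) = D'.lam g₁ g₂) (hω : D.ω = D'.ω) :
    D = D' := by
  obtain ⟨π, hs, hc, Γ₀, hi, γ, hz, lam, hl, ω, hn, hcomp⟩ := D
  obtain ⟨π', hs', hc', Γ₀', hi', γ', hz', lam', hl', ω', hn', hcomp'⟩ := D'
  subst hπ hΓ₀ hω
  have h₁ : γ = γ' := MonoidHom.ext fun u => hγ u u.2 u.2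
  have h₂ : lam = lam' := funext fun g₁ => funext fun g₂ => Subtype.ext (hlam g₁ g₂)
  subst h₁ h₂
  rfl

theorem PointedZestingChoice.ext_of_eq {k Γ V G : Type*} [Field k] [Group Γ]
    [AddCommGroup V] [Module k V] [DistribMulAction Γ V] [SMulCommClass Γ k V]
    [YetterDrinfeld k Γ V] [Group G] {c c' : PointedZestingChoice k Γ V G} (hι : c.ι = c'.ι)
    (hΓ₀ : c.Γ₀ = c'.Γ₀)
    (hΦ : ∀ (u : Γ) (hu : u ∈ c.Γ₀) (hu' : u ∈ c'.Γ₀), c.Φ ⟨u, hu⟩ = c'.Φ ⟨u, hu'⟩)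
    (hlam : ∀ g₁ g₂, (c.lam g₁ g₂ : Γ) = c'.lam g₁ g₂) (hω : c.ω = c'.ω) : c = c' := by
  obtain ⟨ι, hs, Γ₀, hc, hk, Φ, hz, lam, hl, ω, hn, hcomp⟩ := c
  obtain ⟨ι', hs', Γ₀', hc', hk', Φ', hz', lam', hl', ω', hn', hcomp'⟩ := c'
  subst hι hΓ₀ hω
  have h₁ : Φ = Φ' := MonoidHom.ext fun u => hΦ u u.2 u.2
  have h₂ : lam = lam' := funext fun g₁ => funext fun g₂ => Subtype.ext (hlam g₁ g₂)
  subst h₁ h₂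
  rfl

section

open YetterDrinfeld SkewMonoidAlgebra Bosonization

variable {k Γ V B G : Type*} [Field k] [Group Γ]
  [AddCommGroup V] [Module k V] [DistribMulAction Γ V] [SMulCommClass Γ k V]
  [YetterDrinfeld k Γ V] [Ring B] [Algebra k B] [MulSemiringAction Γ B] [SMulCommClass Γ k B]
  [YetterDrinfeld k Γ B] [Coalgebra k B] [BraidedHopfAlgebra k Γ B] [Group G]

/-! ### Characters of the bosonization coming from `Γ`. -/

section Characters

theorem Bosonization.comul_group (g : Γ) :
    Coalgebra.comul (R := k) (single g 1 : SkewMonoidAlgebra B Γ) = single g 1 ⊗ₜ single g 1 :=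
  comulHom_group g

theorem Bosonization.counit_group (g : Γ) :
    Coalgebra.counit (R := k) (single g 1 : SkewMonoidAlgebra B Γ) = 1 :=
  (toGroupLike k Γ B g).2.counit_eq_one

theorem Bosonization.counitBase_smul_eq (g : Γ) (x : B) :
    counitBase k Γ B (g • x) = counitBase k Γ B x :=
  BraidedHopfAlgebra.counit_smul g x

theorem Bosonization.counitBase_smul_mul (χ : Γ →* kˣ) {x : B} {g : Γ} :
    counitBase k Γ B (g • x) * (Units.coeHom k).comp χ g =
      (Units.coeHom k).comp χ g * counitBase k Γ B x := by
  rw [counitBase_smul_eq, mul_comm]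

variable (B) in
/-- The character `x # h ↦ ε(x) χ(h)` of the bosonization. -/
noncomputable def Bosonization.characterHom (χ : Γ →* kˣ) : SkewMonoidAlgebra B Γ →ₐ[k] k :=
  liftNCAlgHom (counitBase k Γ B) ((Units.coeHom k).comp χ) (counitBase_smul_mul χ)

theorem Bosonization.characterHom_single (χ : Γ →* kˣ) (h : Γ) (x : B) :
    characterHom B χ (single h x) = Coalgebra.counit (R := k) x * (χ h : kˣ) :=
  liftNCAlgHom_single _ _ (counitBase_smul_mul χ) _ _

theorem Bosonization.characterHom_group (χ : Γ →* kˣ) (h : Γ) :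
    characterHom B χ (single h 1) = (χ h : kˣ) := by
  rw [characterHom_single, BraidedHopfAlgebra.counit_one (Γ := Γ), one_mul]

variable (P : PreNicholsAlgebra k Γ V B)

theorem PreNicholsAlgebra.characterHom_gen (χ : Γ →* kˣ) (v : V) :
    characterHom B χ (P.gen v) = 0 := by
  rw [gen, characterHom_single, P.counit_incl, zero_mul]

/-- The homomorphism from characters of `Γ` to characters of the bosonization. -/
noncomputable def PreNicholsAlgebra.characterMonoidHom :
    (Γ →* kˣ) →* WithConv (SkewMonoidAlgebra B Γ →ₐ[k] k) where
  toFun χ := WithConv.toConv (characterHom B χ)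
  map_one' := by
    apply WithConv.ofConv_injective
    refine P.algHom_ext (fun h v _ => ?_) fun g => ?_
    · refine (P.characterHom_gen 1 v).trans ?_
      rw [AlgHom.convOne_def]
      exact (P.counit_gen v).symm
    · refine (characterHom_group 1 g).trans ?_
      rw [AlgHom.convOne_def]
      exact (counit_group g).symm
  map_mul' χ χ' := by
    apply WithConv.ofConv_injective
    refine P.algHom_ext (fun h v hv => ?_) fun g => ?_
    · refine (P.characterHom_gen _ v).trans ?_
      rw [AlgHom.convMul_def]
      simp [P.comul_gen hv, P.characterHom_gen]
    · refine (characterHom_group _ g).trans ?_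
      rw [AlgHom.convMul_def]
      simp [comul_group, characterHom_group]

end Characters

/-! ### From a choice to a datum. -/

namespace PointedZestingChoice

variable (P : PreNicholsAlgebra k Γ V B) (c : PointedZestingChoice k Γ V G)

/-- The composite `Γ → Γ / supp V → G`. -/
def degree : Γ →* G := c.ι.comp (QuotientGroup.mk' _)

theorem degree_apply (g : Γ) : c.degree g = c.ι (g : Γ ⧸ supp k Γ V) := rfl

theorem degree_eq_one {h : Γ} {v : V} (hv : IsHomogeneous k h v) (hv₀ : v ≠ 0) :
    c.degree h = 1 := by
  have : (h : Γ ⧸ supp k Γ V) = 1 :=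
    (QuotientGroup.eq_one_iff h).2 (Subgroup.subset_closure ⟨v, hv₀, hv⟩)
  rw [degree_apply, this, map_one]

theorem ofId_counitBase_smul_mul {x : B} {g : Γ} :
    (Algebra.ofId k (MonoidAlgebra k G)).comp (counitBase k Γ B) (g • x) *
        (MonoidAlgebra.of k G).comp c.degree g =
      (MonoidAlgebra.of k G).comp c.degree g *
        (Algebra.ofId k (MonoidAlgebra k G)).comp (counitBase k Γ B) x := by
  rw [AlgHom.comp_apply, AlgHom.comp_apply, counitBase_smul_eq]
  exact Algebra.commutes _ _

variable (B) in
/-- The algebra map `x # g ↦ ε(x) ι(g)`. -/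
noncomputable def projectionAlgHom : Bosonization B Γ →ₐ[k] MonoidAlgebra k G :=
  liftNCAlgHom ((Algebra.ofId k _).comp (counitBase k Γ B))
    ((MonoidAlgebra.of k G).comp c.degree) c.ofId_counitBase_smul_mul

theorem projectionAlgHom_single (g : Γ) (x : B) : c.projectionAlgHom B (single g x) =
    MonoidAlgebra.single (c.degree g) (Coalgebra.counit (R := k) x) := by
  refine (liftNCAlgHom_single _ _ c.ofId_counitBase_smul_mul _ _).trans ?_
  refine (Algebra.smul_def (Coalgebra.counit (R := k) x) _).symm.trans ?_
  simp

theorem projectionAlgHom_group (g : Γ) : c.projectionAlgHom B (single g 1) =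
    MonoidAlgebra.single (c.degree g) 1 := by
  rw [projectionAlgHom_single, BraidedHopfAlgebra.counit_one (Γ := Γ)]

theorem projectionAlgHom_gen (v : V) : c.projectionAlgHom B (P.gen v) = 0 := by
  rw [PreNicholsAlgebra.gen, projectionAlgHom_single, P.counit_incl, MonoidAlgebra.single_zero]

/-- The Hopf algebra map `x # g ↦ ε(x) ι(g)`. -/
noncomputable def projection : Bosonization B Γ →ₐc[k] MonoidAlgebra k G :=
  BialgHom.ofAlgHom (c.projectionAlgHom B)
    (P.algHom_ext (fun h v _ => by simp [projectionAlgHom_gen]) fun g => by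
      simp [projectionAlgHom_group, counit_group])
    (P.algHom_ext (fun h v hv => by simp [projectionAlgHom_gen, P.comul_gen hv]) fun g => by
      simp [projectionAlgHom_group, comul_group])

theorem projection_surjective : Function.Surjective (c.projection P) := by
  intro x
  induction x using MonoidAlgebra.induction_linear with
  | zero => exact ⟨0, map_zero _⟩
  | add x y hx hy =>
    obtain ⟨a, rfl⟩ := hx
    obtain ⟨b, rfl⟩ := hy
    exact ⟨a + b, map_add _ _ _⟩
  | single g a =>
    obtain ⟨q, hq⟩ := c.ι_surjective g
    obtain ⟨h, rfl⟩ := QuotientGroup.mk_surjective q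
    refine ⟨a • single h 1, (map_smul _ _ _).trans ?_⟩
    refine (congrArg (a • ·) (c.projectionAlgHom_group h)).trans ?_
    rw [degree_apply, hq]
    simp

/-- Both sides are algebra maps, the flip being one, so generators suffice. A nonzero `v` of degree
`h` is killed, and `h`, lying in the support, maps to `1`. -/
theorem projection_cocentral :
    LinearMap.lTensor (Bosonization B Γ)
        (c.projection P : Bosonization B Γ →ₐ[k] MonoidAlgebra k G).toLinearMap ∘ₗ
      Coalgebra.comul =
    LinearMap.lTensor (Bosonization B Γ)
        (c.projection P : Bosonization B Γ →ₐ[k] MonoidAlgebra k G).toLinearMap ∘ₗ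
      (TensorProduct.comm k _ _).toLinearMap ∘ₗ Coalgebra.comul := by
  have h : (Algebra.TensorProduct.map (AlgHom.id k (Bosonization B Γ))
        (c.projectionAlgHom B)).comp (Bialgebra.comulAlgHom k _) =
      ((Algebra.TensorProduct.map (AlgHom.id k (Bosonization B Γ)) (c.projectionAlgHom B)).comp
        (Algebra.TensorProduct.comm k _ _).toAlgHom).comp (Bialgebra.comulAlgHom k _) := by
    refine P.algHom_ext (fun h v hv => ?_) fun g => ?_
    · by_cases hv₀ : v = 0
      · rw [hv₀, P.gen_zero, map_zero, map_zero]
      · simp [P.comul_gen hv, projectionAlgHom_gen, projectionAlgHom_group,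
          c.degree_eq_one hv hv₀, MonoidAlgebra.one_def]
    · simp [comul_group]
  exact congrArg AlgHom.toLinearMap h

variable (B) in
/-- The identification of `Γ₀` with the corresponding group of group-like elements. -/
noncomputable def groupEquiv : c.Γ₀ ≃* c.Γ₀.map (toGroupLike k Γ B) :=
  c.Γ₀.equivMapOfInjective _ (toGroupLike_injective k Γ B)

-- On `Γ` this is centrality of `u`, and on `V` it is the condition on `Φ`; the elements satisfying
-- it form a subalgebra.
include P in
theorem characterHom_central (u : c.Γ₀) (h : Bosonization B Γ) :
    convLeft (characterHom B (c.Φ u)).toLinearMap LinearMap.id h * single (u : Γ) 1 =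
      single (u : Γ) 1 * convRight LinearMap.id (characterHom B (c.Φ u)).toLinearMap h := by
  let ψ := characterHom B (c.Φ u)
  let L : Bosonization B Γ →ₐ[k] Bosonization B Γ :=
    ((Algebra.TensorProduct.lid k _).toAlgHom.comp
      (Algebra.TensorProduct.map ψ (AlgHom.id k _))).comp (Bialgebra.comulAlgHom k _)
  let R : Bosonization B Γ →ₐ[k] Bosonization B Γ :=
    ((Algebra.TensorProduct.rid k k _).toAlgHom.comp
      (Algebra.TensorProduct.map (AlgHom.id k _) ψ)).comp (Bialgebra.comulAlgHom k _)
  let U : Bosonization B Γ := single (u : Γ) 1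
  -- Both convolutions are algebra endomorphisms, so being intertwined by `U` is closed under
  -- products.
  let S : Subalgebra k (SkewMonoidAlgebra B Γ) :=
    { carrier := {h | L h * U = U * R h}
      mul_mem' := fun {a b} ha hb => by
        simp only [Set.mem_ofPred_eq, map_mul] at *
        rw [mul_assoc, hb, ← mul_assoc, ha, mul_assoc]
      add_mem' := fun {a b} ha hb => by
        simp only [Set.mem_ofPred_eq, map_add, add_mul, mul_add] at *
        rw [ha, hb]
      algebraMap_mem' := fun r => by
        simp only [Set.mem_ofPred_eq, AlgHom.commutes]
        exact Algebra.commutes _ _ }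
  refine P.mem_of_generators S (fun g v hv => ?_) (fun g => ?_) h
  · change L (P.gen v) * U = U * R (P.gen v)
    have h₁ : L (P.gen v) = (c.Φ u g : kˣ).val • P.gen v := by
      simp [L, P.comul_gen hv, ψ, P.characterHom_gen, characterHom_group]
    have h₂ : R (P.gen v) = P.gen v := by
      simp [R, P.comul_gen hv, ψ, P.characterHom_gen]
    rw [h₁, h₂, P.single_mul_gen, c.Φ_smul u g v hv]
    simp [PreNicholsAlgebra.gen, smul_single, U]
  · change L (single g 1) * U = U * R (single g 1)
    have h₁ : L (single g 1) = (c.Φ u g : kˣ).val • single g 1 := by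
      simp [L, comul_group, ψ, characterHom_group]
    have h₂ : R (single g 1) = (c.Φ u g : kˣ).val • single g 1 := by
      simp [R, comul_group, ψ, characterHom_group]
    rw [h₁, h₂, smul_mul_assoc, mul_smul_comm, single_mul_single, single_mul_single,
      Subgroup.mem_center_iff.1 (c.Γ₀_central u.2) g, smul_one, smul_one]

/-- The associative zesting datum determined by a choice. -/
noncomputable def datum : AssocZestingDatum k (Bosonization B Γ) G where
  π := c.projection P
  π_surjective := c.projection_surjective P
  π_cocentral := c.projection_cocentral P
  Γ₀ := c.Γ₀.map (toGroupLike k Γ B)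
  Γ₀_coinvariant := by
    rintro _ ⟨u, hu, rfl⟩
    rw [(toGroupLike k Γ B u).2.comul_eq_tmul_self, LinearMap.lTensor_tmul]
    congr 1
    refine (c.projectionAlgHom_group u).trans ?_
    rw [degree_apply, c.Γ₀_le_ker u hu, MonoidAlgebra.one_def]
  γ := P.characterMonoidHom.comp (c.Φ.comp (c.groupEquiv B).symm.toMonoidHom)
  central g h := by
    obtain ⟨u, rfl⟩ := (c.groupEquiv B).surjective g
    have := c.characterHom_central P u h
    simpa only [MonoidHom.comp_apply, MulEquiv.coe_toMonoidHom, MulEquiv.symm_apply_apply] using! this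
  lam g₁ g₂ := c.groupEquiv B (c.lam g₁ g₂)
  lam_cocycle :=
    { one_left g := by rw [c.lam_cocycle.one_left, map_one]
      one_right g := by rw [c.lam_cocycle.one_right, map_one]
      cocycle g₁ g₂ g₃ := by rw [← map_mul, c.lam_cocycle.cocycle, map_mul] }
  ω := c.ω
  ω_normalized := c.ω_normalized
  compat g₁ g₂ g₃ g₄ := by
    rw [← c.compat, MonoidHom.comp_apply, MonoidHom.comp_apply, MulEquiv.coe_toMonoidHom,
      MulEquiv.symm_apply_apply]
    exact characterHom_group _ _

theorem datum_γ_groupEquiv (u : c.Γ₀) :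
    ((c.datum P).γ (c.groupEquiv B u)).ofConv = characterHom B (c.Φ u) := by
  change characterHom B (c.Φ ((c.groupEquiv B).symm (c.groupEquiv B u))) = _
  rw [MulEquiv.symm_apply_apply]

theorem determines_datum : c.Determines (c.datum P) where
  π_eq x g := c.projectionAlgHom_single g x
  Γ₀_eq := rfl
  γ_eq g g' hg h := by
    have : g' = c.groupEquiv B g := Subtype.ext hg
    rw [this, c.datum_γ_groupEquiv P, characterHom_group]
  lam_eq g₁ g₂ := rfl
  ω_eq := rfl
  γ_formula g g' hg x h := by
    have : g' = c.groupEquiv B g := Subtype.ext hg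
    rw [this, c.datum_γ_groupEquiv P, characterHom_single]

/-! ### Uniqueness, and when a datum is determined by its choice. -/

variable {c} {D D' : AssocZestingDatum k (Bosonization B Γ) G}

theorem IsRestrictionOf.exists_eq (h : c.IsRestrictionOf D) {u : GroupLike k (Bosonization B Γ)}
    (hu : u ∈ D.Γ₀) : ∃ g : c.Γ₀, toGroupLike k Γ B g = u := by
  rw [h.Γ₀_eq] at hu
  obtain ⟨g, hg, rfl⟩ := hu
  exact ⟨⟨g, hg⟩, rfl⟩

theorem IsRestrictionOf.toGroupLike_mem (h : c.IsRestrictionOf D) (g : c.Γ₀) :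
    toGroupLike k Γ B g ∈ D.Γ₀ := by
  rw [h.Γ₀_eq]
  exact ⟨g, g.2, rfl⟩

theorem Determines.unique (h : c.Determines D) (h' : c.Determines D') : D = D' := by
  refine AssocZestingDatum.ext_of_eq ?_ (h.Γ₀_eq.trans h'.Γ₀_eq.symm) (fun u hu hu' => ?_)
    (fun g₁ g₂ => (h.lam_eq g₁ g₂).trans (h'.lam_eq g₁ g₂).symm) (h.ω_eq.trans h'.ω_eq.symm)
  · apply BialgHom.coe_toAlgHom_injective
    apply AlgHom.toLinearMap_injective
    exact lhom_ext fun g x => (h.π_eq x g).trans (h'.π_eq x g).symm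
  · obtain ⟨g, hg⟩ := h.exists_eq hu
    apply WithConv.ofConv_injective
    apply AlgHom.toLinearMap_injective
    exact lhom_ext fun a x =>
      (h.γ_formula g ⟨u, hu⟩ hg.symm x a).trans (h'.γ_formula g ⟨u, hu'⟩ hg.symm x a).symm

theorem IsRestrictionOf.unique {c' : PointedZestingChoice k Γ V G} (h : c.IsRestrictionOf D)
    (h' : c'.IsRestrictionOf D) : c = c' := by
  have hΓ₀ : c.Γ₀ = c'.Γ₀ :=
    Subgroup.map_injective (toGroupLike_injective k Γ B) (h.Γ₀_eq.symm.trans h'.Γ₀_eq)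
  refine PointedZestingChoice.ext_of_eq ?_ hΓ₀ (fun u hu hu' => ?_)
    (fun g₁ g₂ => toGroupLike_injective k Γ B ((h.lam_eq g₁ g₂).symm.trans (h'.lam_eq g₁ g₂)))
    (h.ω_eq.symm.trans h'.ω_eq)
  · refine MonoidHom.ext fun q => ?_
    obtain ⟨g, rfl⟩ := QuotientGroup.mk_surjective q
    -- At `x = 1` the counit is `1`, so the group element can be recovered from the monomial.
    have := (h.π_eq 1 g).symm.trans (h'.π_eq 1 g)
    rw [BraidedHopfAlgebra.counit_one (Γ := Γ)] at this
    exact MonoidAlgebra.single_left_injective (R := k) one_ne_zero this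
  · ext a
    have hm := h.toGroupLike_mem ⟨u, hu⟩
    exact (h.γ_eq ⟨u, hu⟩ ⟨_, hm⟩ rfl a).symm.trans (h'.γ_eq ⟨u, hu'⟩ ⟨_, hm⟩ rfl a)

theorem IsRestrictionOf.determines_of_gen (h : c.IsRestrictionOf D)
    (h₀ : ∀ (g : D.Γ₀) (a : Γ) (v : V), IsHomogeneous k a v →
      (D.γ g).ofConv (P.gen v) = 0) : c.Determines D where
  toIsRestrictionOf := h
  γ_formula g g' hg x a := by
    have : (D.γ g').ofConv = characterHom B (c.Φ g) :=
      P.algHom_ext (fun a v hv => (h₀ g' a v hv).trans (P.characterHom_gen _ v).symm)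
        fun a => (h.γ_eq g g' hg a).trans (characterHom_group _ a).symm
    rw [this, characterHom_single]

/-- Two characters agreeing on `Γ` and `V` are equal, and on degrees other than `1` the vanishing is
automatic by `form_gen_eq_zero`. -/
theorem IsRestrictionOf.determines_iff (h : c.IsRestrictionOf D) :
    c.Determines D ↔ ∀ (g : D.Γ₀) (v : V), IsHomogeneous k (1 : Γ) v →
      (D.γ g).ofConv (single 1 (P.incl v)) = 0 := by
  refine ⟨fun hD g v _ => ?_, fun h₀ => h.determines_of_gen P fun g a v hv => ?_⟩
  · obtain ⟨u, hu⟩ := h.exists_eq g.2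
    rw [hD.γ_formula u g hu.symm, P.counit_incl, zero_mul]
  · by_cases ha : a = 1
    · subst ha
      exact h₀ g v hv
    · obtain ⟨u, rfl⟩ := (D.groupPartEquiv P).surjective g
      exact D.form_gen_eq_zero P u hv ha

/-- Powers of `v` lie in distinct degrees; if none vanished they would form an infinite independent
family. -/
theorem _root_.PreNicholsAlgebra.isNilpotent_incl [Module.Finite k B] (v : V) :
    IsNilpotent (P.incl v) := by
  have := P.gradedAlgebra
  by_contra hnil
  have hne : ∀ n, P.incl v ^ n ≠ 0 := fun n hn => hnil ⟨n, hn⟩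
  have hmem : ∀ n : ℕ, P.incl v ^ n ∈ P.grading n := fun n => by
    simpa using SetLike.pow_mem_graded n (P.incl_mem_grading v)
  have hind : LinearIndependent k fun n : ℕ => P.incl v ^ n :=
    (DirectSum.Decomposition.isInternal P.grading).submodule_iSupIndep.linearIndependent
      P.grading hmem hne
  have := hind.finite
  exact not_finite ℕ

include P in
theorem IsRestrictionOf.determines (h : c.IsRestrictionOf D)
    (hV : (∀ v : V, IsHomogeneous k (1 : Γ) v → v = 0) ∨ Module.Finite k B) :
    c.Determines D := by
  refine (h.determines_iff P).2 fun g v hv => ?_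
  rcases hV with hV | hB
  · rw [hV v hv, map_zero, single_zero, map_zero]
  -- A character into a field sends nilpotent elements to zero.
  · obtain ⟨n, hn⟩ := P.isNilpotent_incl v
    have h₁ : (single 1 (P.incl v) : SkewMonoidAlgebra B Γ) ^ n = 0 := by
      have := map_pow (PreNicholsAlgebra.baseHom k Γ B) (P.incl v) n
      rw [hn, map_zero] at this
      exact this.symm
    refine eq_zero_of_pow_eq_zero (n := n) ?_
    rw [← map_pow, h₁, map_zero]

/-! ### Explicit formulas for `H^λ`. -/

theorem _root_.AssocZestingDatum.coactionHom_group (g : Γ) :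
    D.coactionHom (single g 1) =
      MonoidAlgebra.single (D.degHom g) 1 ⊗ₜ (single g 1 : Bosonization B Γ) := by
  refine (congrArg (Algebra.TensorProduct.map (D.π : Bosonization B Γ →ₐ[k] MonoidAlgebra k G)
    (AlgHom.id k (Bosonization B Γ))) (comul_group g)).trans ?_
  simp [D.π_group]

-- The coaction and `x ↦ 1 ⊗ x` are algebra maps on `B`; they agree on nonzero `v` of degree `h`
-- because `π(v) = 0` and `π(h) = 1`.
include P in
theorem _root_.AssocZestingDatum.single_one_mem_homogeneous (x : B) :
    (single 1 x : Bosonization B Γ) ∈ D.homogeneous 1 := by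
  have h : D.coactionHom.comp (PreNicholsAlgebra.baseHom k Γ B) =
      (Algebra.TensorProduct.includeRight :
        Bosonization B Γ →ₐ[k] MonoidAlgebra k G ⊗[k] Bosonization B Γ).comp
        (PreNicholsAlgebra.baseHom k Γ B) := by
    refine P.base_algHom_ext fun a v hv => ?_
    change D.coactionHom (P.gen v) = 1 ⊗ₜ P.gen v
    by_cases hv₀ : v = 0
    · rw [hv₀, P.gen_zero, map_zero, TensorProduct.tmul_zero]
    · refine (congrArg (Algebra.TensorProduct.map (D.π : Bosonization B Γ →ₐ[k] MonoidAlgebra k G)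
        (AlgHom.id k (Bosonization B Γ))) (P.comul_gen hv)).trans ?_
      obtain ⟨h₁, h₂⟩ := D.π_eq_one_and_eq_zero P hv hv₀
      simp [h₁, h₂, D.π_group, MonoidAlgebra.one_def]
  exact D.mem_homogeneous_iff.2 (AlgHom.congr_fun h x)

include P in
theorem IsRestrictionOf.single_mem_component (h : c.IsRestrictionOf D) (g : Γ) (x : B) :
    (single g x : Bosonization B Γ) ∈ D.component (c.ι (g : Γ ⧸ supp k Γ V)) := by
  -- By uniqueness the choice is the one read off from `D`, whose `ι` is induced by `π`.
  rw [h.unique (D.isRestrictionOf_choice P)]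
  have := D.mul_mem_homogeneous (D.single_one_mem_homogeneous P x)
    (D.mem_homogeneous_iff.2 (D.coactionHom_group g))
  rw [one_mul, ← Bosonization.single_eq] at this
  exact this

include P in
theorem IsRestrictionOf.mul_formula (h : c.IsRestrictionOf D)
    {Q : CoquasiBialgebra k (Bosonization B Γ)} (hQ : D.IsZested Q) (x y : B) (g l : Γ) :
    Q.mul (single g x ⊗ₜ single l y) =
      single (g * l * (c.lam (c.ι (g : Γ ⧸ supp k Γ V)) (c.ι (l : Γ ⧸ supp k Γ V)) : Γ))
        (x * g • y) := by
  rw [hQ.mul _ _ _ (h.single_mem_component P g x) _ (h.single_mem_component P l y), h.lam_eq]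
  refine (congrArg (· * _) single_mul_single).trans ?_
  refine single_mul_single.trans ?_
  simp

-- Unlike the product, the associator evaluates `γ` on an element with a component in `B`, so the
-- restriction of `γ` to `Γ` is not enough.
include P in
theorem Determines.assoc_formula (h : c.Determines D)
    {Q : CoquasiBialgebra k (Bosonization B Γ)} (hQ : D.IsZested Q) (x y z : B) (g l t : Γ) :
    Q.assoc ((single g x ⊗ₜ single l y) ⊗ₜ single t z) =
      Coalgebra.counit (R := k) x * Coalgebra.counit (R := k) y * Coalgebra.counit (R := k) z *
        (c.ω (c.ι (g : Γ ⧸ supp k Γ V)) (c.ι (l : Γ ⧸ supp k Γ V))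
          (c.ι (t : Γ ⧸ supp k Γ V)) : kˣ) *
        (c.Φ (c.lam (c.ι (g : Γ ⧸ supp k Γ V)) (c.ι (l : Γ ⧸ supp k Γ V))) t : kˣ) := by
  have e : ∀ (g : Γ) (x : B), Coalgebra.counit (R := k) (single g x : Bosonization B Γ) =
      Coalgebra.counit (R := k) x := counitHom_single
  have hr := h.toIsRestrictionOf
  rw [hQ.assoc _ _ _ _ (hr.single_mem_component P g x) _ (hr.single_mem_component P l y) _
    (hr.single_mem_component P t z), h.γ_formula _ _ (h.lam_eq _ _), h.ω_eq, Bialgebra.counit_mul,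
    e, e]
  ring

end PointedZestingChoice

end

theorem mainTheorem4 {k Γ V B G : Type*} [Field k] [Group Γ]
    [AddCommGroup V] [Module k V] [Module.Finite k V]
    [DistribMulAction Γ V] [SMulCommClass Γ k V] [YetterDrinfeld k Γ V]
    [Ring B] [Algebra k B] [MulSemiringAction Γ B] [SMulCommClass Γ k B]
    [YetterDrinfeld k Γ B] [Coalgebra k B] [BraidedHopfAlgebra k Γ B]
    (P : PreNicholsAlgebra k Γ V B) [Group G] :
    -- every choice determines exactly one datum
    (∀ c : PointedZestingChoice k Γ V G,
      ∃! D : AssocZestingDatum k (Bosonization B Γ) G, c.Determines D) ∧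
    -- every datum restricts to exactly one choice
    (∀ D : AssocZestingDatum k (Bosonization B Γ) G,
      ∃! c : PointedZestingChoice k Γ V G, c.IsRestrictionOf D) ∧
    -- and is determined by it precisely when `γ` vanishes on the coinvariants of `V`,
    (∀ (D : AssocZestingDatum k (Bosonization B Γ) G) (c : PointedZestingChoice k Γ V G),
      c.IsRestrictionOf D →
        (c.Determines D ↔ ∀ (g : D.Γ₀) (v : V), YetterDrinfeld.IsHomogeneous k (1 : Γ) v →
          (D.γ g).ofConv (SkewMonoidAlgebra.single 1 (P.incl v)) = 0)) ∧
    -- which is automatic if `V` has no nonzero coinvariants or `B` is finite-dimensional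
    ((∀ v : V, YetterDrinfeld.IsHomogeneous k (1 : Γ) v → v = 0) ∨ Module.Finite k B →
      ∀ (D : AssocZestingDatum k (Bosonization B Γ) G) (c : PointedZestingChoice k Γ V G),
        c.IsRestrictionOf D → c.Determines D) ∧
    -- the relative `r`-form and the coquasi-Hopf algebra obtained from a datum
    (∀ (c : PointedZestingChoice k Γ V G) (D : AssocZestingDatum k (Bosonization B Γ) G),
      c.IsRestrictionOf D →
        (∃ r : Bosonization B Γ →ₗ[k] MonoidAlgebra k D.Γ₀ →ₗ[k] k,
          IsRelativeRForm D.inclusion r ∧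
          ∀ (h : Bosonization B Γ) (g : D.Γ₀),
            r h (MonoidAlgebra.single g 1) = (D.γ g⁻¹).ofConv h) ∧
        (∃ Q : CoquasiHopfAlgebra k (Bosonization B Γ), D.IsZested Q.toCoquasiBialgebra) ∧
        ∀ Q : CoquasiBialgebra k (Bosonization B Γ), D.IsZested Q →
          (∀ (x y : B) (g h : Γ),
            Q.mul (SkewMonoidAlgebra.single g x ⊗ₜ SkewMonoidAlgebra.single h y) =
              SkewMonoidAlgebra.single
                (g * h * (c.lam (c.ι (g : Γ ⧸ YetterDrinfeld.supp k Γ V))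
                  (c.ι (h : Γ ⧸ YetterDrinfeld.supp k Γ V)) : Γ))
                (x * g • y)) ∧
          (c.Determines D → ∀ (x y z : B) (g h l : Γ),
            Q.assoc ((SkewMonoidAlgebra.single g x ⊗ₜ SkewMonoidAlgebra.single h y) ⊗ₜ
                SkewMonoidAlgebra.single l z) =
              Coalgebra.counit (R := k) x * Coalgebra.counit (R := k) y *
                Coalgebra.counit (R := k) z *
                (c.ω (c.ι (g : Γ ⧸ YetterDrinfeld.supp k Γ V))
                  (c.ι (h : Γ ⧸ YetterDrinfeld.supp k Γ V))
                  (c.ι (l : Γ ⧸ YetterDrinfeld.supp k Γ V)) : kˣ) *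
                (c.Φ (c.lam (c.ι (g : Γ ⧸ YetterDrinfeld.supp k Γ V))
                  (c.ι (h : Γ ⧸ YetterDrinfeld.supp k Γ V))) l : kˣ))) := by
  refine ⟨fun c => ⟨c.datum P, c.determines_datum P, fun D hD => hD.unique (c.determines_datum P)⟩,
    fun D => ⟨D.choice P, D.isRestrictionOf_choice P,
      fun c hc => hc.unique (D.isRestrictionOf_choice P)⟩,
    fun D c h => h.determines_iff P, fun hV D c h => h.determines P hV,
    fun c D h => ⟨⟨D.rForm, AssocZestingDatum.isRelativeRForm_rForm, fun a g => ?_⟩,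
      ⟨D.zested, AssocZestingDatum.isZested_zested⟩,
      fun Q hQ => ⟨h.mul_formula P hQ, fun hD => hD.assoc_formula P hQ⟩⟩⟩
  rw [AssocZestingDatum.rForm_single, one_mul]
  rfl
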